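/- **Solvability of the linearized current vortex sheet system.** Let $T>0$, $\mathbb{T}=\mathbb{R}/(2\pi\mathbb{Z})$, $I^+=(0,1)$, $I^-=(-1,0)$, $\Omega_0^\pm=\mathbb{T}^2\times I^\pm$ with points $y=(y',y_3)=(y_1,y_2,y_3)$, $\Gamma_0=\{y_3=0\}$ and $\Gamma^\pm=\{y_3=\pm1\}$. Here $H^\infty=\bigcap_m H^m$ is the intersection of all Sobolev spaces. Repeated indices are summed, $\alpha$ over $\{1,2,3\}$ and $j$ over $\{1,2\}$; $\nabla\cdot$ and $\Delta$ act in $y$. Fix constant states $u^{0,\pm}=(u_1^{0,\pm},u_2^{0,\pm},0)$ and $H^{0,\pm}=(H_1^{0,\pm},H_2^{0,\pm},0)$. Let $\mathbb{F}_1^\pm,\dots,\mathbb{F}_8^\pm\in H^\infty([0,T]\times\Omega_0^\pm)$, $\mathbb{G}_1^\pm,\mathbb{G}_2^\pm,\mathbb{G}_5\in H^\infty([0,T]\times\mathbb{T}^2)$ and $u_0^\pm,H_0^\pm\in H^\infty(\Omega_0^\pm)$ (with values in $\mathbb{R}^3$). Consider the problem for $(u^\pm,H^\pm,q^\pm)$: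 $$ \begin{cases} (\partial_t+u_j^{0,\pm}\partial_{y_j})u_\alpha^\pm+u_\alpha^{0,\pm}\,\nabla\cdot u^\pm-H_j^{0,\pm}\partial_{y_j}H_\alpha^\pm-H_\alpha^{0,\pm}\,\nabla\cdot H^\pm+\partial_{y_\alpha}q^\pm=\mathbb{F}_\alpha^\pm, & \alpha=1,2,3,\\ (\partial_t+u_j^{0,\pm}\partial_{y_j})H_\alpha^\pm-u_\alpha^{0,\pm}\,\nabla\cdot H^\pm-H_j^{0,\pm}\partial_{y_j}u_\alpha^\pm+H_\alpha^{0,\pm}\,\nabla\cdot u^\pm=\mathbb{F}_{3+\alpha}^\pm, & \alpha=1,2,3,\\ \nabla\cdot u^\pm=\mathbb{F}_7^\pm,\qquad \nabla\cdot H^\pm=\mathbb{F}_8^\pm & \end{cases} $$ in $[0,T]\times\Omega_0^\pm$, with the boundary and jump conditions $$ u_3^\pm|_{\Gamma^\pm}=H_3^\pm|_{\Gamma^\pm}=0,\qquad u_3^\pm|_{\Gamma_0}=\mathbb{G}_1^\pm,\qquad H_3^\pm|_{\Gamma_0}=\mathbb{G}_2^\pm,\qquad q^+|_{\Gamma_0}-q^-|_{\Gamma_0}=\mathbb{G}_5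 $$ and the initial conditions $(u^\pm,H^\pm)|_{t=0}=(u_0^\pm,H_0^\pm)$. This problem has a solution with all components in $H^\infty([0,T]\times\Omega_0^\pm)$ that is unique up to adding one and the same function of $t$ to both $q^+$ and $q^-$ if and only if all the following conditions hold: - $\mathbb{F}_6^\pm|_{\Gamma^\pm}=0$; - $\mathbb{F}_6^\pm|_{\Gamma_0}=(\partial_t+u_j^{0,\pm}\partial_{y_j})\mathbb{G}_2^\pm-H_j^{0,\pm}\partial_{y_j}\mathbb{G}_1^\pm$; - $\partial_t\mathbb{F}_8^\pm=\partial_{y_\alpha}\mathbb{F}_{3+\alpha}^\pm$; - $\nabla\cdot u_0^\pm=\mathbb{F}_7^\pm|_{t=0}$ and $\nabla\cdot H_0^\pm=\mathbb{F}_8^\pm|_{t=0}$; - $u_{0,3}^\pm|_{\Gamma^\pm}=H_{0,3}^\pm|_{\Gamma^\pm}=0$, $u_{0,3}^\pm|_{\Gamma_0}=\mathbb{G}_1^\pm|_{t=0}$, $H_{0,3}^\pm|_{\Gamma_0}=\mathbb{G}_2^\pm|_{t=0}$; - for every $t\in[0,T]$, the overdetermined coupled Laplace problem $$ \begin{cases}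 -\Delta q^\pm=-\partial_{y_\alpha}\mathbb{F}_\alpha^\pm+(\partial_t+2u_j^{0,\pm}\partial_{y_j})\mathbb{F}_7^\pm-2H_j^{0,\pm}\partial_{y_j}\mathbb{F}_8^\pm & \text{in }\Omega_0^\pm,\\ \partial_{y_3}q^\pm|_{\Gamma^\pm}=\mathbb{F}_3^\pm|_{\Gamma^\pm}, &\\ \partial_{y_3}q^\pm|_{\Gamma_0}=\mathbb{F}_3^\pm|_{\Gamma_0}-(\partial_t+u_j^{0,\pm}\partial_{y_j})\mathbb{G}_1^\pm+H_j^{0,\pm}\partial_{y_j}\mathbb{G}_2^\pm, &\\ q^+|_{\Gamma_0}-q^-|_{\Gamma_0}=\mathbb{G}_5 & \end{cases} $$ has a solution $(q^+,q^-)\in H^\infty(\Omega_0^+)\times H^\infty(\Omega_0^-)$. Likewise, the same conditions hold if and only if the problem has exactly one solution in $H^\infty([0,T]\times\Omega_0^\pm)$ whose total pressure is normalized by $$\int_{\Omega_0^+}q^+(t,y)\,dy+\int_{\Omega_0^-}q^-(t,y)\,dy=0\qquad\text{for all }t\in[0,T].$$ -/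

import Mathlib

open Set MeasureTheory
open scoped ContDiff

noncomputable section

namespace VortexSheet

/-! ### Sobolev spaces

A function on (an open subset of) `𝕋² × ℝᵏ`, with `𝕋 = ℝ / 2πℤ`, is a function on (an open subset of)
`ℝⁿ` that is `2π`-periodic in the coordinates belonging to a set `P`. -/

/-- One period cell: the coordinates in `P` range over `(0, 2π]`, the others are free. -/
def cell {n : ℕ} (P : Set (Fin n)) : Set (Fin n → ℝ) :=
  {x | ∀ i ∈ P, x i ∈ Ioc (0 : ℝ) (2 * Real.pi)}

/-- `g` is the weak (distributional) derivative of `f` in the `i`-th coordinate on the open set `D`. -/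
def IsWeakDeriv {n : ℕ} (D : Set (Fin n → ℝ)) (i : Fin n) (f g : (Fin n → ℝ) → ℝ) : Prop :=
  LocallyIntegrableOn f D ∧ LocallyIntegrableOn g D ∧
    ∀ φ : (Fin n → ℝ) → ℝ, ContDiff ℝ ∞ φ → HasCompactSupport φ → tsupport φ ⊆ D →
      ∫ x in D, f x * fderiv ℝ φ x (Pi.single i 1) = - ∫ x in D, g x * φ x

/-- The Sobolev space `H^m`: `f` and its weak derivatives up to order `m` are square integrable on one
period cell. -/
def MemSobolev {n : ℕ} (D : Set (Fin n → ℝ)) (P : Set (Fin n)) : ℕ → ((Fin n → ℝ) → ℝ) → Prop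
  | 0, f => MemLp f 2 (volume.restrict (D ∩ cell P))
  | m + 1, f => MemLp f 2 (volume.restrict (D ∩ cell P)) ∧
      ∀ i, ∃ g, IsWeakDeriv D i f g ∧ MemSobolev D P m g

/-- The space `H^∞ = ⋂ₘ H^m` of `2π`-periodic functions in the coordinates of `P`. An element of `H^∞`
is always represented by the member of its class that is continuous up to the boundary
(the domains below are slabs, so that there is exactly one such member on `closure D`);
traces on the boundary are the values of that representative. -/
structure MemHInf {n : ℕ} (D : Set (Fin n → ℝ)) (P : Set (Fin n)) (f : (Fin n → ℝ) → ℝ) : Prop where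
  continuousOn : ContinuousOn f (closure D)
  periodic : ∀ i ∈ P, ∀ x ∈ closure D, f (x + Pi.single i (2 * Real.pi)) = f x
  sobolev : ∀ m, MemSobolev D P m f

/-- The `i`-th partial derivative on the closed domain `closure D` (one-sided, from inside the domain,
at boundary points). -/
def pd {n : ℕ} (D : Set (Fin n → ℝ)) (i : Fin n) (f : (Fin n → ℝ) → ℝ) (x : Fin n → ℝ) : ℝ :=
  fderivWithin ℝ f (closure D) x (Pi.single i 1)

/-! ### Geometry -/

/-- The two sides `±` of the sheet. -/
inductive Side where
  | plus
  | minus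

/-- `I⁺ = (0, 1)` and `I⁻ = (-1, 0)`. -/
def I : Side → Set ℝ
  | .plus => Ioo 0 1
  | .minus => Ioo (-1) 0

/-- The height `±1` of the outer boundary `Γ^±`. -/
def wall : Side → ℝ
  | .plus => 1
  | .minus => -1

/-- `Ω₀^± = 𝕋² × I^±`, with points `y = (y₁, y₂, y₃)` stored as `(y 0, y 1, y 2)`. -/
def Om (s : Side) : Set (Fin 3 → ℝ) := {y | y 2 ∈ I s}

/-- The interior `(0, T) × Ω₀^±` of the space-time domain, with points `(t, y₁, y₂, y₃)`. -/
def Cyl (T : ℝ) (s : Side) : Set (Fin 4 → ℝ) := {x | x 0 ∈ Ioo 0 T ∧ x 3 ∈ I s}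

/-- The interior `(0, T) × 𝕋²` of the boundary space-time domain, with points `(t, y₁, y₂)`. -/
def BCyl (T : ℝ) : Set (Fin 3 → ℝ) := {z | z 0 ∈ Ioo 0 T}

/-- `H^∞(Ω₀^±)`. -/
abbrev HInfSpace (s : Side) (f : (Fin 3 → ℝ) → ℝ) : Prop := MemHInf (Om s) {0, 1} f

/-- `H^∞([0, T] × Ω₀^±)`. -/
abbrev HInfCyl (T : ℝ) (s : Side) (f : (Fin 4 → ℝ) → ℝ) : Prop := MemHInf (Cyl T s) {1, 2} f

/-- `H^∞([0, T] × 𝕋²)`. -/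
abbrev HInfBdry (T : ℝ) (g : (Fin 3 → ℝ) → ℝ) : Prop := MemHInf (BCyl T) {1, 2} g

/-- The point `(t, y)`. -/
def atTime {n : ℕ} (t : ℝ) (y : Fin n → ℝ) : Fin (n + 1) → ℝ := Fin.cons t y

/-- The point `(z, y₃)` with last coordinate `y₃ = a`. -/
def atHeight {n : ℕ} (a : ℝ) (z : Fin n → ℝ) : Fin (n + 1) → ℝ := Fin.snoc z a

/-! ### Data, unknowns and differential operators -/

/-- The constant background state: `u⁰ = (u⁰₁, u⁰₂, 0)` and `H⁰ = (H⁰₁, H⁰₂, 0)` on each side;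
only the tangential components are stored. -/
structure Background where
  u : Side → Fin 2 → ℝ
  H : Side → Fin 2 → ℝ

/-- The source terms: `Fu` is `(𝔽₁, 𝔽₂, 𝔽₃)`, `FH` is `(𝔽₄, 𝔽₅, 𝔽₆)`. -/
structure Sources where
  Fu : Side → Fin 3 → (Fin 4 → ℝ) → ℝ
  FH : Side → Fin 3 → (Fin 4 → ℝ) → ℝ
  F7 : Side → (Fin 4 → ℝ) → ℝ
  F8 : Side → (Fin 4 → ℝ) → ℝ
  G1 : Side → (Fin 3 → ℝ) → ℝ
  G2 : Side → (Fin 3 → ℝ) → ℝ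
  G5 : (Fin 3 → ℝ) → ℝ

/-- All source terms belong to `H^∞`. -/
structure Sources.Smooth (T : ℝ) (S : Sources) : Prop where
  Fu : ∀ s α, HInfCyl T s (S.Fu s α)
  FH : ∀ s α, HInfCyl T s (S.FH s α)
  F7 : ∀ s, HInfCyl T s (S.F7 s)
  F8 : ∀ s, HInfCyl T s (S.F8 s)
  G1 : ∀ s, HInfBdry T (S.G1 s)
  G2 : ∀ s, HInfBdry T (S.G2 s)
  G5 : HInfBdry T S.G5

/-- The initial velocity and magnetic field. -/
structure InitialData where
  u : Side → Fin 3 → (Fin 3 → ℝ) → ℝ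
  H : Side → Fin 3 → (Fin 3 → ℝ) → ℝ

/-- The initial data belong to `H^∞(Ω₀^±)`. -/
structure InitialData.Smooth (d : InitialData) : Prop where
  u : ∀ s α, HInfSpace s (d.u s α)
  H : ∀ s α, HInfSpace s (d.H s α)

/-- The unknowns `U^± = (u^±, H^±, q^±)`. -/
structure State where
  u : Side → Fin 3 → (Fin 4 → ℝ) → ℝ
  H : Side → Fin 3 → (Fin 4 → ℝ) → ℝ
  q : Side → (Fin 4 → ℝ) → ℝ

/-- The partial derivative `∂_{y_α}` in space-time. -/
def dy (T : ℝ) (s : Side) (α : Fin 3) (f : (Fin 4 → ℝ) → ℝ) : (Fin 4 → ℝ) → ℝ :=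
  pd (Cyl T s) α.succ f

/-- The partial derivative `∂_t` in space-time. -/
def dt (T : ℝ) (s : Side) (f : (Fin 4 → ℝ) → ℝ) : (Fin 4 → ℝ) → ℝ :=
  pd (Cyl T s) 0 f

/-- The tangential derivative `v_j ∂_{y_j}` (`j = 1, 2`) in space-time. -/
def tang (T : ℝ) (s : Side) (v : Fin 2 → ℝ) (f : (Fin 4 → ℝ) → ℝ) (x : Fin 4 → ℝ) : ℝ :=
  ∑ j : Fin 2, v j * dy T s j.castSucc f x

/-- The time derivative `∂_t` on `[0, T] × 𝕋²`. -/
def dtB (T : ℝ) (g : (Fin 3 → ℝ) → ℝ) : (Fin 3 → ℝ) → ℝ :=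
  pd (BCyl T) 0 g

/-- The tangential derivative `v_j ∂_{y_j}` (`j = 1, 2`) on `[0, T] × 𝕋²`. -/
def tangB (T : ℝ) (v : Fin 2 → ℝ) (g : (Fin 3 → ℝ) → ℝ) (z : Fin 3 → ℝ) : ℝ :=
  ∑ j : Fin 2, v j * pd (BCyl T) j.succ g z

/-- The divergence in `y` of a time-dependent vector field. -/
def div (T : ℝ) (s : Side) (w : Fin 3 → (Fin 4 → ℝ) → ℝ) (x : Fin 4 → ℝ) : ℝ :=
  ∑ α : Fin 3, dy T s α (w α) x

/-- The divergence of a vector field on `Ω₀^±`. -/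
def divSpace (s : Side) (w : Fin 3 → (Fin 3 → ℝ) → ℝ) (y : Fin 3 → ℝ) : ℝ :=
  ∑ α : Fin 3, pd (Om s) α (w α) y

/-- The Laplacian of a function on `Ω₀^±`. -/
def laplacian (s : Side) (p : (Fin 3 → ℝ) → ℝ) (y : Fin 3 → ℝ) : ℝ :=
  ∑ α : Fin 3, pd (Om s) α (pd (Om s) α p) y

/-! ### The linearized current vortex sheet problem -/

/-- `U` is an `H^∞` solution of the linearized current vortex sheet problem on `[0, T]`. -/
structure IsSolution (T : ℝ) (B : Background) (S : Sources) (d : InitialData) (U : State) : Prop where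
  mem_u : ∀ s α, HInfCyl T s (U.u s α)
  mem_H : ∀ s α, HInfCyl T s (U.H s α)
  mem_q : ∀ s, HInfCyl T s (U.q s)
  momentum : ∀ s, ∀ t ∈ Icc 0 T, ∀ y ∈ Om s, ∀ α : Fin 3,
    dt T s (U.u s α) (atTime t y) + tang T s (B.u s) (U.u s α) (atTime t y)
      + atHeight 0 (B.u s) α * div T s (U.u s) (atTime t y)
      - tang T s (B.H s) (U.H s α) (atTime t y)
      - atHeight 0 (B.H s) α * div T s (U.H s) (atTime t y)
      + dy T s α (U.q s) (atTime t y) = S.Fu s α (atTime t y)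
  induction : ∀ s, ∀ t ∈ Icc 0 T, ∀ y ∈ Om s, ∀ α : Fin 3,
    dt T s (U.H s α) (atTime t y) + tang T s (B.u s) (U.H s α) (atTime t y)
      - atHeight 0 (B.u s) α * div T s (U.H s) (atTime t y)
      - tang T s (B.H s) (U.u s α) (atTime t y)
      + atHeight 0 (B.H s) α * div T s (U.u s) (atTime t y) = S.FH s α (atTime t y)
  div_u : ∀ s, ∀ t ∈ Icc 0 T, ∀ y ∈ Om s, div T s (U.u s) (atTime t y) = S.F7 s (atTime t y)
  div_H : ∀ s, ∀ t ∈ Icc 0 T, ∀ y ∈ Om s, div T s (U.H s) (atTime t y) = S.F8 s (atTime t y)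
  wall_u : ∀ s, ∀ t ∈ Icc 0 T, ∀ y' : Fin 2 → ℝ, U.u s 2 (atTime t (atHeight (wall s) y')) = 0
  wall_H : ∀ s, ∀ t ∈ Icc 0 T, ∀ y' : Fin 2 → ℝ, U.H s 2 (atTime t (atHeight (wall s) y')) = 0
  sheet_u : ∀ s, ∀ t ∈ Icc 0 T, ∀ y' : Fin 2 → ℝ,
    U.u s 2 (atTime t (atHeight 0 y')) = S.G1 s (atTime t y')
  sheet_H : ∀ s, ∀ t ∈ Icc 0 T, ∀ y' : Fin 2 → ℝ,
    U.H s 2 (atTime t (atHeight 0 y')) = S.G2 s (atTime t y')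
  sheet_q : ∀ t ∈ Icc 0 T, ∀ y' : Fin 2 → ℝ,
    U.q .plus (atTime t (atHeight 0 y')) - U.q .minus (atTime t (atHeight 0 y'))
      = S.G5 (atTime t y')
  init_u : ∀ s α, ∀ y ∈ Om s, U.u s α (atTime 0 y) = d.u s α y
  init_H : ∀ s α, ∀ y ∈ Om s, U.H s α (atTime 0 y) = d.H s α y

/-- `U` and `V` coincide on `[0, T] × Ω₀^±`, except that the two total pressures `q⁺`, `q⁻` of `V` may
both have been shifted by one and the same function of time. -/
def EqUpToPressureShift (T : ℝ) (U V : State) : Prop :=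
  ∃ c : ℝ → ℝ, ∀ s, ∀ x ∈ closure (Cyl T s),
    (∀ α, V.u s α x = U.u s α x) ∧ (∀ α, V.H s α x = U.H s α x) ∧ V.q s x = U.q s x + c (x 0)

/-- `U` and `V` coincide on `[0, T] × Ω₀^±`. -/
def EqOnDomain (T : ℝ) (U V : State) : Prop :=
  ∀ s, ∀ x ∈ closure (Cyl T s),
    (∀ α, V.u s α x = U.u s α x) ∧ (∀ α, V.H s α x = U.H s α x) ∧ V.q s x = U.q s x

/-- The total pressure has zero mean at every time:
`∫_{Ω₀⁺} q⁺(t, y) dy + ∫_{Ω₀⁻} q⁻(t, y) dy = 0`. -/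
def Normalized (T : ℝ) (U : State) : Prop :=
  ∀ t ∈ Icc 0 T,
    (∫ y in Om .plus ∩ cell {0, 1}, U.q .plus (atTime t y))
      + (∫ y in Om .minus ∩ cell {0, 1}, U.q .minus (atTime t y)) = 0

/-- `(q⁺, q⁻) ∈ H^∞(Ω₀⁺) × H^∞(Ω₀⁻)` solves the coupled Laplace problem at time `t`. -/
structure IsLaplaceSolution (T : ℝ) (B : Background) (S : Sources) (t : ℝ)
    (p : Side → (Fin 3 → ℝ) → ℝ) : Prop where
  mem : ∀ s, HInfSpace s (p s)
  interior : ∀ s, ∀ y ∈ Om s,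
    - laplacian s (p s) y = - (∑ α : Fin 3, dy T s α (S.Fu s α) (atTime t y))
      + (dt T s (S.F7 s) (atTime t y) + 2 * tang T s (B.u s) (S.F7 s) (atTime t y))
      - 2 * tang T s (B.H s) (S.F8 s) (atTime t y)
  outer : ∀ s, ∀ y' : Fin 2 → ℝ,
    pd (Om s) 2 (p s) (atHeight (wall s) y') = S.Fu s 2 (atTime t (atHeight (wall s) y'))
  sheet : ∀ s, ∀ y' : Fin 2 → ℝ,
    pd (Om s) 2 (p s) (atHeight 0 y') = S.Fu s 2 (atTime t (atHeight 0 y'))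
      - (dtB T (S.G1 s) (atTime t y') + tangB T (B.u s) (S.G1 s) (atTime t y'))
      + tangB T (B.H s) (S.G2 s) (atTime t y')
  jump : ∀ y' : Fin 2 → ℝ,
    p .plus (atHeight 0 y') - p .minus (atHeight 0 y') = S.G5 (atTime t y')

/-- The compatibility conditions on the source terms and the initial data. -/
structure Compatible (T : ℝ) (B : Background) (S : Sources) (d : InitialData) : Prop where
  wall_F6 : ∀ s, ∀ t ∈ Icc 0 T, ∀ y' : Fin 2 → ℝ, S.FH s 2 (atTime t (atHeight (wall s) y')) = 0
  sheet_F6 : ∀ s, ∀ t ∈ Icc 0 T, ∀ y' : Fin 2 → ℝ,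
    S.FH s 2 (atTime t (atHeight 0 y'))
      = dtB T (S.G2 s) (atTime t y') + tangB T (B.u s) (S.G2 s) (atTime t y')
        - tangB T (B.H s) (S.G1 s) (atTime t y')
  div_sources : ∀ s, ∀ t ∈ Icc 0 T, ∀ y ∈ Om s,
    dt T s (S.F8 s) (atTime t y) = ∑ α : Fin 3, dy T s α (S.FH s α) (atTime t y)
  div_init_u : ∀ s, ∀ y ∈ Om s, divSpace s (d.u s) y = S.F7 s (atTime 0 y)
  div_init_H : ∀ s, ∀ y ∈ Om s, divSpace s (d.H s) y = S.F8 s (atTime 0 y)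
  wall_init_u : ∀ s, ∀ y' : Fin 2 → ℝ, d.u s 2 (atHeight (wall s) y') = 0
  wall_init_H : ∀ s, ∀ y' : Fin 2 → ℝ, d.H s 2 (atHeight (wall s) y') = 0
  sheet_init_u : ∀ s, ∀ y' : Fin 2 → ℝ, d.u s 2 (atHeight 0 y') = S.G1 s (atTime 0 y')
  sheet_init_H : ∀ s, ∀ y' : Fin 2 → ℝ, d.H s 2 (atHeight 0 y') = S.G2 s (atTime 0 y')
  laplace : ∀ t ∈ Icc 0 T, ∃ p, IsLaplaceSolution T B S t p

end VortexSheet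

end

noncomputable section

namespace VortexSheet

/-! ### Weak derivatives -/

section Weak

variable {n : ℕ} {D : Set (Fin n → ℝ)} {P : Set (Fin n)} {i j : Fin n}
  {f g h : (Fin n → ℝ) → ℝ}

/-! The fields and the total pressure can be treated separately. Once the divergences are replaced
by `F7` and `F8`, the momentum equation plus ε times the induction equation, with ε = ±1, is a
scalar transport equation for each component of the Elsässer variable w = u + εH. Its operator is
∂_t + (u⁰ − εH⁰)·∇, and the pressure enters only through its gradient in the source `elsSource`. The
velocity is constant and tangential, so characteristics never leave the slab: for given q and
initial data there is exactly one solution (`exists_transport`, `IsSmooth.eq_zero_of_mat`), and no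
boundary value may be prescribed.

The constraints on w, namely its divergence and the traces of w₃ on the wall and on the sheet, obey
transport equations of their own, because the operator commutes with the divergence and with
restriction to horizontal planes. They persist exactly when they hold initially and the source
satisfies `IsElsCompat`. Sorting the conditions for ε = 1 and ε = −1 by parity in ε, the even part
is the Neumann problem `IsPressure` for q and the odd part is the relation `IsSourceCompat` between
the induction sources. Applying the transport operator to the constraints gives necessity
(`IsSolution.compatible`). Solving the transport equations gives sufficiency
(`Compatible.exists_isSolution`), as soon as a pressure smooth in space and time is known.

Such a pressure is the analytic core. The compatibility condition supplies a solution of the Laplace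
problem at each time, with no relation between different times. On a flat slab tangential
derivatives preserve the homogeneous Neumann condition and commute with Δ. An energy estimate
therefore bounds second derivatives containing a tangential one, the identity ∂₃² = Δ − ∂₁² − ∂₂²
supplies the others, and a Sobolev inequality turns L² into sup bounds (`exists_supE_le`). After
subtracting a lift of the boundary data and normalising at the origin, every derivative of the
pressure is thus a bounded linear function of finitely many L² derivatives of its Laplacian
(`exists_neumann_operator`). The source is a smooth L²-valued curve in time, so the pressure is
smooth in time as well (`IsNeumann.isSmooth_of_time`, `exists_smooth_pressure`). No existence theory
for the Neumann problem is needed.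

The same estimate shows that two pressures differ by one constant per side and time, and the jump
condition makes the two constants equal. The gradients then agree, so the fields agree by uniqueness
for transport (`IsSolution.eqUpToPressureShift`). Uniqueness is therefore automatic, and both
equivalences are about existence; the normalised form follows by subtracting the spatial mean.

All of this is carried out for functions smooth up to the boundary. `memHInf_iff_isSmooth`
identifies them with H^∞: mollifications of a weak derivative are bounded uniformly by L¹ norms on
cubes, which gives Lipschitz representatives of all weak derivatives and then classical derivatives.
-/

lemma two_le_infty : (2 : WithTop ℕ∞) ≤ ∞ :=
  WithTop.coe_le_coe.2 (le_top : (2 : ℕ∞) ≤ ⊤)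

/-- The `i`-th partial derivative of a function on the whole space. -/
abbrev partialD (i : Fin n) (φ : (Fin n → ℝ) → ℝ) (x : Fin n → ℝ) : ℝ :=
  fderiv ℝ φ x (Pi.single i 1)

lemma integrable_mul_of_tsupport_subset (hf : LocallyIntegrableOn f D) {φ : (Fin n → ℝ) → ℝ}
    (hφ : Continuous φ) (hc : HasCompactSupport φ) (hs : tsupport φ ⊆ D) :
    Integrable (fun x => f x * φ x) := by
  have h1 : IntegrableOn f (tsupport φ) := hf.integrableOn_compact_subset hs hc
  have h2 : IntegrableOn (fun x => f x * φ x) (tsupport φ) :=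
    h1.mul_continuousOn hφ.continuousOn hc
  rw [integrableOn_iff_integrable_of_support_subset] at h2
  · exact h2
  · intro x hx
    apply subset_tsupport
    intro h0
    exact hx (by simp [h0])

lemma setIntegral_eq_of_tsupport_subset {φ : (Fin n → ℝ) → ℝ} (hs : tsupport φ ⊆ D) :
    ∫ x in D, f x * φ x = ∫ x, f x * φ x := by
  apply setIntegral_eq_integral_of_forall_compl_eq_zero
  intro x hx
  rw [image_eq_zero_of_notMem_tsupport (fun h => hx (hs h)), mul_zero]

lemma tsupport_partialD_subset (φ : (Fin n → ℝ) → ℝ) : tsupport (partialD i φ) ⊆ tsupport φ :=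
  tsupport_fderiv_apply_subset ℝ (f := φ) (Pi.single i 1)

lemma hasCompactSupport_partialD {φ : (Fin n → ℝ) → ℝ} (hc : HasCompactSupport φ) :
    HasCompactSupport (partialD i φ) :=
  hc.of_isClosed_subset (isClosed_tsupport _) (tsupport_partialD_subset φ)

lemma contDiff_partialD {φ : (Fin n → ℝ) → ℝ} (hφ : ContDiff ℝ ∞ φ) :
    ContDiff ℝ ∞ (partialD i φ) :=
  (hφ.fderiv_right (m := ∞) (by simp)).clm_apply contDiff_const

lemma partialD_comm {φ : (Fin n → ℝ) → ℝ} (hφ : ContDiff ℝ ∞ φ) :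
    partialD i (partialD j φ) = partialD j (partialD i φ) := by
  funext x
  have h2 : IsSymmSndFDerivAt ℝ φ x := hφ.contDiffAt.isSymmSndFDerivAt (by simpa using two_le_infty)
  have hd : DifferentiableAt ℝ (fderiv ℝ φ) x :=
    ((hφ.fderiv_right (m := ∞) (by simp)).differentiable (by simp)) x
  have key : ∀ k l : Fin n, partialD k (partialD l φ) x
      = fderiv ℝ (fderiv ℝ φ) x (Pi.single k 1) (Pi.single l 1) := by
    intro k l
    unfold partialD
    rw [fderiv_clm_apply hd (by fun_prop)]
    simp
  rw [key, key]
  exact h2 _ _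

/-- Both candidates pair equally with every test function, so the fundamental lemma of the calculus
of variations applies. This allows the weak derivatives supplied separately at each Sobolev order to
be taken to be one and the same function. -/
lemma IsWeakDeriv.ae_unique (hD : IsOpen D) {g' : (Fin n → ℝ) → ℝ} (h1 : IsWeakDeriv D i f g)
    (h2 : IsWeakDeriv D i f g') : g =ᵐ[volume.restrict D] g' := by
  have h3 : LocallyIntegrableOn (fun x => g x - g' x) D := h1.2.1.sub h2.2.1
  have := hD.ae_eq_zero_of_integral_contDiff_smul_eq_zero h3 (μ := volume) ?_
  · rw [Filter.EventuallyEq, ae_restrict_iff' hD.measurableSet]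
    filter_upwards [this] with x hx hxD
    exact sub_eq_zero.mp (hx hxD)
  · intro φ hφ hc hs
    have e1 := h1.2.2 φ hφ hc hs
    have e2 := h2.2.2 φ hφ hc hs
    rw [e1, neg_inj, setIntegral_eq_of_tsupport_subset hs, setIntegral_eq_of_tsupport_subset hs]
      at e2
    have i1 := integrable_mul_of_tsupport_subset h1.2.1 hφ.continuous hc hs
    have i2 := integrable_mul_of_tsupport_subset h2.2.1 hφ.continuous hc hs
    calc ∫ x, φ x • (g x - g' x) = ∫ x, (g x * φ x - g' x * φ x) := by
          congr 1; ext x; simp only [smul_eq_mul]; ring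
      _ = 0 := by rw [integral_sub i1 i2, e2, sub_self]

lemma IsWeakDeriv.congr {f' g' : (Fin n → ℝ) → ℝ} (h1 : IsWeakDeriv D i f g)
    (hf : f =ᵐ[volume.restrict D] f') (hg : g =ᵐ[volume.restrict D] g') :
    IsWeakDeriv D i f' g' := by
  refine ⟨h1.1.congr hf, h1.2.1.congr hg, fun φ hφ hc hs => ?_⟩
  have e := h1.2.2 φ hφ hc hs
  have e1 : ∫ x in D, f x * fderiv ℝ φ x (Pi.single i 1)
      = ∫ x in D, f' x * fderiv ℝ φ x (Pi.single i 1) :=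
    integral_congr_ae (by filter_upwards [hf] with x hx; simp only [hx])
  have e2 : ∫ x in D, g x * φ x = ∫ x in D, g' x * φ x :=
    integral_congr_ae (by filter_upwards [hg] with x hx; simp only [hx])
  rwa [e1, e2] at e

lemma LocallyIntegrableOn.comp_add (hf : LocallyIntegrableOn f D) {v : Fin n → ℝ}
    (hv : ∀ x, x + v ∈ D ↔ x ∈ D) : LocallyIntegrableOn (fun x => f (x + v)) D := by
  intro x hx
  obtain ⟨s, hs, hi⟩ := hf (x + v) ((hv x).2 hx)
  refine ⟨(fun x => x + v) ⁻¹' s, ?_, ?_⟩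
  · have hc : ContinuousAt (fun x : Fin n → ℝ => x + v) x := by fun_prop
    have : Filter.Tendsto (fun x : Fin n → ℝ => x + v) (nhdsWithin x D) (nhdsWithin (x + v) D) :=
      tendsto_nhdsWithin_iff.2 ⟨hc.tendsto.mono_left nhdsWithin_le_nhds,
        Filter.eventually_of_mem self_mem_nhdsWithin fun y hy => (hv y).2 hy⟩
    exact this hs
  · exact ((measurePreserving_add_right volume v).integrableOn_comp_preimage
      (measurableEmbedding_addRight v)).2 hi

/-- The translation is moved onto the test function. Applied to lattice vectors, this lets weak
derivatives inherit periodicity. -/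
lemma IsWeakDeriv.comp_add (h1 : IsWeakDeriv D i f g) {v : Fin n → ℝ}
    (hv : ∀ x, x + v ∈ D ↔ x ∈ D) :
    IsWeakDeriv D i (fun x => f (x + v)) (fun x => g (x + v)) := by
  refine ⟨LocallyIntegrableOn.comp_add h1.1 hv, LocallyIntegrableOn.comp_add h1.2.1 hv,
    fun φ hφ hc hs => ?_⟩
  set ψ : (Fin n → ℝ) → ℝ := fun x => φ (x - v) with hψ
  have hψs : ContDiff ℝ ∞ ψ := hφ.comp (contDiff_id.sub contDiff_const)
  have hts : tsupport ψ = (Homeomorph.addRight (-v)) ⁻¹' tsupport φ := by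
    have := tsupport_comp_eq_preimage φ (Homeomorph.addRight (-v))
    rw [← this]; rfl
  have hψc : HasCompactSupport ψ := by
    have := hc.comp_homeomorph (Homeomorph.addRight (-v))
    exact this
  have hψD : tsupport ψ ⊆ D := by
    rw [hts]
    intro x hx
    have h3 : x + -v ∈ D := hs hx
    have := (hv (x + -v)).2 h3
    simpa using this
  have e := h1.2.2 ψ hψs hψc hψD
  have hpre : (fun x : Fin n → ℝ => x + v) ⁻¹' D = D := by
    ext x; exact hv x
  have tr : ∀ F : (Fin n → ℝ) → ℝ, ∫ x in D, F (x + v) = ∫ x in D, F x := by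
    intro F
    have := (measurePreserving_add_right (volume : Measure (Fin n → ℝ)) v).setIntegral_preimage_emb
      (measurableEmbedding_addRight v) F D
    rwa [hpre] at this
  have hfd : ∀ x, fderiv ℝ ψ x = fderiv ℝ φ (x - v) := fun x => by
    simp only [hψ]; exact fderiv_comp_sub v
  rw [← tr (fun x => f x * fderiv ℝ ψ x (Pi.single i 1)), ← tr (fun x => g x * ψ x)] at e
  simp only [hfd] at e
  simpa [hψ] using e

/-- Integration by parts in a single direction; the test function removes the boundary terms. Asking
only for a line derivative matters where joint differentiability is not yet known, as for parameter
integrals and for time-dependent solutions of the Neumann problem. -/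
lemma IsWeakDeriv.of_hasLineDerivAt (hf : ContinuousOn f D) (hg : ContinuousOn g D)
    (hD : IsOpen D)
    (h : ∀ x ∈ D, HasLineDerivAt ℝ f (g x) x (Pi.single i 1)) : IsWeakDeriv D i f g := by
  have lf := hf.locallyIntegrableOn (μ := volume) hD.measurableSet
  have lg := hg.locallyIntegrableOn (μ := volume) hD.measurableSet
  refine ⟨lf, lg, fun φ hφ hc hs => ?_⟩
  have hs' : tsupport (partialD i φ) ⊆ D := (tsupport_partialD_subset φ).trans hs
  have e1 : ∫ x in D, f x * fderiv ℝ φ x (Pi.single i 1) = ∫ x, f x * partialD i φ x :=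
    setIntegral_eq_of_tsupport_subset hs'
  rw [e1, setIntegral_eq_of_tsupport_subset hs]
  have := integral_bilinear_hasLineDerivAt_right_eq_neg_left_of_integrable
    (μ := (volume : Measure (Fin n → ℝ))) (f := f) (f' := g) (g := φ) (g' := partialD i φ)
    (v := Pi.single i 1) (B := ContinuousLinearMap.mul ℝ ℝ) ?_ ?_ ?_ ?_ ?_
  · simpa using this
  · simpa using integrable_mul_of_tsupport_subset lg hφ.continuous hc hs
  · simpa using integrable_mul_of_tsupport_subset lf (contDiff_partialD hφ).continuous
      (hasCompactSupport_partialD hc) hs'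
  · simpa using integrable_mul_of_tsupport_subset lf hφ.continuous hc hs
  · exact fun x hx => h x (hs hx)
  · exact fun x _ => ((hφ.differentiable (by simp)) x).hasFDerivAt.hasLineDerivAt _

/-- If `∂ᵢ f = h`, `∂ⱼ f = g` and `∂ⱼ h = m`, then `∂ᵢ g = m`. -/
lemma IsWeakDeriv.swap {m : (Fin n → ℝ) → ℝ} (hi : IsWeakDeriv D i f h)
    (hj : IsWeakDeriv D j f g) (hm : IsWeakDeriv D j h m) : IsWeakDeriv D i g m := by
  refine ⟨hj.2.1, hm.2.1, fun φ hφ hc hs => ?_⟩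
  have s1 : ∀ k, tsupport (partialD k φ) ⊆ D := fun k => (tsupport_partialD_subset φ).trans hs
  have a := hj.2.2 (partialD i φ) (contDiff_partialD hφ) (hasCompactSupport_partialD hc) (s1 i)
  have b := hi.2.2 (partialD j φ) (contDiff_partialD hφ) (hasCompactSupport_partialD hc) (s1 j)
  have c := hm.2.2 φ hφ hc hs
  -- The order of differentiation is exchanged on the test function, where it is classical.
  have e : ∀ x, fderiv ℝ (partialD i φ) x (Pi.single j 1)
      = fderiv ℝ (partialD j φ) x (Pi.single i 1) :=
    fun x => congrFun (partialD_comm (i := j) (j := i) hφ) x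
  simp only [e] at a
  rw [b] at a
  have c' : ∫ x in D, h x * partialD j φ x = -∫ x in D, m x * φ x := c
  rw [c'] at a
  show ∫ x in D, g x * partialD i φ x = _
  linarith

lemma MemSobolev.congr (m : ℕ) : ∀ {f f' : (Fin n → ℝ) → ℝ}, MemSobolev D P m f →
    f =ᵐ[volume.restrict D] f' → MemSobolev D P m f' := by
  have aux : ∀ {f f' : (Fin n → ℝ) → ℝ}, f =ᵐ[volume.restrict D] f' →
      f =ᵐ[volume.restrict (D ∩ cell P)] f' := fun h =>
    ae_restrict_of_ae_restrict_of_subset inter_subset_left h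
  cases m with
  | zero => exact fun {f f'} h1 h2 => (memLp_congr_ae (aux h2)).1 h1
  | succ m =>
    intro f f' h1 h2
    refine ⟨(memLp_congr_ae (aux h2)).1 h1.1, fun i => ?_⟩
    obtain ⟨g, hg, hm⟩ := h1.2 i
    exact ⟨g, hg.congr h2 Filter.EventuallyEq.rfl, hm⟩

lemma MemSobolev.memLp {m : ℕ} (h : MemSobolev D P m f) :
    MemLp f 2 (volume.restrict (D ∩ cell P)) := by
  cases m with
  | zero => exact h
  | succ m => exact h.1

/-- Weak derivatives of functions in all `H^m` are in all `H^m`. -/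
lemma exists_weakDeriv_forall_memSobolev (hD : IsOpen D) (h : ∀ m, MemSobolev D P m f)
    (i : Fin n) : ∃ g, IsWeakDeriv D i f g ∧ ∀ m, MemSobolev D P m g := by
  obtain ⟨g, hg, -⟩ := (h 1).2 i
  refine ⟨g, hg, fun m => ?_⟩
  obtain ⟨g', hg', hm⟩ := (h (m + 1)).2 i
  exact hm.congr m (hg'.ae_unique hD hg)

/-- A function in all `H^m` together with a compatible choice of all its weak derivatives. -/
lemma exists_weak_tower (hD : IsOpen D) (h : ∀ m, MemSobolev D P m f) :
    ∃ F : List (Fin n) → (Fin n → ℝ) → ℝ, F [] = f ∧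
      (∀ w i, IsWeakDeriv D i (F w) (F (i :: w))) ∧
      ∀ w, MemLp (F w) 2 (volume.restrict (D ∩ cell P)) := by
  choose G hG using fun (a : {f : (Fin n → ℝ) → ℝ // ∀ m, MemSobolev D P m f}) (i : Fin n) =>
    exists_weakDeriv_forall_memSobolev hD a.2 i
  let F : List (Fin n) → {f : (Fin n → ℝ) → ℝ // ∀ m, MemSobolev D P m f} := fun w =>
    List.rec ⟨f, h⟩ (fun i _ a => ⟨G a i, (hG a i).2⟩) w
  exact ⟨fun w => (F w).1, rfl, fun w i => (hG (F w) i).1, fun w => ((F w).2 0).memLp⟩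

/-- Coinduction principle: a family of functions that is closed under weak derivatives and consists
of functions square integrable on a cell lies in all `H^m`. -/
lemma memSobolev_of_closed {C : Set ((Fin n → ℝ) → ℝ)}
    (h2 : ∀ f ∈ C, MemLp f 2 (volume.restrict (D ∩ cell P)))
    (hd : ∀ f ∈ C, ∀ i, ∃ g ∈ C, IsWeakDeriv D i f g) (m : ℕ) :
    ∀ f ∈ C, MemSobolev D P m f := by
  induction m with
  | zero => exact h2
  | succ m ih =>
    intro f hf
    refine ⟨h2 f hf, fun i => ?_⟩
    obtain ⟨g, hg, hfg⟩ := hd f hf i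
    exact ⟨g, hfg, ih g hg⟩

end Weak

/-! ### A sup estimate by integrals of derivatives -/

section SupEstimate

open scoped ENNReal

lemma hasDerivAt_update_of_hasLineDerivAt {n : ℕ} {f : (Fin n → ℝ) → ℝ} {f' : ℝ} {i : Fin n}
    {x : Fin n → ℝ} {s : ℝ}
    (h : HasLineDerivAt ℝ f f' (Function.update x i s) (Pi.single i 1)) :
    HasDerivAt (fun r => f (Function.update x i r)) f' s := by
  have e : ∀ t : ℝ, Function.update x i s + t • Pi.single i (1 : ℝ)
      = Function.update x i (s + t) := by
    intro t; ext j
    by_cases hj : j = i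
    · subst hj; simp
    · simp [hj]
  unfold HasLineDerivAt at h
  simp only [e] at h
  have h2 : HasDerivAt (fun t => f (Function.update x i (s + t))) f' (s - s) := by simpa using h
  simpa using h2.comp_sub_const s s

/-- Average the inequality |h(s₀)| ≤ |h(s)| + ∫|h'| over s in the interval: the embedding of W^{1,1}
into L^∞ in one dimension. -/
lemma enorm_le_lintegral_add {h h' : ℝ → ℝ} {c l s₀ : ℝ} (hl : 0 < l)
    (hd : ∀ s ∈ Icc c (c + l), HasDerivAt h (h' s) s) (hc : ContinuousOn h' (Icc c (c + l)))
    (hs : s₀ ∈ Icc c (c + l)) :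
    ‖h s₀‖ₑ ≤ (ENNReal.ofReal l⁻¹ + 1) * ∫⁻ s in Icc c (c + l), (‖h s‖ₑ + ‖h' s‖ₑ) := by
  have hch : ContinuousOn h (Icc c (c + l)) := fun s hs => (hd s hs).continuousAt.continuousWithinAt
  have key : ∀ s ∈ Icc c (c + l), ‖h s₀‖ₑ ≤ ‖h s‖ₑ + ∫⁻ r in Icc c (c + l), ‖h' r‖ₑ := by
    intro s hs'
    have hsub : uIcc s s₀ ⊆ Icc c (c + l) := uIcc_subset_Icc hs' hs
    have e : ∫ r in s..s₀, h' r = h s₀ - h s :=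
      intervalIntegral.integral_eq_sub_of_hasDerivAt (fun r hr => hd r (hsub hr))
        ((hc.mono hsub).intervalIntegrable)
    have e2 : ‖h s₀ - h s‖ₑ ≤ ∫⁻ r in Icc c (c + l), ‖h' r‖ₑ := by
      rw [← e]
      have : ‖∫ r in s..s₀, h' r‖ₑ = ‖∫ r in uIoc s s₀, h' r‖ₑ := by
        rw [← enorm_norm, intervalIntegral.norm_integral_eq_norm_integral_uIoc, enorm_norm]
      rw [this]
      exact (enorm_integral_le_lintegral_enorm _).trans
        (lintegral_mono_set (uIoc_subset_uIcc.trans hsub))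
    calc ‖h s₀‖ₑ = ‖h s + (h s₀ - h s)‖ₑ := by congr 1; ring
      _ ≤ ‖h s‖ₑ + ‖h s₀ - h s‖ₑ := enorm_add_le _ _
      _ ≤ _ := by gcongr
  have hm : AEMeasurable (fun s => ‖h s‖ₑ) (volume.restrict (Icc c (c + l))) :=
    (hch.aestronglyMeasurable measurableSet_Icc).enorm
  set A := ∫⁻ s in Icc c (c + l), ‖h s‖ₑ
  set B := ∫⁻ s in Icc c (c + l), ‖h' s‖ₑ
  have hvol : (volume : Measure ℝ) (Icc c (c + l)) = ENNReal.ofReal l := by simp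
  have h1 : ‖h s₀‖ₑ * ENNReal.ofReal l ≤ A + B * ENNReal.ofReal l := by
    calc ‖h s₀‖ₑ * ENNReal.ofReal l = ∫⁻ _ in Icc c (c + l), ‖h s₀‖ₑ := by
          rw [setLIntegral_const, hvol]
      _ ≤ ∫⁻ s in Icc c (c + l), (‖h s‖ₑ + B) := setLIntegral_mono' measurableSet_Icc key
      _ = A + B * ENNReal.ofReal l := by
          rw [lintegral_add_left' hm, setLIntegral_const, hvol]
  have hl0 : ENNReal.ofReal l * ENNReal.ofReal l⁻¹ = 1 := by
    rw [← ENNReal.ofReal_mul hl.le, mul_inv_cancel₀ hl.ne', ENNReal.ofReal_one]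
  rw [lintegral_add_left' hm]
  calc ‖h s₀‖ₑ = ‖h s₀‖ₑ * ENNReal.ofReal l * ENNReal.ofReal l⁻¹ := by rw [mul_assoc, hl0, mul_one]
    _ ≤ (A + B * ENNReal.ofReal l) * ENNReal.ofReal l⁻¹ := by gcongr
    _ = ENNReal.ofReal l⁻¹ * A + 1 * B := by rw [add_mul, mul_assoc, hl0]; ring
    _ ≤ (ENNReal.ofReal l⁻¹ + 1) * A + (ENNReal.ofReal l⁻¹ + 1) * B := by
        gcongr
        · exact le_self_add
        · exact le_add_self
    _ = _ := by ring

/-- A weighted sum of the `b v`, over words `v` that extend `w` by at most `k` letters. -/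
def towerBound {n : ℕ} (K : ℝ≥0∞) : ℕ → (List (Fin n) → ℝ≥0∞) → List (Fin n) → ℝ≥0∞
  | 0, b, w => b w
  | k + 1, b, w => K * (towerBound K k b w + ∑ i, towerBound K k b (i :: w))

lemma towerBound_mono {n : ℕ} {K : ℝ≥0∞} {b b' : List (Fin n) → ℝ≥0∞} (h : ∀ w, b w ≤ b' w)
    (k : ℕ) : ∀ w, towerBound K k b w ≤ towerBound K k b' w := by
  induction k with
  | zero => exact h
  | succ k ih =>
    intro w
    simp only [towerBound]
    gcongr
    · exact ih w
    · exact ih _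

lemma towerBound_lt_top {n : ℕ} {K : ℝ≥0∞} (hK : K ≠ ⊤) {b : List (Fin n) → ℝ≥0∞}
    (h : ∀ w, b w ≠ ⊤) (k : ℕ) : ∀ w, towerBound K k b w ≠ ⊤ := by
  induction k with
  | zero => exact h
  | succ k ih =>
    intro w
    simp only [towerBound]
    refine ENNReal.mul_ne_top hK (ENNReal.add_ne_top.2 ⟨ih w, ?_⟩)
    exact ENNReal.sum_ne_top.2 fun i _ => ih _

lemma measurable_towerBound {n : ℕ} {X : Type*} [MeasurableSpace X] {K : ℝ≥0∞}
    {g : List (Fin n) → X → ℝ≥0∞} (hg : ∀ w, Measurable (g w)) (k : ℕ) :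
    ∀ w, Measurable fun x => towerBound K k (fun v => g v x) w := by
  induction k with
  | zero => exact hg
  | succ k ih =>
    intro w
    simp only [towerBound]
    exact ((ih w).add (Finset.measurable_sum _ fun i _ => ih _)).const_mul _

lemma lintegral_const_mul_add_sum {X ι : Type*} [Fintype ι] [MeasurableSpace X] {μ : Measure X}
    (K : ℝ≥0∞) {f : X → ℝ≥0∞} {g : ι → X → ℝ≥0∞} (hf : Measurable f) (hg : ∀ i, Measurable (g i)) :
    ∫⁻ x, K * (f x + ∑ i, g i x) ∂μ = K * (∫⁻ x, f x ∂μ + ∑ i, ∫⁻ x, g i x ∂μ) := by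
  have hs : Measurable fun x => ∑ i, g i x := Finset.measurable_sum _ fun i _ => hg i
  have h1 := lintegral_const_mul (μ := μ) K (hf.add hs)
  simp only [Pi.add_apply] at h1
  rw [h1, lintegral_add_left hf, lintegral_finsetSum _ fun i _ => hg i]

lemma measurable_indicator_of_continuousOn {X : Type*} [TopologicalSpace X] [MeasurableSpace X]
    [BorelSpace X] {s : Set X} {f : X → ℝ} (hf : ContinuousOn f s) (hs : MeasurableSet s) :
    Measurable (s.indicator f) := by
  classical
  rw [← piecewise_eq_indicator]
  exact hf.measurable_piecewise (continuousOn_const (c := (0 : ℝ))) hs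

lemma lintegral_towerBound {n : ℕ} {X : Type*} [MeasurableSpace X] {μ : Measure X} {K : ℝ≥0∞}
    {g : List (Fin n) → X → ℝ≥0∞} (hg : ∀ w, Measurable (g w)) (k : ℕ) :
    ∀ w, ∫⁻ x, towerBound K k (fun v => g v x) w ∂μ
      = towerBound K k (fun v => ∫⁻ x, g v x ∂μ) w := by
  induction k with
  | zero => exact fun w => rfl
  | succ k ih =>
    intro w
    simp only [towerBound]
    have hm := fun w => measurable_towerBound (K := K) hg k w
    rw [lintegral_const_mul_add_sum K (hm w) fun i => hm (i :: w)]
    simp only [ih]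

/-- A tower: `G (i :: w)` is the `i`-th partial derivative of `G w`. -/
structure IsTower {n : ℕ} (U : Set (Fin n → ℝ)) (G : List (Fin n) → (Fin n → ℝ) → ℝ) : Prop where
  continuousOn : ∀ w, ContinuousOn (G w) U
  hasLineDerivAt : ∀ w i, ∀ x ∈ U, HasLineDerivAt ℝ (G w) (G (i :: w) x) x (Pi.single i 1)

lemma IsTower.mono {n : ℕ} {U V : Set (Fin n → ℝ)} {G : List (Fin n) → (Fin n → ℝ) → ℝ}
    (h : IsTower U G) (hV : V ⊆ U) : IsTower V G :=
  ⟨fun w => (h.continuousOn w).mono hV, fun w i x hx => h.hasLineDerivAt w i x (hV hx)⟩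

variable {n : ℕ} {G : List (Fin n) → (Fin n → ℝ) → ℝ} {c : Fin n → ℝ} {l : ℝ}

lemma update_mem_Icc {x a b : Fin n → ℝ} (hx : x ∈ Icc a b) {i : Fin n} {s : ℝ}
    (hs : s ∈ Icc (a i) (b i)) : Function.update x i s ∈ Icc a b := by
  refine ⟨fun j => ?_, fun j => ?_⟩ <;> by_cases hj : j = i
  · subst hj; simpa using hs.1
  · simpa [hj] using hx.1 j
  · subst hj; simpa using hs.2
  · simpa [hj] using hx.2 j

/-- The one-dimensional estimate along coordinate `i`, applied to every term of the bound; each use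
costs one more level of derivatives. The indicators make the integrands measurable on the whole
space, as iterated integration requires. -/
lemma IsTower.towerBound_le_lintegral (hl : 0 < l) (hG : IsTower (Icc c fun i => c i + l) G)
    (i : Fin n) (k : ℕ) :
    ∀ w, ∀ x ∈ Icc c (fun i => c i + l),
      towerBound (ENNReal.ofReal l⁻¹ + 1) k
        (fun v => ‖(Icc c fun i => c i + l).indicator (G v) x‖ₑ) w ≤
      ∫⁻ s in Icc (c i) (c i + l), towerBound (ENNReal.ofReal l⁻¹ + 1) (k + 1)
        (fun v => ‖(Icc c fun i => c i + l).indicator (G v) (Function.update x i s)‖ₑ) w := by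
  set Q : Set (Fin n → ℝ) := Icc c fun i => c i + l
  have hQ : MeasurableSet Q := measurableSet_Icc
  have hGm : ∀ w, Measurable (Q.indicator (G w)) := fun w =>
    measurable_indicator_of_continuousOn (hG.continuousOn w) hQ
  have hGu : ∀ (x : Fin n → ℝ) w,
      Measurable fun s => ‖Q.indicator (G w) (Function.update x i s)‖ₑ :=
    fun x w => ((hGm w).comp (measurable_update x)).enorm
  induction k with
  | zero =>
    intro w x hx
    have hup : ∀ s ∈ Icc (c i) (c i + l), Function.update x i s ∈ Q :=
      fun s hs => update_mem_Icc hx hs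
    have hcu : ∀ v, ContinuousOn (fun s => G v (Function.update x i s)) (Icc (c i) (c i + l)) :=
      fun v => (hG.continuousOn v).comp (by fun_prop) hup
    have h1 := enorm_le_lintegral_add (h := fun s => G w (Function.update x i s))
      (h' := fun s => G (i :: w) (Function.update x i s)) (c := c i) (s₀ := x i) hl
      (fun s hs => hasDerivAt_update_of_hasLineDerivAt (hG.hasLineDerivAt w i _ (hup s hs)))
      (hcu _) ⟨hx.1 i, hx.2 i⟩
    simp only [Function.update_eq_self] at h1
    simp only [towerBound, indicator_of_mem hx]
    refine h1.trans ?_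
    have hs1 := ((hGu x w)).add
      (Finset.measurable_sum (Finset.univ : Finset (Fin n)) fun j _ => hGu x (j :: w))
    have h2 := lintegral_const_mul (μ := volume.restrict (Icc (c i) (c i + l)))
      (ENNReal.ofReal l⁻¹ + 1) hs1
    simp only [Pi.add_apply] at h2
    rw [h2]
    refine mul_le_mul' le_rfl ?_
    refine setLIntegral_mono' measurableSet_Icc fun s hs => ?_
    rw [indicator_of_mem (hup s hs)]
    gcongr
    -- Only the derivative in direction `i` is needed; the other ones are included so that the bound
    -- has the same form for every coordinate.
    refine le_trans ?_ (Finset.single_le_sum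
      (f := fun j => ‖Q.indicator (G (j :: w)) (Function.update x i s)‖ₑ)
      (fun _ _ => zero_le) (Finset.mem_univ i))
    simp only [indicator_of_mem (hup s hs)]
    exact le_rfl
  | succ k ih =>
    intro w x hx
    rw [towerBound]
    conv_rhs => enter [2, s]; rw [towerBound]
    have hm := fun w => measurable_towerBound (K := ENNReal.ofReal l⁻¹ + 1) (hGu x) (k + 1) w
    rw [lintegral_const_mul_add_sum _ (hm w) fun j => hm (j :: w)]
    gcongr
    · exact ih w x hx
    · exact ih _ x hx

/-- Coordinates are integrated out one at a time. After all `n` of them a pointwise value is bounded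
by integrals of derivatives of order at most `n`. -/
lemma IsTower.towerBound_le_lmarginal (hl : 0 < l) (hG : IsTower (Icc c fun i => c i + l) G)
    (s : Finset (Fin n)) :
    ∀ k w, ∀ x ∈ Icc c (fun i => c i + l),
      towerBound (ENNReal.ofReal l⁻¹ + 1) k
        (fun v => ‖(Icc c fun i => c i + l).indicator (G v) x‖ₑ) w ≤
      lmarginal (fun i => volume.restrict (Icc (c i) (c i + l))) s
        (fun y => towerBound (ENNReal.ofReal l⁻¹ + 1) (k + s.card)
        (fun v => ‖(Icc c fun i => c i + l).indicator (G v) y‖ₑ) w) x := by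
  set Q : Set (Fin n → ℝ) := Icc c fun i => c i + l
  have hGm : ∀ w, Measurable fun x => ‖Q.indicator (G w) x‖ₑ := fun w =>
    (measurable_indicator_of_continuousOn (hG.continuousOn w) measurableSet_Icc).enorm
  induction s using Finset.induction_on with
  | empty => intro k w x hx; simp
  | insert i s hi ih =>
    intro k w x hx
    rw [lmarginal_insert _ (measurable_towerBound hGm _ _) hi]
    refine (hG.towerBound_le_lintegral hl i k w x hx).trans ?_
    refine setLIntegral_mono' measurableSet_Icc fun r hr => ?_
    refine (ih (k + 1) w _ (update_mem_Icc hx hr)).trans (le_of_eq ?_)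
    rw [Finset.card_insert_of_notMem hi]
    congr 2
    funext y
    congr 1
    ring

/-- Sup estimate: a function is bounded on a cube by integrals of its derivatives over the cube. -/
theorem IsTower.enorm_le_towerBound (hl : 0 < l) (hG : IsTower (Icc c fun i => c i + l) G)
    (w : List (Fin n)) {x : Fin n → ℝ} (hx : x ∈ Icc c fun i => c i + l) :
    ‖G w x‖ₑ ≤ towerBound (ENNReal.ofReal l⁻¹ + 1) n
      (fun v => ∫⁻ y in Icc c fun i => c i + l, ‖G v y‖ₑ) w := by
  have h := hG.towerBound_le_lmarginal hl Finset.univ 0 w x hx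
  set Q : Set (Fin n → ℝ) := Icc c fun i => c i + l with hQ
  have hGm : ∀ w, Measurable fun x => ‖Q.indicator (G w) x‖ₑ := fun w =>
    (measurable_indicator_of_continuousOn (hG.continuousOn w) measurableSet_Icc).enorm
  rw [lmarginal_univ, ← Measure.restrict_pi_pi, lintegral_towerBound hGm] at h
  simp only [towerBound, indicator_of_mem hx, zero_add, Finset.card_univ, Fintype.card_fin] at h
  refine h.trans (towerBound_mono (fun v => ?_) n w)
  rw [pi_univ_Icc, ← hQ, ← volume_pi]
  refine setLIntegral_mono' measurableSet_Icc fun y hy => ?_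
  rw [indicator_of_mem hy]

end SupEstimate

/-! ### Slabs -/

section Slab

variable {n : ℕ}

/-- The points whose coordinates outside `P` lie in given open intervals. -/
def slab (a b : Fin n → ℝ) (P : Set (Fin n)) : Set (Fin n → ℝ) :=
  Pᶜ.pi fun i => Ioo (a i) (b i)

/-- `D` is a slab: an open box in the coordinates outside `P`, the whole space in those of `P`. -/
def IsSlab (D : Set (Fin n → ℝ)) (P : Set (Fin n)) : Prop :=
  ∃ a b : Fin n → ℝ, (∀ i, a i < b i) ∧ D = slab a b P

/-- Invariance of a function on `closure D` under the period lattice. -/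
def IsPeriodic (D : Set (Fin n → ℝ)) (P : Set (Fin n)) (f : (Fin n → ℝ) → ℝ) : Prop :=
  ∀ i ∈ P, ∀ x ∈ closure D, f (x + Pi.single i (2 * Real.pi)) = f x

/-- Smooth up to the boundary and periodic. -/
structure IsSmooth (D : Set (Fin n → ℝ)) (P : Set (Fin n)) (f : (Fin n → ℝ) → ℝ) : Prop where
  contDiffOn : ContDiffOn ℝ ∞ f (closure D)
  periodic : IsPeriodic D P f

variable {a b : Fin n → ℝ} {D : Set (Fin n → ℝ)} {P : Set (Fin n)}

lemma isOpen_slab : IsOpen (slab a b P) :=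
  isOpen_set_pi (Set.toFinite _) fun _ _ => isOpen_Ioo

lemma closure_slab (h : ∀ i, a i < b i) :
    closure (slab a b P) = Pᶜ.pi fun i => Icc (a i) (b i) := by
  simp only [slab, closure_pi_set, closure_Ioo (h _).ne]

lemma convex_slab : Convex ℝ (slab a b P) := convex_pi fun _ _ => convex_Ioo _ _

lemma IsSlab.isOpen (h : IsSlab D P) : IsOpen D := by
  obtain ⟨a, b, -, rfl⟩ := h; exact isOpen_slab

lemma IsSlab.measurableSet (h : IsSlab D P) : MeasurableSet D := h.isOpen.measurableSet

lemma IsSlab.convex (h : IsSlab D P) : Convex ℝ D := by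
  obtain ⟨a, b, -, rfl⟩ := h; exact convex_slab

lemma IsSlab.nonempty (h : IsSlab D P) : D.Nonempty := by
  obtain ⟨a, b, hab, rfl⟩ := h
  exact ⟨fun i => (a i + b i) / 2, fun i _ =>
    ⟨by show a i < (a i + b i) / 2; linarith [hab i], by show (a i + b i) / 2 < b i; linarith [hab i]⟩⟩

lemma IsSlab.interior_closure_nonempty (h : IsSlab D P) : (interior (closure D)).Nonempty :=
  h.nonempty.mono (interior_maximal subset_closure h.isOpen)

lemma IsSlab.uniqueDiffOn (h : IsSlab D P) : UniqueDiffOn ℝ (closure D) :=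
  uniqueDiffOn_convex h.convex.closure h.interior_closure_nonempty

lemma IsSlab.closure_subset_closure_interior (h : IsSlab D P) :
    closure D ⊆ closure (interior (closure D)) :=
  closure_mono (interior_maximal subset_closure h.isOpen)

/-- Points of `closure D` may be moved freely in the coordinates of `P`. -/
lemma IsSlab.mem_closure_of_eq (h : IsSlab D P) {x y : Fin n → ℝ} (hx : x ∈ closure D)
    (hxy : ∀ i, i ∉ P → y i = x i) : y ∈ closure D := by
  obtain ⟨a, b, hab, rfl⟩ := h
  rw [closure_slab hab] at *
  intro i hi
  rw [hxy i hi]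
  exact hx i hi

lemma IsSlab.mem_of_eq (h : IsSlab D P) {x y : Fin n → ℝ} (hx : x ∈ D)
    (hxy : ∀ i, i ∉ P → y i = x i) : y ∈ D := by
  obtain ⟨a, b, hab, rfl⟩ := h
  intro i hi
  show y i ∈ _
  rw [hxy i hi]
  exact hx i hi

/-- The period lattice, as multiples with respect to the coordinates of `P`. -/
def latticeVec (P : Set (Fin n)) (k : Fin n → ℤ) : Fin n → ℝ :=
  P.indicator fun i => (k i : ℝ) * (2 * Real.pi)

lemma IsSlab.add_latticeVec_mem (h : IsSlab D P) (k : Fin n → ℤ) (x : Fin n → ℝ) :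
    x + latticeVec P k ∈ D ↔ x ∈ D := by
  constructor <;> intro hx <;> refine h.mem_of_eq hx fun i hi => ?_ <;> simp [latticeVec, hi]

lemma IsSlab.add_latticeVec_mem_closure (h : IsSlab D P) (k : Fin n → ℤ) (x : Fin n → ℝ) :
    x + latticeVec P k ∈ closure D ↔ x ∈ closure D := by
  constructor <;> intro hx <;> refine h.mem_closure_of_eq hx fun i hi => ?_ <;>
    simp [latticeVec, hi]

/-- The vectors supported in `P` that leave `f` invariant form an additive group containing the
generators of the lattice. The support condition keeps translated points inside the closed slab,
where invariance is available. -/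
lemma IsPeriodic.latticeVec (h : IsSlab D P) {f : (Fin n → ℝ) → ℝ} (hf : IsPeriodic D P f)
    (k : Fin n → ℤ) : ∀ x ∈ closure D, f (x + latticeVec P k) = f x := by
  classical
  let S : AddSubgroup (Fin n → ℝ) :=
    { carrier := {v | (∀ i, i ∉ P → v i = 0) ∧ ∀ x ∈ closure D, f (x + v) = f x}
      zero_mem' := by simp
      add_mem' := by
        rintro v w ⟨hv, hv'⟩ ⟨hw, hw'⟩
        refine ⟨fun i hi => by simp [hv i hi, hw i hi], fun x hx => ?_⟩
        rw [← add_assoc, hw' _ (h.mem_closure_of_eq hx fun i hi => by simp [hv i hi]), hv' x hx]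
      neg_mem' := by
        rintro v ⟨hv, hv'⟩
        refine ⟨fun i hi => by simp [hv i hi], fun x hx => ?_⟩
        rw [← hv' (x + -v) (h.mem_closure_of_eq hx fun i hi => by simp [hv i hi])]
        simp }
  have hs : ∀ i ∈ P, Pi.single i (2 * Real.pi) ∈ S := fun i hi =>
    ⟨fun j hj => Pi.single_eq_of_ne (by rintro rfl; exact hj hi) _, hf i hi⟩
  have : VortexSheet.latticeVec P k ∈ S := by
    have e : VortexSheet.latticeVec P k
        = ∑ i, if i ∈ P then k i • Pi.single i (2 * Real.pi) else 0 := by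
      ext j
      rw [Finset.sum_apply, Finset.sum_eq_single j]
      · by_cases hj : j ∈ P <;> simp [VortexSheet.latticeVec, hj]
      · intro i _ hij
        by_cases hi : i ∈ P <;> simp [hi, Pi.single_eq_of_ne hij.symm]
      · simp
    rw [e]
    refine S.sum_mem fun i _ => ?_
    by_cases hi : i ∈ P
    · simpa [hi] using S.zsmul_mem (hs i hi) (k i)
    · simp [hi, S.zero_mem]
  exact this.2

/-- Every point can be moved into the period cell by a lattice vector. -/
lemma exists_latticeVec_mem_cell (P : Set (Fin n)) (x : Fin n → ℝ) :
    ∃ k : Fin n → ℤ, x + latticeVec P k ∈ cell P := by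
  have hp : 0 < 2 * Real.pi := by positivity
  refine ⟨fun i => -toIocDiv hp 0 (x i), fun i hi => ?_⟩
  have := sub_toIocDiv_zsmul_mem_Ioc hp 0 (x i)
  simp only [zero_add, zsmul_eq_mul] at this
  simpa [latticeVec, hi, sub_eq_add_neg] using this

lemma measurableSet_cell (P : Set (Fin n)) : MeasurableSet (cell P) := by
  have : cell P = ⋂ i ∈ P, (fun x : Fin n → ℝ => x i) ⁻¹' Ioc 0 (2 * Real.pi) := by
    ext x; simp [cell]
  rw [this]
  exact MeasurableSet.biInter (Set.to_countable P) fun i _ =>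
    measurable_pi_apply i measurableSet_Ioc

/-- A compact set containing the part of the closed slab in one period cell. Boundedness of
continuous periodic functions and finiteness of the cell volume both come from it. -/
lemma IsSlab.exists_isCompact (h : IsSlab D P) :
    ∃ K, IsCompact K ∧ K ⊆ closure D ∧ closure D ∩ cell P ⊆ K := by
  obtain ⟨a, b, hab, rfl⟩ := h
  rw [closure_slab hab]
  classical
  refine ⟨Set.univ.pi fun i => if i ∈ P then Icc 0 (2 * Real.pi) else Icc (a i) (b i),
    isCompact_univ_pi fun i => ?_, ?_, ?_⟩
  · split_ifs <;> exact isCompact_Icc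
  · intro x hx i hi
    have := hx i (mem_univ i)
    have hi' : i ∉ P := hi
    simpa [hi'] using this
  · rintro x ⟨hx, hx'⟩ i -
    by_cases hi : i ∈ P
    · simp only [hi, if_true]; exact Ioc_subset_Icc_self (hx' i hi)
    · simp only [hi, if_false]; exact hx i hi

lemma IsSlab.volume_cell_lt_top (h : IsSlab D P) : volume (D ∩ cell P) < ⊤ := by
  obtain ⟨K, hK, -, hs⟩ := h.exists_isCompact
  exact (measure_mono ((inter_subset_inter_left _ subset_closure).trans hs)).trans_lt
    hK.measure_lt_top

lemma IsSlab.isFiniteMeasure (h : IsSlab D P) :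
    IsFiniteMeasure ((volume : Measure (Fin n → ℝ)).restrict (D ∩ cell P)) :=
  ⟨by simpa using h.volume_cell_lt_top⟩

lemma IsSlab.exists_bound (h : IsSlab D P) {f : (Fin n → ℝ) → ℝ}
    (hf : ContinuousOn f (closure D)) (hp : IsPeriodic D P f) :
    ∃ C, ∀ x ∈ closure D, |f x| ≤ C := by
  obtain ⟨K, hK, hKD, hs⟩ := h.exists_isCompact
  obtain ⟨C, hC⟩ := hK.exists_bound_of_continuousOn (hf.mono hKD)
  refine ⟨C, fun x hx => ?_⟩
  obtain ⟨k, hk⟩ := exists_latticeVec_mem_cell P x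
  rw [← hp.latticeVec h k x hx]
  exact hC _ (hs ⟨(h.add_latticeVec_mem_closure k x).2 hx, hk⟩)

lemma IsSlab.memLp (h : IsSlab D P) {f : (Fin n → ℝ) → ℝ}
    (hf : ContinuousOn f (closure D)) (hp : IsPeriodic D P f) (p : ENNReal) :
    MemLp f p (volume.restrict (D ∩ cell P)) := by
  have := h.isFiniteMeasure
  obtain ⟨C, hC⟩ := h.exists_bound hf hp
  have hm : MeasurableSet (D ∩ cell P) := h.measurableSet.inter (measurableSet_cell P)
  refine MemLp.of_bound (C := C) ((hf.mono (inter_subset_left.trans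
    subset_closure)).aestronglyMeasurable hm) ?_
  filter_upwards [ae_restrict_mem hm] with x hx
  exact hC x (subset_closure hx.1)

/-- Coinduction principle for `H^∞`. -/
theorem memHInf_of_closed (h : IsSlab D P) {C : Set ((Fin n → ℝ) → ℝ)}
    (hc : ∀ f ∈ C, ContinuousOn f (closure D)) (hp : ∀ f ∈ C, IsPeriodic D P f)
    (hd : ∀ f ∈ C, ∀ i, ∃ g ∈ C, IsWeakDeriv D i f g) : ∀ f ∈ C, MemHInf D P f := fun f hf =>
  ⟨hc f hf, hp f hf, fun m => memSobolev_of_closed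
    (fun g hg => h.memLp (hc g hg) (hp g hg) 2) hd m f hf⟩

/-- Membership in H^∞ asks for periodicity of the function only. A translate of a weak derivative is
the weak derivative of the translate, so uniqueness carries periodicity up the tower, almost
everywhere. -/
lemma weak_tower_latticeVec (h : IsSlab D P) {F : List (Fin n) → (Fin n → ℝ) → ℝ}
    (h0 : IsPeriodic D P (F []))
    (hF : ∀ w i, IsWeakDeriv D i (F w) (F (i :: w))) (k : Fin n → ℤ) (w : List (Fin n)) :
    (fun x => F w (x + latticeVec P k)) =ᵐ[volume.restrict D] F w := by
  induction w with
  | nil =>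
    filter_upwards [ae_restrict_mem h.measurableSet] with x hx
    exact h0.latticeVec h k x (subset_closure hx)
  | cons i w ih =>
    have h1 := (hF w i).comp_add (h.add_latticeVec_mem k)
    exact (h1.congr ih Filter.EventuallyEq.rfl).ae_unique h.isOpen (hF w i)

/-- Periodicity almost everywhere bounds integrals over unit cubes by integrals over the cell. -/
lemma lintegral_cube_le (h : IsSlab D P) {g : (Fin n → ℝ) → ℝ}
    (hg : ∀ k, (fun x => g (x + latticeVec P k)) =ᵐ[volume.restrict D] g) (c : Fin n → ℝ) :
    ∫⁻ x in D ∩ Icc c (fun i => c i + 1), ‖g x‖ₑ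
      ≤ 2 ^ n * ∫⁻ x in D ∩ cell P, ‖g x‖ₑ := by
  have hp : 0 < 2 * Real.pi := by positivity
  have hp1 : 1 < 2 * Real.pi := by linarith [Real.pi_gt_three]
  -- First the corner `c` is moved into the cell. Since the side 1 is shorter than 2π, each
  -- coordinate then overshoots by at most one period, which `e` records; this is where the factor
  -- 2ⁿ comes from.
  let k : (Fin n → Fin 2) → Fin n → ℤ := fun e i => -(toIocDiv hp 0 (c i) + (e i : ℕ))
  have hcov : D ∩ Icc c (fun i => c i + 1) ⊆
      ⋃ e : Fin n → Fin 2, (fun x => x + latticeVec P (k e)) ⁻¹' (D ∩ cell P) := by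
    rintro x ⟨hxD, hx⟩
    simp only [mem_iUnion]
    have hx1 : ∀ i, ∃ e : Fin 2,
        x i + -((toIocDiv hp 0 (c i) : ℝ) + ((e : ℕ) : ℝ)) * (2 * Real.pi) ∈ Ioc 0 (2 * Real.pi) := by
      intro i
      have h1 := sub_toIocDiv_zsmul_mem_Ioc hp 0 (c i)
      simp only [zero_add, zsmul_eq_mul] at h1
      have h2 := hx.1 i
      have h3 : x i ≤ c i + 1 := hx.2 i
      by_cases hle : x i - toIocDiv hp 0 (c i) * (2 * Real.pi) ≤ 2 * Real.pi
      · refine ⟨0, ?_, ?_⟩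
        · simp only [Fin.val_zero, Nat.cast_zero, add_zero]; linarith [h1.1]
        · simp only [Fin.val_zero, Nat.cast_zero, add_zero]; linarith
      · refine ⟨1, ?_, ?_⟩
        · simp only [Fin.val_one, Nat.cast_one]; linarith [h1.1]
        · simp only [Fin.val_one, Nat.cast_one]; linarith [h1.2]
    choose e he using hx1
    refine ⟨e, (h.add_latticeVec_mem _ x).2 hxD, fun i hi => ?_⟩
    simpa [latticeVec, hi, k] using he i
  have hm : MeasurableSet (D ∩ cell P) := h.measurableSet.inter (measurableSet_cell P)
  have each : ∀ e, ∫⁻ x in (fun x => x + latticeVec P (k e)) ⁻¹' (D ∩ cell P), ‖g x‖ₑ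
      = ∫⁻ x in D ∩ cell P, ‖g x‖ₑ := by
    intro e
    have hpre : (fun x => x + latticeVec P (k e)) ⁻¹' (D ∩ cell P) ⊆ D :=
      fun x hx => (h.add_latticeVec_mem _ x).1 hx.1
    have hms : MeasurableSet ((fun x => x + latticeVec P (k e)) ⁻¹' (D ∩ cell P)) :=
      (measurable_add_const _) hm
    have h1 : ∫⁻ x in (fun x => x + latticeVec P (k e)) ⁻¹' (D ∩ cell P), ‖g x‖ₑ
        = ∫⁻ x in (fun x => x + latticeVec P (k e)) ⁻¹' (D ∩ cell P),
          ‖g (x + latticeVec P (k e))‖ₑ := by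
      refine lintegral_congr_ae ?_
      filter_upwards [ae_restrict_of_ae_restrict_of_subset hpre (hg (k e))] with x hx
      simp only [hx]
    rw [h1]
    exact (measurePreserving_add_right volume (latticeVec P (k e))).setLIntegral_comp_preimage_emb
      (measurableEmbedding_addRight _) (fun x => ‖g x‖ₑ) _
  calc ∫⁻ x in D ∩ Icc c (fun i => c i + 1), ‖g x‖ₑ
      ≤ ∫⁻ x in ⋃ e : Fin n → Fin 2, (fun x => x + latticeVec P (k e)) ⁻¹' (D ∩ cell P), ‖g x‖ₑ :=
        lintegral_mono_set hcov
    _ ≤ ∑' e : Fin n → Fin 2,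
        ∫⁻ x in (fun x => x + latticeVec P (k e)) ⁻¹' (D ∩ cell P), ‖g x‖ₑ :=
        lintegral_iUnion_le _ _
    _ = 2 ^ n * ∫⁻ x in D ∩ cell P, ‖g x‖ₑ := by
        simp only [each, tsum_fintype, Finset.sum_const, Finset.card_univ, Fintype.card_fun,
          Fintype.card_fin, nsmul_eq_mul]
        push_cast; rfl

end Slab

/-! ### Sobolev embedding: `H^∞` functions are smooth up to the boundary -/

section Embedding

open scoped Convolution
open Filter Topology

variable {n : ℕ} {a b : Fin n → ℝ} {D : Set (Fin n → ℝ)} {P : Set (Fin n)}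
  {F : List (Fin n) → (Fin n → ℝ) → ℝ}

/-- The linear form with given partial derivatives. -/
def gradCLM (v : Fin n → ℝ) : (Fin n → ℝ) →L[ℝ] ℝ :=
  ∑ i, v i • ContinuousLinearMap.proj i

lemma gradCLM_apply (v x : Fin n → ℝ) : gradCLM v x = ∑ i, v i * x i := by
  simp [gradCLM]

@[simp] lemma gradCLM_single (v : Fin n → ℝ) (i : Fin n) : gradCLM v (Pi.single i 1) = v i := by
  rw [gradCLM_apply, Finset.sum_eq_single i]
  · simp
  · intro j _ hj; simp [hj]
  · simp

lemma clm_eq_gradCLM (A : (Fin n → ℝ) →L[ℝ] ℝ) : A = gradCLM fun i => A (Pi.single i 1) := by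
  refine ContinuousLinearMap.coe_injective (LinearMap.pi_ext fun i r => ?_)
  have : Pi.single i r = r • (Pi.single i 1 : Fin n → ℝ) := by
    rw [← Pi.single_smul, smul_eq_mul, mul_one]
  simp only [ContinuousLinearMap.coe_coe]
  rw [this, map_smul, map_smul, gradCLM_single]

lemma clm_apply_eq_sum (A : (Fin n → ℝ) →L[ℝ] ℝ) (x : Fin n → ℝ) :
    A x = ∑ i, A (Pi.single i 1) * x i := by
  conv_lhs => rw [clm_eq_gradCLM A, gradCLM_apply]

lemma norm_clm_le_sum (A : (Fin n → ℝ) →L[ℝ] ℝ) : ‖A‖ ≤ ∑ i, |A (Pi.single i 1)| := by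
  refine A.opNorm_le_bound (Finset.sum_nonneg fun _ _ => abs_nonneg _) fun x => ?_
  rw [clm_apply_eq_sum, Finset.sum_mul]
  refine (norm_sum_le _ _).trans (Finset.sum_le_sum fun i _ => ?_)
  rw [norm_mul, Real.norm_eq_abs]
  gcongr
  exact norm_le_pi_norm x i

/-- A sequence of smooth kernels concentrating at the origin. -/
def mollifier (n : ℕ) (m : ℕ) : ContDiffBump (0 : Fin n → ℝ) where
  rIn := 1 / ((m : ℝ) + 1)
  rOut := 2 * (1 / ((m : ℝ) + 1))
  rIn_pos := by positivity
  rIn_lt_rOut := by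
    have : 0 < 1 / ((m : ℝ) + 1) := by positivity
    linarith

lemma tendsto_mollifier_rOut : Tendsto (fun m => (mollifier n m).rOut) atTop (𝓝 0) := by
  have : Tendsto (fun m : ℕ => 2 * (1 / ((m : ℝ) + 1))) atTop (𝓝 (2 * 0)) :=
    tendsto_one_div_add_atTop_nhds_zero_nat.const_mul 2
  simpa [mollifier] using this

/-- Mollification of a function on `D`, extended by zero. -/
def mollify (D : Set (Fin n → ℝ)) (m : ℕ) (g : (Fin n → ℝ) → ℝ) : (Fin n → ℝ) → ℝ :=
  (mollifier n m).normed volume ⋆[ContinuousLinearMap.lsmul ℝ ℝ, volume] D.indicator g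

lemma mollify_eq (m : ℕ) (g : (Fin n → ℝ) → ℝ) (x : Fin n → ℝ) :
    mollify D m g x = ∫ t, (mollifier n m).normed volume t * D.indicator g (x - t) := rfl

/-- Mollification commutes with weak differentiation at points farther from the boundary than the
radius of the kernel: the derivative falls on the kernel, and the reflected, translated kernel is an
admissible test function. -/
lemma hasFDerivAt_mollify (hD : IsOpen D) {f : (Fin n → ℝ) → ℝ} {g : Fin n → (Fin n → ℝ) → ℝ}
    (hl : LocallyIntegrable (D.indicator f)) (hw : ∀ i, IsWeakDeriv D i f (g i)) {m : ℕ}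
    {x : Fin n → ℝ} (hx : Metric.closedBall x (mollifier n m).rOut ⊆ D) :
    HasFDerivAt (mollify D m f) (gradCLM fun i => mollify D m (g i) x) x := by
  set ρ := (mollifier n m).normed (volume : Measure (Fin n → ℝ)) with hρ
  have hρs : ContDiff ℝ ∞ ρ := (mollifier n m).contDiff_normed
  have hρc : HasCompactSupport ρ := (mollifier n m).hasCompactSupport_normed
  have h1 := hρc.hasFDerivAt_convolution_left (ContinuousLinearMap.lsmul ℝ ℝ)
    (hρs.of_le (mod_cast le_top)) hl x
  have hred : ∀ A : (Fin n → ℝ) →L[ℝ] ℝ, HasFDerivAt (mollify D m f) A x →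
      (∀ i, A (Pi.single i 1) = mollify D m (g i) x) →
      HasFDerivAt (mollify D m f) (gradCLM fun i => mollify D m (g i) x) x := by
    intro A hA hAi
    rw [clm_eq_gradCLM A] at hA
    simpa only [hAi] using hA
  refine hred _ h1 fun i => ?_
  have hex := (hρc.fderiv ℝ).convolutionExists_left
    ((ContinuousLinearMap.lsmul ℝ ℝ : ℝ →L[ℝ] ℝ →L[ℝ] ℝ).precompL (Fin n → ℝ))
    (hρs.continuous_fderiv (by simp)) hl x
  rw [convolution_def, ContinuousLinearMap.integral_apply hex]
  simp only [ContinuousLinearMap.precompL_apply, ContinuousLinearMap.lsmul_apply]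
  -- the test function
  set ψ : (Fin n → ℝ) → ℝ := fun t => ρ (x - t) with hψ
  have hψs : ContDiff ℝ ∞ ψ := hρs.comp (contDiff_const.sub contDiff_id)
  have hts : tsupport ψ = (Homeomorph.subLeft x) ⁻¹' tsupport ρ := by
    have := tsupport_comp_eq_preimage ρ (Homeomorph.subLeft x)
    rw [← this]; rfl
  have hψc : HasCompactSupport ψ := hρc.comp_homeomorph (Homeomorph.subLeft x)
  have hψD : tsupport ψ ⊆ D := by
    rw [hts, hρ, ContDiffBump.tsupport_normed_eq]
    intro t ht
    apply hx
    simpa [dist_eq_norm, norm_sub_rev] using ht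
  have e := (hw i).2.2 ψ hψs hψc hψD
  have hfd : ∀ t, fderiv ℝ ψ t (Pi.single i 1) = -(fderiv ℝ ρ (x - t) (Pi.single i 1)) := by
    intro t
    have : HasFDerivAt ψ ((fderiv ℝ ρ (x - t)).comp (-ContinuousLinearMap.id ℝ (Fin n → ℝ))) t := by
      refine HasFDerivAt.comp t ((hρs.differentiable (by simp)) (x - t)).hasFDerivAt ?_
      exact (hasFDerivAt_id t).const_sub x
    rw [this.fderiv]; simp
  have hind : ∀ (u v : (Fin n → ℝ) → ℝ), ∫ t in D, u t * v t = ∫ t, v t * D.indicator u t := by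
    intro u v
    rw [← integral_indicator hD.measurableSet]
    congr 1; funext t
    by_cases ht : t ∈ D <;> simp [ht, mul_comm]
  simp only [hfd, mul_neg] at e
  rw [integral_neg, neg_inj, hind, hind] at e
  rw [mollify_eq, ← integral_sub_left_eq_self
    (fun t => (fderiv ℝ ρ t) (Pi.single i 1) • D.indicator f (x - t)) _ x,
    ← integral_sub_left_eq_self
    (fun t => (mollifier n m).normed volume t * D.indicator (g i) (x - t)) _ x]
  simp only [sub_sub_cancel, smul_eq_mul]
  exact e

/-- By Tonelli, the integral is at most an average, with weight of mass one, of integrals over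
translates of the cube. The bound `hB` is uniform in the corner and a cube of side `l ≤ 1` fits into
a unit cube, so mollification does not increase it. -/
lemma lintegral_mollify_le {g : (Fin n → ℝ) → ℝ} (hl : LocallyIntegrable (D.indicator g))
    (hD : MeasurableSet D) {B : ENNReal}
    (hB : ∀ c, ∫⁻ x in D ∩ Icc c (fun i => c i + 1), ‖g x‖ₑ ≤ B) (m : ℕ) {l : ℝ} (hl1 : l ≤ 1)
    (c : Fin n → ℝ) : ∫⁻ x in Icc c (fun i => c i + l), ‖mollify D m g x‖ₑ ≤ B := by
  set ρ := (mollifier n m).normed (volume : Measure (Fin n → ℝ)) with hρ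
  set Q : Set (Fin n → ℝ) := Icc c (fun i => c i + l)
  have hρm : AEStronglyMeasurable ρ volume :=
    (mollifier n m).continuous_normed.aestronglyMeasurable
  have hint : AEStronglyMeasurable (fun p : (Fin n → ℝ) × (Fin n → ℝ) =>
      ρ p.2 * D.indicator g (p.1 - p.2)) ((volume.restrict Q).prod volume) := by
    have h1 : AEStronglyMeasurable (fun p : (Fin n → ℝ) × (Fin n → ℝ) =>
      ρ p.2 * D.indicator g (p.1 - p.2)) (volume.prod volume) :=
      hρm.comp_snd.mul (hl.aestronglyMeasurable.comp_quasiMeasurePreserving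
        (quasiMeasurePreserving_sub volume volume))
    exact h1.mono_ac (Measure.AbsolutelyContinuous.prod
      Measure.restrict_le_self.absolutelyContinuous Measure.AbsolutelyContinuous.rfl)
  have hin : ∀ t, ∫⁻ x in Q, ‖D.indicator g (x - t)‖ₑ ≤ B := by
    intro t
    refine le_trans ?_ (hB (c - t))
    have h1 : ∫⁻ x in Q, ‖D.indicator g (x - t)‖ₑ
        ≤ ∫⁻ x in (fun x => x - t) ⁻¹' Icc (c - t) (fun i => (c - t) i + 1),
          ‖D.indicator g (x - t)‖ₑ := by
      refine lintegral_mono_set fun x hx => ⟨fun i => ?_, fun i => ?_⟩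
      · have := hx.1 i; simp only [Pi.sub_apply]; linarith
      · have : x i ≤ c i + l := hx.2 i
        simp only [Pi.sub_apply]; linarith
    refine h1.trans (le_of_eq ?_)
    have h2 := (measurePreserving_sub_right (volume : Measure (Fin n → ℝ)) t).setLIntegral_comp_preimage_emb
      (measurableEmbedding_subRight t) (fun x => ‖D.indicator g x‖ₑ)
      (Icc (c - t) (fun i => (c - t) i + 1))
    rw [h2, ← setLIntegral_indicator hD]
    refine lintegral_congr fun x => ?_
    by_cases hx : x ∈ D <;> simp [hx]
  calc ∫⁻ x in Q, ‖mollify D m g x‖ₑ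
      ≤ ∫⁻ x in Q, ∫⁻ t, ‖ρ t * D.indicator g (x - t)‖ₑ :=
        lintegral_mono fun x => enorm_integral_le_lintegral_enorm _
    _ = ∫⁻ t, ∫⁻ x in Q, ‖ρ t * D.indicator g (x - t)‖ₑ := lintegral_lintegral_swap hint.enorm
    _ = ∫⁻ t, ‖ρ t‖ₑ * ∫⁻ x in Q, ‖D.indicator g (x - t)‖ₑ := by
        refine lintegral_congr fun t => ?_
        simp only [enorm_mul]
        rw [lintegral_const_mul' _ _ (by simp)]
    _ ≤ ∫⁻ t, ‖ρ t‖ₑ * B := lintegral_mono fun t => by gcongr; exact hin t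
    _ = B := by
        rw [lintegral_mul_const'' _ hρm.enorm]
        have h1 : ∫⁻ t, ‖ρ t‖ₑ = 1 := by
          have h2 := ofReal_integral_norm_eq_lintegral_enorm
            (μ := volume) (f := ρ) (mollifier n m).integrable_normed
          rw [← h2]
          have : ∀ t, ‖ρ t‖ = ρ t := fun t => by
            rw [Real.norm_eq_abs, abs_of_nonneg ((mollifier n m).nonneg_normed t)]
          simp only [this]
          rw [hρ, (mollifier n m).integral_normed, ENNReal.ofReal_one]
        rw [h1, one_mul]

/-- Every point that is `ε`-inside a slab lies in a cube that is `ε`-inside. -/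
lemma exists_cube_subset {ε l : ℝ} (hab : ∀ i, 4 * l ≤ b i - a i) (hl : 0 < l) (hε : 0 ≤ ε)
    (hεl : ε < l)
    {x : Fin n → ℝ} (hx : Metric.closedBall x ε ⊆ slab a b P) :
    ∃ c, x ∈ Icc c (fun i => c i + l) ∧
      ∀ y ∈ Icc c (fun i => c i + l), Metric.closedBall y ε ⊆ slab a b P := by
  have hx1 : ∀ i ∉ P, a i < x i - ε ∧ x i + ε < b i := by
    intro i hi
    have h1 : x - (fun _ => ε) ∈ slab a b P := hx (by
      rw [mem_closedBall_iff_norm, pi_norm_le_iff_of_nonneg hε]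
      intro j; simp [abs_of_nonneg hε])
    have h2 : x + (fun _ => ε) ∈ slab a b P := hx (by
      rw [mem_closedBall_iff_norm, pi_norm_le_iff_of_nonneg hε]
      intro j; simp [abs_of_nonneg hε])
    exact ⟨(h1 i hi).1, (h2 i hi).2⟩
  -- In each coordinate the cube extends from `x` towards the farther face. That face is at distance
  -- at least (b − a)/2 ≥ 2l > l + ε, so it is not reached; the nearer face is no closer to the cube
  -- than to `x`.
  refine ⟨fun i => if x i ≤ (a i + b i) / 2 then x i else x i - l, ⟨fun i => ?_, fun i => ?_⟩, ?_⟩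
  · dsimp only; split_ifs <;> linarith
  · dsimp only; split_ifs <;> linarith
  · intro y hy z hz i hi
    have h1 := hy.1 i
    have h2 := hy.2 i
    have h3 : |z i - y i| ≤ ε := by
      rw [mem_closedBall_iff_norm] at hz
      exact (norm_le_pi_norm (z - y) i).trans hz
    have h4 := hx1 i hi
    have h5 := hab i
    rw [abs_le] at h3
    dsimp only at h1 h2
    constructor
    · split_ifs at h1 h2 <;> linarith
    · split_ifs at h1 h2 <;> linarith

lemma exists_side (hab : ∀ i, a i < b i) : ∃ l : ℝ, 0 < l ∧ l ≤ 1 ∧ ∀ i, 4 * l ≤ b i - a i := by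
  classical
  have hne : (insert (1 : ℝ) (Finset.univ.image fun i => (b i - a i) / 4)).Nonempty :=
    Finset.insert_nonempty _ _
  refine ⟨(insert (1 : ℝ) (Finset.univ.image fun i => (b i - a i) / 4)).min' hne, ?_, ?_, ?_⟩
  · rw [Finset.lt_min'_iff]
    intro y hy
    simp only [Finset.mem_insert, Finset.mem_image, Finset.mem_univ, true_and] at hy
    rcases hy with rfl | ⟨i, rfl⟩
    · norm_num
    · linarith [hab i]
  · exact Finset.min'_le _ _ (Finset.mem_insert_self _ _)
  · intro i
    have := Finset.min'_le (insert (1 : ℝ) (Finset.univ.image fun i => (b i - a i) / 4))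
      ((b i - a i) / 4) (by simp)
    linarith

lemma exists_cube_subset_slab {l : ℝ} (hab : ∀ i, 4 * l ≤ b i - a i) (hl : 0 < l)
    {x : Fin n → ℝ} (hx : x ∈ slab a b P) :
    ∃ c, x ∈ Icc c (fun i => c i + l) ∧ Icc c (fun i => c i + l) ⊆ slab a b P := by
  obtain ⟨c, hc, h⟩ := exists_cube_subset (x := x) (P := P) hab hl le_rfl hl
    (by simpa using hx)
  exact ⟨c, hc, fun y hy => h y hy (by simp)⟩

lemma hasFDerivAt_continuousAt_tower {U : Set (Fin n → ℝ)}
    {G : List (Fin n) → (Fin n → ℝ) → ℝ}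
    (h : ∀ w, ∀ x ∈ U, HasFDerivAt (G w) (gradCLM fun i => G (i :: w) x) x) : IsTower U G where
  continuousOn w x hx := (h w x hx).continuousAt.continuousWithinAt
  hasLineDerivAt w i x hx := by
    simpa using (h w x hx).hasLineDerivAt (Pi.single i 1)

/-- The sup estimate on a cube inside the slab, combined with the L¹ bounds that mollification
preserves. What matters is that the right-hand side depends neither on `m` nor on the point. -/
lemma enorm_mollify_le (hw : ∀ w i, IsWeakDeriv (slab a b P) i (F w) (F (i :: w)))
    (hl : ∀ w, LocallyIntegrable ((slab a b P).indicator (F w))) {B : List (Fin n) → ENNReal}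
    (hB : ∀ w c, ∫⁻ x in slab a b P ∩ Icc c (fun i => c i + 1), ‖F w x‖ₑ ≤ B w) {l : ℝ}
    (hl0 : 0 < l) (hl1 : l ≤ 1) (hab : ∀ i, 4 * l ≤ b i - a i) {m : ℕ}
    (hm : (mollifier n m).rOut < l) (w : List (Fin n)) {x : Fin n → ℝ}
    (hx : Metric.closedBall x (mollifier n m).rOut ⊆ slab a b P) :
    ‖mollify (slab a b P) m (F w) x‖ₑ ≤ towerBound (ENNReal.ofReal l⁻¹ + 1) n B w := by
  obtain ⟨c, hxc, hc⟩ := exists_cube_subset hab hl0 (mollifier n m).rOut_pos.le hm hx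
  have ht : IsTower (Icc c fun i => c i + l) fun w => mollify (slab a b P) m (F w) :=
    hasFDerivAt_continuousAt_tower fun w y hy =>
      hasFDerivAt_mollify isOpen_slab (hl w) (hw w) (hc y hy)
  exact (ht.enorm_le_towerBound hl0 w hxc).trans (towerBound_mono (fun v =>
    lintegral_mollify_le (hl v) isOpen_slab.measurableSet (hB v) m hl1 c) n w)

lemma locallyIntegrable_indicator (hD : MeasurableSet D) {g : (Fin n → ℝ) → ℝ}
    (hg : AEStronglyMeasurable g (volume.restrict D)) {B : ENNReal} (hBt : B ≠ ⊤)
    (hB : ∀ c, ∫⁻ x in D ∩ Icc c (fun i => c i + 1), ‖g x‖ₑ ≤ B) :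
    LocallyIntegrable (D.indicator g) := by
  intro x
  refine ⟨Icc (fun i => x i - 1 / 2) (fun i => (fun i => x i - 1 / 2) i + 1), ?_, ?_⟩
  · rw [← pi_univ_Icc]
    exact set_pi_mem_nhds finite_univ fun i _ => Icc_mem_nhds (by linarith) (by linarith)
  · rw [IntegrableOn, integrable_indicator_iff hD, IntegrableOn, Measure.restrict_restrict hD]
    refine ⟨hg.mono_measure (Measure.restrict_mono inter_subset_left le_rfl), ?_⟩
    exact (hB _).trans_lt (lt_top_iff_ne_top.2 hBt)

/-- A weak tower with uniform local `L¹` bounds has Lipschitz representatives. -/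
lemma exists_lipschitz_representative (hab : ∀ i, a i < b i)
    (hw : ∀ w i, IsWeakDeriv (slab a b P) i (F w) (F (i :: w)))
    {B : List (Fin n) → ENNReal} (hBt : ∀ w, B w ≠ ⊤)
    (hB : ∀ w c, ∫⁻ x in slab a b P ∩ Icc c (fun i => c i + 1), ‖F w x‖ₑ ≤ B w)
    (w : List (Fin n)) : ∃ (K : NNReal) (g : (Fin n → ℝ) → ℝ), LipschitzWith K g ∧
      F w =ᵐ[volume.restrict (slab a b P)] g := by
  set D := slab a b P with hDdef
  have hD : IsOpen D := isOpen_slab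
  obtain ⟨l, hl0, hl1, hl⟩ := exists_side hab
  have hli : ∀ w, LocallyIntegrable (D.indicator (F w)) := fun w => by
    -- Measurability is read off from a weak derivative in some direction. In dimension zero there
    -- is none, but there every function is measurable.
    by_cases hn : Nonempty (Fin n)
    · obtain ⟨i⟩ := hn
      exact locallyIntegrable_indicator hD.measurableSet (hw w i).1.aestronglyMeasurable (hBt w)
        (hB w)
    · have : IsEmpty (Fin n) := not_nonempty_iff.1 hn
      have : Measurable (F w) := measurable_of_finite _
      exact locallyIntegrable_indicator hD.measurableSet this.aestronglyMeasurable (hBt w) (hB w)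
  set M : List (Fin n) → ENNReal := towerBound (ENNReal.ofReal l⁻¹ + 1) n B
  have hM : ∀ w, M w ≠ ⊤ := towerBound_lt_top (by simp) hBt n
  have hae := ContDiffBump.ae_convolution_tendsto_right_of_locallyIntegrable
    (μ := volume) (φ := fun m => mollifier n m) (K := 2) tendsto_mollifier_rOut
    (Eventually.of_forall fun m => le_rfl) (hli w)
  -- By Lebesgue differentiation this is almost all of `D`.
  set A : Set (Fin n → ℝ) := {x | x ∈ D ∧ Tendsto (fun m => mollify D m (F w) x) atTop (𝓝 (F w x))}
    with hA
  set K : NNReal := (∑ i, (M (i :: w)).toNNReal)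
  -- The segment between two points of the convex slab has a neighbourhood inside it. There the
  -- mollified gradients are bounded independently of `m`, and the resulting Lipschitz bound
  -- survives the limit.
  have hlip : LipschitzOnWith K (F w) A := by
    refine LipschitzOnWith.of_dist_le_mul fun x hx y hy => ?_
    have hseg : segment ℝ y x ⊆ D := convex_slab.segment_subset hy.1 hx.1
    have hsc : IsCompact (segment ℝ y x) := by
      rw [segment_eq_image]
      exact isCompact_Icc.image (by fun_prop)
    obtain ⟨δ, hδ, hδD⟩ := hsc.exists_cthickening_subset_open hD hseg
    have hev : ∀ᶠ m in atTop, dist (mollify D m (F w) x) (mollify D m (F w) y)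
        ≤ K * dist x y := by
      have h1 := tendsto_mollifier_rOut (n := n) |>.eventually (gt_mem_nhds hδ)
      have h2 := tendsto_mollifier_rOut (n := n) |>.eventually (gt_mem_nhds hl0)
      filter_upwards [h1, h2] with m hm1 hm2
      have hball : ∀ z ∈ segment ℝ y x, Metric.closedBall z (mollifier n m).rOut ⊆ D :=
        fun z hz => (Metric.closedBall_subset_closedBall hm1.le).trans
          ((Metric.closedBall_subset_cthickening hz δ).trans hδD)
      rw [dist_eq_norm, dist_eq_norm]
      refine Convex.norm_image_sub_le_of_norm_hasFDerivWithin_le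
        (f' := fun z => gradCLM fun i => mollify D m (F (i :: w)) z)
        (fun z hz => (hasFDerivAt_mollify hD (hli w) (hw w) (hball z hz)).hasFDerivWithinAt)
        (fun z hz => ?_) (convex_segment y x) (left_mem_segment ℝ y x) (right_mem_segment ℝ y x)
      refine (norm_clm_le_sum _).trans ?_
      simp only [gradCLM_single, K, NNReal.coe_sum]
      refine Finset.sum_le_sum fun i _ => ?_
      have h3 := enorm_mollify_le hw hli hB hl0 hl1 hl hm2 (i :: w) (hball z hz)
      have h4 := ENNReal.toNNReal_mono (hM _) h3
      exact_mod_cast h4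
    exact le_of_tendsto (hx.2.dist hy.2) hev
  -- The Lipschitz extension to the whole space provides boundary values at the same time.
  obtain ⟨g, hg, hgA⟩ := hlip.extend_real
  refine ⟨K, g, hg, ?_⟩
  rw [EventuallyEq, ae_restrict_iff' hD.measurableSet]
  filter_upwards [hae] with x hx hxD
  refine hgA ⟨hxD, ?_⟩
  rw [indicator_of_mem hxD] at hx
  exact hx

/-- The gradients of the mollifications converge locally uniformly, at a rate given by the Lipschitz
constant and the radius of the kernel. The theorem on limits of derivatives then makes the weak
derivative classical. -/
lemma hasFDerivAt_of_weakDeriv (hD : IsOpen D) {f : (Fin n → ℝ) → ℝ}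
    {g : Fin n → (Fin n → ℝ) → ℝ} (hf : Continuous f) {K : NNReal}
    (hg : ∀ i, LipschitzWith K (g i)) (hw : ∀ i, IsWeakDeriv D i f (g i)) {x : Fin n → ℝ}
    (hx : x ∈ D) : HasFDerivAt f (gradCLM fun i => g i x) x := by
  have hli : ∀ u : (Fin n → ℝ) → ℝ, Continuous u → LocallyIntegrable (D.indicator u) :=
    fun u hu => hu.locallyIntegrable.indicator hD.measurableSet
  obtain ⟨δ, hδ, hδD⟩ := Metric.isOpen_iff.1 hD x hx
  have hsmall : ∀ {r : ℝ}, r < δ / 2 → ∀ y ∈ Metric.ball x (δ / 2), Metric.closedBall y r ⊆ D := by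
    intro r hr y hy z hz
    refine hδD ?_
    rw [Metric.mem_ball] at hy ⊢
    rw [Metric.mem_closedBall] at hz
    linarith [dist_triangle z y x]
  have hlim : ∀ u : (Fin n → ℝ) → ℝ, Continuous u → ∀ L : ℝ, 0 < L →
      (∀ ε > 0, ∀ y, ∃ η > 0, ∀ z ∈ Metric.ball y η, dist (u z) (u y) ≤ ε) := by
    intro u hu L _ ε hε y
    obtain ⟨η, hη, h⟩ := Metric.continuousAt_iff.1 (hu.continuousAt (x := y)) ε hε
    exact ⟨η, hη, fun z hz => (h hz).le⟩
  have hev := tendsto_mollifier_rOut (n := n) |>.eventually (gt_mem_nhds (half_pos hδ))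
  refine hasFDerivAt_of_tendstoUniformlyOnFilter (l := atTop) (f := fun m => mollify D m f)
    (f' := fun m y => gradCLM fun i => mollify D m (g i) y)
    (g' := fun y => gradCLM fun i => g i y) ?_ ?_ ?_
  · rw [Metric.tendstoUniformlyOnFilter_iff]
    intro ε hε
    have h2 := tendsto_mollifier_rOut (n := n) |>.eventually
      (gt_mem_nhds (show (0 : ℝ) < ε / (n * K + 1) by positivity))
    filter_upwards [(hev.and h2).prod_mk (Metric.ball_mem_nhds x (half_pos hδ))] with p hp
    obtain ⟨⟨hp1, hp2⟩, hp3⟩ := hp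
    rw [dist_comm, dist_eq_norm]
    refine (norm_clm_le_sum _).trans_lt ?_
    have hr0 := (mollifier n p.1).rOut_pos
    have hb := hsmall hp1 p.2 hp3
    have : ∀ i, |mollify D p.1 (g i) p.2 - g i p.2| ≤ K * (mollifier n p.1).rOut := by
      intro i
      have h4 := ContDiffBump.dist_normed_convolution_le (μ := volume) (φ := mollifier n p.1)
        (g := D.indicator (g i)) (x₀ := p.2) (ε := K * (mollifier n p.1).rOut)
        (hli _ (hg i).continuous).aestronglyMeasurable ?_
      · rw [indicator_of_mem (hb (Metric.mem_closedBall_self hr0.le))] at h4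
        exact h4
      · intro z hz
        rw [indicator_of_mem (hb (Metric.ball_subset_closedBall hz)),
          indicator_of_mem (hb (Metric.mem_closedBall_self hr0.le))]
        refine ((hg i).dist_le_mul z p.2).trans ?_
        gcongr
        exact (Metric.mem_ball.1 hz).le
    calc ∑ i, |(gradCLM (fun i => mollify D p.1 (g i) p.2) - gradCLM fun i => g i p.2)
          (Pi.single i 1)| ≤ ∑ _i : Fin n, K * (mollifier n p.1).rOut :=
          Finset.sum_le_sum fun i _ => by simpa using this i
      _ = n * K * (mollifier n p.1).rOut := by simp [mul_assoc]
      _ ≤ (n * K + 1) * (mollifier n p.1).rOut := by nlinarith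
      _ < ε := by rw [lt_div_iff₀ (by positivity)] at hp2; linarith
  · filter_upwards [hev.prod_mk (Metric.ball_mem_nhds x (half_pos hδ))] with p hp
    exact hasFDerivAt_mollify hD (hli f hf) hw (hsmall hp.1 p.2 hp.2)
  · filter_upwards [Metric.ball_mem_nhds x (half_pos hδ)] with y hy
    rw [Metric.tendsto_nhds]
    intro ε hε
    obtain ⟨η, hη, hη2⟩ := hlim f hf 1 one_pos (ε / 2) (half_pos hε) y
    have h2 := tendsto_mollifier_rOut (n := n) |>.eventually (gt_mem_nhds hη)
    filter_upwards [hev, h2] with m hm1 hm2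
    have hb := hsmall hm1 y hy
    have hr0 := (mollifier n m).rOut_pos
    have h4 := ContDiffBump.dist_normed_convolution_le (μ := volume) (φ := mollifier n m)
      (g := D.indicator f) (x₀ := y) (ε := ε / 2)
      (hli _ hf).aestronglyMeasurable ?_
    · rw [indicator_of_mem (hb (Metric.mem_closedBall_self hr0.le))] at h4
      exact h4.trans_lt (half_lt_self hε)
    · intro z hz
      rw [indicator_of_mem (hb (Metric.ball_subset_closedBall hz)),
        indicator_of_mem (hb (Metric.mem_closedBall_self hr0.le))]
      exact hη2 z (Metric.ball_subset_ball hm2.le hz)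

/-- On a convex open set a derivative with a limit at a boundary point is the derivative there;
continuity of `g` on the closure supplies the limit. -/
lemma IsSlab.hasFDerivWithinAt_closure (h : IsSlab D P) {f : (Fin n → ℝ) → ℝ}
    {g : Fin n → (Fin n → ℝ) → ℝ} (hf : ContinuousOn f (closure D))
    (hg : ∀ i, ContinuousOn (g i) (closure D))
    (hd : ∀ x ∈ D, HasFDerivAt f (gradCLM fun i => g i x) x) :
    ∀ x ∈ closure D, HasFDerivWithinAt f (gradCLM fun i => g i x) (closure D) x := by
  intro x hx
  refine hasFDerivWithinAt_closure_of_tendsto_fderiv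
    (fun y hy => (hd y hy).differentiableAt.differentiableWithinAt) h.convex h.isOpen
    (fun y hy => (hf y hy).mono subset_closure) ?_
  have h1 : Tendsto (fun y => gradCLM fun i => g i y) (𝓝[D] x) (𝓝 (gradCLM fun i => g i x)) := by
    unfold gradCLM
    refine tendsto_finsetSum _ fun i _ => ?_
    exact (((hg i x hx).mono subset_closure).tendsto).smul_const _
  refine h1.congr' ?_
  filter_upwards [self_mem_nhdsWithin] with y hy
  exact (hd y hy).fderiv.symm

lemma IsSlab.contDiffOn_of_tower (h : IsSlab D P) {G : List (Fin n) → (Fin n → ℝ) → ℝ}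
    (hc : ∀ w, ContinuousOn (G w) (closure D))
    (hd : ∀ w, ∀ x ∈ D, HasFDerivAt (G w) (gradCLM fun i => G (i :: w) x) x) (w : List (Fin n)) :
    ContDiffOn ℝ ∞ (G w) (closure D) := by
  rw [contDiffOn_infty]
  intro m
  induction m generalizing w with
  | zero => exact contDiffOn_zero.2 (hc w)
  | succ m ih =>
    push_cast
    rw [contDiffOn_succ_iff_hasFDerivWithinAt_of_uniqueDiffOn h.uniqueDiffOn]
    refine ⟨by simp, fun x => gradCLM fun i => G (i :: w) x, ?_,
      h.hasFDerivWithinAt_closure (hc w) (fun i => hc _) (hd w)⟩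
    unfold gradCLM
    exact ContDiffOn.sum fun i _ => (ih (i :: w)).smul contDiffOn_const

/-- Sobolev embedding. -/
theorem MemHInf.isSmooth (h : IsSlab D P) {f : (Fin n → ℝ) → ℝ} (hf : MemHInf D P f) :
    IsSmooth D P f := by
  refine ⟨?_, hf.periodic⟩
  obtain ⟨F, hF0, hFw, hF2⟩ := exists_weak_tower h.isOpen hf.sobolev
  have hper : IsPeriodic D P (F []) := hF0 ▸ hf.periodic
  have hfin := h.isFiniteMeasure
  have hB := fun w => lintegral_cube_le h (g := F w)
    (fun k => weak_tower_latticeVec h hper hFw k w)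
  have hBt : ∀ w, (2 : ENNReal) ^ n * ∫⁻ x in D ∩ cell P, ‖F w x‖ₑ ≠ ⊤ := fun w =>
    ENNReal.mul_ne_top (by simp) ((hF2 w).integrable (by norm_num)).2.ne
  have h' := h
  obtain ⟨a, b, hab, rfl⟩ := h'
  choose K G hG hFG using exists_lipschitz_representative hab hFw hBt hB
  have hGw : ∀ w i, IsWeakDeriv (slab a b P) i (G w) (G (i :: w)) := fun w i =>
    (hFw w i).congr (hFG w) (hFG _)
  have hd : ∀ w, ∀ x ∈ slab a b P, HasFDerivAt (G w) (gradCLM fun i => G (i :: w) x) x := by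
    intro w x hx
    refine hasFDerivAt_of_weakDeriv h.isOpen (hG w).continuous (K := ∑ i, K (i :: w))
      (fun i => (hG (i :: w)).weaken ?_) (hGw w) hx
    exact Finset.single_le_sum (f := fun i => K (i :: w)) (fun _ _ => zero_le) (Finset.mem_univ i)
  have hs := h.contDiffOn_of_tower (fun w => (hG w).continuous.continuousOn) hd []
  have heq : EqOn f (G []) (slab a b P) := by
    refine Measure.eqOn_open_of_ae_eq (μ := volume) (hF0 ▸ hFG []) h.isOpen
      (hf.continuousOn.mono subset_closure) (hG []).continuous.continuousOn
  exact hs.congr (heq.of_subset_closure hf.continuousOn (hG []).continuous.continuousOn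
    subset_closure subset_rfl)

end Embedding

/-! ### Calculus of partial derivatives up to the boundary -/

section Calculus

variable {n m : ℕ} {D : Set (Fin n → ℝ)} {P : Set (Fin n)} {D' : Set (Fin m → ℝ)} {P' : Set (Fin m)}
  {f g : (Fin n → ℝ) → ℝ} {i j : Fin n} {x : Fin n → ℝ}

lemma IsSmooth.congr (h : IsSlab D P) (hf : IsSmooth D P f) (hfg : EqOn g f (closure D)) :
    IsSmooth D P g := by
  refine ⟨hf.contDiffOn.congr hfg, fun i hi x hx => ?_⟩
  have hx' : x + Pi.single i (2 * Real.pi) ∈ closure D :=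
    h.mem_closure_of_eq hx fun j hj => by
      have : j ≠ i := by rintro rfl; exact hj hi
      simp [this]
  rw [hfg hx, hfg hx', hf.periodic i hi x hx]

lemma IsSmooth.const (c : ℝ) : IsSmooth D P fun _ => c := ⟨contDiffOn_const, fun _ _ _ _ => rfl⟩

lemma IsSmooth.add (hf : IsSmooth D P f) (hg : IsSmooth D P g) :
    IsSmooth D P fun x => f x + g x :=
  ⟨hf.contDiffOn.add hg.contDiffOn, fun i hi x hx => by
    simp only [hf.periodic i hi x hx, hg.periodic i hi x hx]⟩

lemma IsSmooth.mul (hf : IsSmooth D P f) (hg : IsSmooth D P g) :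
    IsSmooth D P fun x => f x * g x :=
  ⟨hf.contDiffOn.mul hg.contDiffOn, fun i hi x hx => by
    simp only [hf.periodic i hi x hx, hg.periodic i hi x hx]⟩

lemma IsSmooth.const_mul (c : ℝ) (hf : IsSmooth D P f) : IsSmooth D P fun x => c * f x :=
  (IsSmooth.const c).mul hf

lemma IsSmooth.neg (hf : IsSmooth D P f) : IsSmooth D P fun x => -f x := by
  simpa using hf.const_mul (-1)

lemma IsSmooth.sub (hf : IsSmooth D P f) (hg : IsSmooth D P g) :
    IsSmooth D P fun x => f x - g x := by
  simpa [sub_eq_add_neg] using hf.add hg.neg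

lemma IsSmooth.sum {ι : Type*} (s : Finset ι) {F : ι → (Fin n → ℝ) → ℝ}
    (hF : ∀ k ∈ s, IsSmooth D P (F k)) : IsSmooth D P fun x => ∑ k ∈ s, F k x :=
  ⟨ContDiffOn.sum fun k hk => (hF k hk).contDiffOn, fun i hi x hx =>
    Finset.sum_congr rfl fun k hk => (hF k hk).periodic i hi x hx⟩

lemma IsSmooth.continuousOn (hf : IsSmooth D P f) : ContinuousOn f (closure D) :=
  hf.contDiffOn.continuousOn

lemma IsSmooth.hasFDerivWithinAt (hf : IsSmooth D P f) (hx : x ∈ closure D) :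
    HasFDerivWithinAt f (gradCLM fun i => pd D i f x) (closure D) x := by
  have h1 := ((hf.contDiffOn.differentiableOn (by simp)) x hx).hasFDerivWithinAt
  rw [clm_eq_gradCLM (fderivWithin ℝ f (closure D) x)] at h1
  exact h1

lemma IsSlab.pd_eq (h : IsSlab D P) {A : (Fin n → ℝ) →L[ℝ] ℝ} (hx : x ∈ closure D)
    (hA : HasFDerivWithinAt f A (closure D) x) : pd D i f x = A (Pi.single i 1) := by
  rw [pd, hA.fderivWithin (h.uniqueDiffOn x hx)]

lemma pd_congr (hfg : EqOn f g (closure D)) (hx : x ∈ closure D) : pd D i f x = pd D i g x := by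
  rw [pd, pd, fderivWithin_congr hfg (hfg hx)]

lemma IsSmooth.hasLineDerivAt (h : IsSlab D P) (hf : IsSmooth D P f) (hx : x ∈ D) :
    HasLineDerivAt ℝ f (pd D i f x) x (Pi.single i 1) := by
  have h1 := (hf.hasFDerivWithinAt (subset_closure hx)).hasFDerivAt
    (Filter.mem_of_superset (h.isOpen.mem_nhds hx) subset_closure)
  simpa using h1.hasLineDerivAt (Pi.single i 1)

lemma IsSmooth.isWeakDeriv (h : IsSlab D P) (hf : IsSmooth D P f)
    (hc : ContinuousOn (pd D i f) D) : IsWeakDeriv D i f (pd D i f) :=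
  IsWeakDeriv.of_hasLineDerivAt (hf.continuousOn.mono subset_closure) hc h.isOpen
    fun _ hx => hf.hasLineDerivAt h hx

/-- Composition with a smooth map of slabs that respects the periods. -/
lemma IsSmooth.comp (hf : IsSmooth D P f) {A : (Fin m → ℝ) → Fin n → ℝ} (hA : ContDiff ℝ ∞ A)
    (hm : MapsTo A (closure D') (closure D))
    (hp : ∀ i ∈ P', ∃ j ∈ P, ∀ x, A (x + Pi.single i (2 * Real.pi))
      = A x + Pi.single j (2 * Real.pi)) : IsSmooth D' P' fun x => f (A x) := by
  refine ⟨hf.contDiffOn.comp hA.contDiffOn hm, fun i hi x hx => ?_⟩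
  obtain ⟨j, hj, e⟩ := hp i hi
  simp only [e]
  exact hf.periodic j hj _ (hm hx)

/-- The chain rule needs only one column of the Jacobian of `A`. Stating it through `hv` avoids
computing that Jacobian for the maps of interest, which are straight in the direction concerned. -/
lemma IsSmooth.pd_comp (h' : IsSlab D' P') (hf : IsSmooth D P f)
    {A : (Fin m → ℝ) → Fin n → ℝ} (hA : ContDiff ℝ ∞ A)
    (hm : MapsTo A (closure D') (closure D)) {x : Fin m → ℝ} (hx : x ∈ closure D') {i : Fin m}
    {v : Fin n → ℝ} (hv : ∀ s : ℝ, A (x + s • Pi.single i 1) = A x + s • v) :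
    pd D' i (fun x => f (A x)) x = ∑ j, v j * pd D j f (A x) := by
  have hAx : HasFDerivAt A (fderiv ℝ A x) x := ((hA.differentiable (by simp)) x).hasFDerivAt
  have h1 := (hf.hasFDerivWithinAt (hm hx)).comp x hAx.hasFDerivWithinAt hm
  have h2 : fderiv ℝ A x (Pi.single i 1) = v := by
    have h3 : HasDerivAt (fun s : ℝ => A (x + s • Pi.single i 1)) (fderiv ℝ A x (Pi.single i 1)) 0 :=
      hAx.hasLineDerivAt _
    simp only [hv] at h3
    have h4 : HasDerivAt (fun s : ℝ => A x + s • v) v 0 := by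
      simpa using ((hasDerivAt_id (0 : ℝ)).smul_const v).const_add (A x)
    exact h3.unique h4
  have := h'.pd_eq (i := i) hx h1
  rw [show (fun x => f (A x)) = f ∘ A from rfl, this]
  simp only [ContinuousLinearMap.comp_apply, h2, gradCLM_apply]
  exact Finset.sum_congr rfl fun _ _ => mul_comm _ _

lemma IsSmooth.pd (h : IsSlab D P) (hf : IsSmooth D P f) (i : Fin n) :
    IsSmooth D P (pd D i f) := by
  refine ⟨(hf.contDiffOn.fderivWithin h.uniqueDiffOn (m := ∞) (by simp)).clm_apply
    contDiffOn_const, fun j hj x hx => ?_⟩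
  have hm : MapsTo (fun x => x + Pi.single j (2 * Real.pi)) (closure D) (closure D) := fun x hx =>
    h.mem_closure_of_eq hx fun k hk => by
      have : k ≠ j := by rintro rfl; exact hk hj
      simp [this]
  have h1 := hf.pd_comp h (A := fun x => x + Pi.single j (2 * Real.pi)) (by fun_prop) hm hx (i := i)
    (v := Pi.single i 1) (fun s => by abel)
  rw [← pd_congr (fun y hy => hf.periodic j hj y hy) hx, h1,
    Finset.sum_eq_single i (fun k _ hk => by simp [hk]) (by simp)]
  simp

/-- On slabs, `H^∞` consists of the periodic functions that are smooth up to the boundary. -/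
theorem memHInf_iff_isSmooth (h : IsSlab D P) : MemHInf D P f ↔ IsSmooth D P f := by
  refine ⟨MemHInf.isSmooth h, fun hf => memHInf_of_closed h (C := {f | IsSmooth D P f})
    (fun f hf => hf.continuousOn) (fun f hf => hf.periodic) (fun f hf i => ?_) f hf⟩
  exact ⟨_, hf.pd h i, hf.isWeakDeriv h ((hf.pd h i).continuousOn.mono subset_closure)⟩

lemma pd_add (h : IsSlab D P) (hf : IsSmooth D P f) (hg : IsSmooth D P g) (hx : x ∈ closure D) :
    pd D i (fun x => f x + g x) x = pd D i f x + pd D i g x := by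
  have := h.pd_eq (f := fun x => f x + g x) (i := i) hx
    ((hf.hasFDerivWithinAt hx).add (hg.hasFDerivWithinAt hx))
  simpa using this

lemma pd_sub (h : IsSlab D P) (hf : IsSmooth D P f) (hg : IsSmooth D P g) (hx : x ∈ closure D) :
    pd D i (fun x => f x - g x) x = pd D i f x - pd D i g x := by
  have := h.pd_eq (f := fun x => f x - g x) (i := i) hx
    ((hf.hasFDerivWithinAt hx).sub (hg.hasFDerivWithinAt hx))
  simpa using this

lemma pd_mul (h : IsSlab D P) (hf : IsSmooth D P f) (hg : IsSmooth D P g) (hx : x ∈ closure D) :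
    pd D i (fun x => f x * g x) x = f x * pd D i g x + g x * pd D i f x := by
  have := h.pd_eq (f := fun x => f x * g x) (i := i) hx
    ((hf.hasFDerivWithinAt hx).mul (hg.hasFDerivWithinAt hx))
  simpa using this

lemma pd_const (h : IsSlab D P) (c : ℝ) (hx : x ∈ closure D) : pd D i (fun _ => c) x = 0 := by
  have := h.pd_eq (i := i) hx (hasFDerivWithinAt_const c x (closure D))
  simpa using this

lemma pd_const_mul (h : IsSlab D P) (c : ℝ) (hf : IsSmooth D P f) (hx : x ∈ closure D) :
    pd D i (fun x => c * f x) x = c * pd D i f x := by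
  rw [pd_mul h (IsSmooth.const c) hf hx, pd_const h c hx, mul_zero, add_zero]

lemma pd_sum (h : IsSlab D P) {ι : Type*} (s : Finset ι) {F : ι → (Fin n → ℝ) → ℝ}
    (hF : ∀ k ∈ s, IsSmooth D P (F k)) (hx : x ∈ closure D) :
    pd D i (fun x => ∑ k ∈ s, F k x) x = ∑ k ∈ s, pd D i (F k) x := by
  have := h.pd_eq (i := i) hx
    (HasFDerivWithinAt.fun_sum fun k hk => (hF k hk).hasFDerivWithinAt hx)
  simpa using this

/-- Symmetry of the second derivative reaches the boundary because the closed slab has unique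
derivatives and lies in the closure of its interior. -/
lemma pd_comm (h : IsSlab D P) (hf : IsSmooth D P f) (i j : Fin n) (hx : x ∈ closure D) :
    pd D i (pd D j f) x = pd D j (pd D i f) x := by
  have hs : IsSymmSndFDerivWithinAt ℝ f (closure D) x :=
    (hf.contDiffOn x hx).isSymmSndFDerivWithinAt (by simpa using two_le_infty) h.uniqueDiffOn
      (h.closure_subset_closure_interior hx) hx
  have hd : DifferentiableWithinAt ℝ (fderivWithin ℝ f (closure D)) (closure D) x :=
    ((hf.contDiffOn.fderivWithin h.uniqueDiffOn (m := ∞) (by simp)).differentiableOn (by simp)) x hx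
  have key : ∀ k l : Fin n, pd D k (pd D l f) x
      = fderivWithin ℝ (fderivWithin ℝ f (closure D)) (closure D) x (Pi.single k 1)
        (Pi.single l 1) := by
    intro k l
    have h1 := h.pd_eq (f := pd D l f) (i := k) hx
      (hd.hasFDerivWithinAt.clm_apply (hasFDerivWithinAt_const (Pi.single l (1 : ℝ) : Fin n → ℝ) x (closure D)))
    rw [h1]; simp
  rw [key, key]
  exact hs _ _

/-- Iterated partial derivatives. -/
def dw (D : Set (Fin n → ℝ)) : List (Fin n) → ((Fin n → ℝ) → ℝ) → (Fin n → ℝ) → ℝ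
  | [], f => f
  | i :: w, f => VortexSheet.pd D i (dw D w f)

lemma dw_append (u v : List (Fin n)) : dw D (u ++ v) f = dw D u (dw D v f) := by
  induction u with
  | nil => rfl
  | cons i u ih => simp only [List.cons_append, dw, ih]

lemma IsSmooth.dw (h : IsSlab D P) (hf : IsSmooth D P f) (w : List (Fin n)) :
    IsSmooth D P (dw D w f) := by
  induction w with
  | nil => exact hf
  | cons i w ih => exact ih.pd h i

lemma dw_congr (w : List (Fin n)) (hfg : EqOn f g (closure D)) :
    EqOn (dw D w f) (dw D w g) (closure D) := by
  induction w with
  | nil => exact hfg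
  | cons i w ih => exact fun x hx => pd_congr ih hx

lemma dw_add (h : IsSlab D P) (hf : IsSmooth D P f) (hg : IsSmooth D P g) (w : List (Fin n)) :
    EqOn (dw D w fun x => f x + g x) (fun x => dw D w f x + dw D w g x) (closure D) := by
  induction w with
  | nil => exact fun x _ => rfl
  | cons i w ih =>
    intro x hx
    simp only [dw]
    rw [pd_congr ih hx, pd_add h (hf.dw h w) (hg.dw h w) hx]

lemma dw_const_mul (h : IsSlab D P) (c : ℝ) (hf : IsSmooth D P f) (w : List (Fin n)) :
    EqOn (dw D w fun x => c * f x) (fun x => c * dw D w f x) (closure D) := by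
  induction w with
  | nil => exact fun x _ => rfl
  | cons i w ih =>
    intro x hx
    simp only [dw]
    rw [pd_congr ih hx, pd_const_mul h c (hf.dw h w) hx]

lemma dw_sub (h : IsSlab D P) (hf : IsSmooth D P f) (hg : IsSmooth D P g) (w : List (Fin n)) :
    EqOn (dw D w fun x => f x - g x) (fun x => dw D w f x - dw D w g x) (closure D) := by
  induction w with
  | nil => exact fun x _ => rfl
  | cons i w ih =>
    intro x hx
    simp only [dw]
    rw [pd_congr ih hx, pd_sub h (hf.dw h w) (hg.dw h w) hx]

lemma dw_perm (h : IsSlab D P) (hf : IsSmooth D P f) {u v : List (Fin n)} (huv : u.Perm v) :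
    EqOn (dw D u f) (dw D v f) (closure D) := by
  induction huv with
  | nil => exact fun x _ => rfl
  | cons i _ ih => exact fun x hx => pd_congr ih hx
  | swap i j w => exact fun x hx => pd_comm h (hf.dw h w) j i hx
  | trans _ _ ih1 ih2 => exact ih1.trans ih2

lemma IsSmooth.isTower (h : IsSlab D P) (hf : IsSmooth D P f) :
    IsTower D fun w => VortexSheet.dw D w f where
  continuousOn w := (hf.dw h w).continuousOn.mono subset_closure
  hasLineDerivAt w _ _ hx := (hf.dw h w).hasLineDerivAt h hx

/-- Identities between continuous functions extend to the closure. -/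
lemma IsSmooth.eqOn_closure (hf : IsSmooth D P f) (hg : IsSmooth D P g) (hfg : EqOn f g D) :
    EqOn f g (closure D) :=
  hfg.of_subset_closure hf.continuousOn hg.continuousOn subset_closure subset_rfl

end Calculus

/-! ### The domains of the problem, and restriction to time slices and to the boundary -/

section Domains

/-- The lower end of the interval `I s`. -/
def lo : Side → ℝ
  | .plus => 0
  | .minus => -1

/-- The upper end of the interval `I s`. -/
def hi : Side → ℝ
  | .plus => 1
  | .minus => 0

lemma I_eq (s : Side) : I s = Ioo (lo s) (hi s) := by cases s <;> rfl

lemma lo_lt_hi (s : Side) : lo s < hi s := by cases s <;> norm_num [lo, hi]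

lemma zero_mem_Icc (s : Side) : (0 : ℝ) ∈ Icc (lo s) (hi s) := by
  cases s <;> norm_num [lo, hi]

lemma wall_mem_Icc (s : Side) : wall s ∈ Icc (lo s) (hi s) := by
  cases s <;> norm_num [lo, hi, wall]

lemma wall_ne_zero (s : Side) : wall s ≠ 0 := by cases s <;> norm_num [wall]

lemma Om_eq (s : Side) : Om s = slab (fun _ => lo s) (fun _ => hi s) {0, 1} := by
  ext y
  simp [Om, slab, I_eq, Fin.forall_fin_succ, Set.mem_pi]

/-- The middle entries of both vectors belong to the periodic coordinates and impose nothing; 0 and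
T are chosen there only so that every interval is nondegenerate. -/
lemma Cyl_eq (T : ℝ) (s : Side) :
    Cyl T s = slab ![0, 0, 0, lo s] ![T, T, T, hi s] {1, 2} := by
  ext y
  simp [Cyl, slab, I_eq, Fin.forall_fin_succ, Set.mem_pi]

lemma BCyl_eq (T : ℝ) : BCyl T = slab (fun _ => 0) (fun _ => T) {1, 2} := by
  ext y
  simp [BCyl, slab, Fin.forall_fin_succ, Set.mem_pi]

lemma isSlab_Om (s : Side) : IsSlab (Om s) {0, 1} := ⟨_, _, fun _ => lo_lt_hi s, Om_eq s⟩

/-- The degenerate case in which all coordinates are periodic: it allows traces on horizontal planes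
at a fixed time to be differentiated with the same rules. -/
lemma isSlab_univ : IsSlab (univ : Set (Fin 2 → ℝ)) univ :=
  ⟨0, 1, fun _ => one_pos, by simp [slab]⟩

variable {T : ℝ} {s : Side}

lemma isSlab_Cyl (hT : 0 < T) (s : Side) : IsSlab (Cyl T s) {1, 2} := by
  refine ⟨_, _, ?_, Cyl_eq T s⟩
  simp [Fin.forall_fin_succ, hT]
  exact lo_lt_hi s

lemma isSlab_BCyl (hT : 0 < T) : IsSlab (BCyl T) {1, 2} := ⟨_, _, fun _ => hT, BCyl_eq T⟩

lemma mem_closure_Om {y : Fin 3 → ℝ} : y ∈ closure (Om s) ↔ y 2 ∈ Icc (lo s) (hi s) := by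
  rw [Om_eq, closure_slab fun _ => lo_lt_hi s]
  simp [Fin.forall_fin_succ, Set.mem_pi]

lemma mem_closure_Cyl (hT : 0 < T) {x : Fin 4 → ℝ} :
    x ∈ closure (Cyl T s) ↔ x 0 ∈ Icc 0 T ∧ x 3 ∈ Icc (lo s) (hi s) := by
  rw [Cyl_eq, closure_slab (by simp [Fin.forall_fin_succ, hT]; exact lo_lt_hi s)]
  simp [Fin.forall_fin_succ, Set.mem_pi]

lemma mem_closure_BCyl (hT : 0 < T) {z : Fin 3 → ℝ} : z ∈ closure (BCyl T) ↔ z 0 ∈ Icc 0 T := by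
  rw [BCyl_eq, closure_slab fun _ => hT]
  simp [Fin.forall_fin_succ, Set.mem_pi]

lemma atTime_mem (hT : 0 < T) {t : ℝ} (ht : t ∈ Icc 0 T) {y : Fin 3 → ℝ}
    (hy : y ∈ closure (Om s)) : atTime t y ∈ closure (Cyl T s) :=
  (mem_closure_Cyl hT).2 ⟨ht, mem_closure_Om.1 hy⟩

lemma atHeight_mem_Om {a : ℝ} (ha : a ∈ Icc (lo s) (hi s)) (z : Fin 2 → ℝ) :
    atHeight a z ∈ closure (Om s) := mem_closure_Om.2 ha

lemma atHeight_mem (hT : 0 < T) {a : ℝ} (ha : a ∈ Icc (lo s) (hi s)) {z : Fin 3 → ℝ}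
    (hz : z ∈ closure (BCyl T)) : atHeight a z ∈ closure (Cyl T s) :=
  (mem_closure_Cyl hT).2 ⟨(mem_closure_BCyl hT).1 hz, ha⟩

lemma atTime_mem_BCyl (hT : 0 < T) {t : ℝ} (ht : t ∈ Icc 0 T) (z : Fin 2 → ℝ) :
    atTime t z ∈ closure (BCyl T) := (mem_closure_BCyl hT).2 ht

lemma atTime_atHeight (t a : ℝ) (z : Fin 2 → ℝ) :
    atTime t (atHeight a z) = atHeight a (atTime t z) := by
  ext i; fin_cases i <;> rfl

lemma atTime_eta {n : ℕ} (x : Fin (n + 1) → ℝ) : atTime (x 0) (Fin.tail x) = x := Fin.cons_self_tail x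

lemma atTime_add_smul_single {n : ℕ} (t : ℝ) (y : Fin n → ℝ) (r : ℝ) (i : Fin n) :
    atTime t (y + r • Pi.single i 1) = atTime t y + r • Pi.single i.succ 1 := by
  ext k
  refine Fin.cases ?_ (fun k => ?_) k
  · simp [atTime]
  · simp [atTime, Pi.single_apply]

lemma atHeight_add_smul_single {n : ℕ} (a : ℝ) (y : Fin n → ℝ) (r : ℝ) (i : Fin n) :
    atHeight a (y + r • Pi.single i 1) = atHeight a y + r • Pi.single i.castSucc 1 := by
  ext k
  refine Fin.lastCases ?_ (fun k => ?_) k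
  · simp [atHeight, (Fin.castSucc_ne_last i).symm]
  · simp [atHeight, Pi.single_apply]

lemma single_eq_smul {n : ℕ} (i : Fin n) (r : ℝ) :
    (Pi.single i r : Fin n → ℝ) = r • Pi.single i 1 := by
  rw [← Pi.single_smul, smul_eq_mul, mul_one]

lemma contDiff_atTime {n : ℕ} (t : ℝ) : ContDiff ℝ ∞ fun y : Fin n → ℝ => atTime t y := by
  refine contDiff_pi.2 fun i => ?_
  refine Fin.cases ?_ (fun k => ?_) i
  · exact contDiff_const
  · simpa [atTime] using contDiff_apply ℝ ℝ k

lemma contDiff_atHeight {n : ℕ} (a : ℝ) : ContDiff ℝ ∞ fun y : Fin n → ℝ => atHeight a y := by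
  refine contDiff_pi.2 fun i => ?_
  refine Fin.lastCases ?_ (fun k => ?_) i
  · simpa [atHeight] using contDiff_const
  · simpa [atHeight] using contDiff_apply ℝ ℝ k

section PdComp

variable {n m : ℕ} {D : Set (Fin n → ℝ)} {P : Set (Fin n)} {D' : Set (Fin m → ℝ)} {P' : Set (Fin m)}
  {f : (Fin n → ℝ) → ℝ}

lemma IsSmooth.pd_comp_single (h' : IsSlab D' P') (hf : IsSmooth D P f)
    {A : (Fin m → ℝ) → Fin n → ℝ} (hA : ContDiff ℝ ∞ A)
    (hm : MapsTo A (closure D') (closure D)) {x : Fin m → ℝ} (hx : x ∈ closure D') {i : Fin m}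
    {k : Fin n} (hv : ∀ s : ℝ, A (x + s • Pi.single i 1) = A x + s • Pi.single k 1) :
    VortexSheet.pd D' i (fun x => f (A x)) x = VortexSheet.pd D k f (A x) := by
  rw [hf.pd_comp h' hA hm hx hv, Finset.sum_eq_single k (fun j _ hj => by simp [hj]) (by simp)]
  simp

lemma IsSmooth.pd_comp_zero (h' : IsSlab D' P') (hf : IsSmooth D P f)
    {A : (Fin m → ℝ) → Fin n → ℝ} (hA : ContDiff ℝ ∞ A)
    (hm : MapsTo A (closure D') (closure D)) {x : Fin m → ℝ} (hx : x ∈ closure D') {i : Fin m}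
    (hv : ∀ s : ℝ, A (x + s • Pi.single i 1) = A x) :
    VortexSheet.pd D' i (fun x => f (A x)) x = 0 := by
  rw [hf.pd_comp h' hA hm hx (v := 0) (by simpa using hv)]
  simp

end PdComp

variable {f : (Fin 4 → ℝ) → ℝ}

lemma IsSmooth.atTime (hT : 0 < T) (hf : IsSmooth (Cyl T s) {1, 2} f) {t : ℝ}
    (ht : t ∈ Icc 0 T) : IsSmooth (Om s) {0, 1} fun y => f (VortexSheet.atTime t y) := by
  refine hf.comp (contDiff_atTime t) (fun y hy => atTime_mem hT ht hy) fun i hi => ⟨i.succ, ?_, ?_⟩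
  · rcases hi with rfl | rfl <;> simp
  · intro x
    rw [single_eq_smul, atTime_add_smul_single, ← single_eq_smul]

lemma pd_atTime (hT : 0 < T) (hf : IsSmooth (Cyl T s) {1, 2} f) {t : ℝ}
    (ht : t ∈ Icc 0 T) {y : Fin 3 → ℝ} (hy : y ∈ closure (Om s)) (i : Fin 3) :
    pd (Om s) i (fun y => f (atTime t y)) y = pd (Cyl T s) i.succ f (atTime t y) :=
  hf.pd_comp_single (isSlab_Om s) (contDiff_atTime t) (fun _ hy => atTime_mem hT ht hy) hy
    fun r => atTime_add_smul_single t y r i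

lemma dw_atTime (hT : 0 < T) (hf : IsSmooth (Cyl T s) {1, 2} f) {t : ℝ}
    (ht : t ∈ Icc 0 T) (w : List (Fin 3)) :
    EqOn (dw (Om s) w fun y => f (atTime t y))
      (fun y => dw (Cyl T s) (w.map Fin.succ) f (atTime t y)) (closure (Om s)) := by
  induction w with
  | nil => exact fun y _ => rfl
  | cons i w ih =>
    intro y hy
    simp only [dw, List.map_cons]
    rw [pd_congr ih hy, pd_atTime hT (hf.dw (isSlab_Cyl hT s) _) ht hy]

lemma IsSmooth.atHeight (hT : 0 < T) (hf : IsSmooth (Cyl T s) {1, 2} f) {a : ℝ}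
    (ha : a ∈ Icc (lo s) (hi s)) :
    IsSmooth (BCyl T) {1, 2} fun z => f (VortexSheet.atHeight a z) := by
  refine hf.comp (contDiff_atHeight a) (fun z hz => atHeight_mem hT ha hz)
    fun i hi => ⟨i.castSucc, ?_, ?_⟩
  · rcases hi with rfl | rfl <;> simp
  · intro x
    rw [single_eq_smul, atHeight_add_smul_single, ← single_eq_smul]

lemma pd_atHeight (hT : 0 < T) (hf : IsSmooth (Cyl T s) {1, 2} f) {a : ℝ}
    (ha : a ∈ Icc (lo s) (hi s)) {z : Fin 3 → ℝ} (hz : z ∈ closure (BCyl T)) (i : Fin 3) :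
    pd (BCyl T) i (fun z => f (atHeight a z)) z = pd (Cyl T s) i.castSucc f (atHeight a z) :=
  hf.pd_comp_single (isSlab_BCyl hT) (contDiff_atHeight a) (fun _ hz => atHeight_mem hT ha hz) hz
    fun r => atHeight_add_smul_single a z r i

/-- Tangential derivatives are derivatives of the trace. This is where flatness of the boundary
enters the regularity theory. -/
lemma pd_Om_atHeight {p : (Fin 3 → ℝ) → ℝ} (hp : IsSmooth (Om s) {0, 1} p) {a : ℝ}
    (ha : a ∈ Icc (lo s) (hi s)) (h0 : ∀ z, p (atHeight a z) = 0) (j : Fin 2) (z : Fin 2 → ℝ) :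
    pd (Om s) j.castSucc p (atHeight a z) = 0 := by
  have h1 := hp.pd_comp_single isSlab_univ (contDiff_atHeight a)
    (fun z _ => atHeight_mem_Om ha z) (x := z) (by simp)
    (fun r => atHeight_add_smul_single a z r j)
  rw [← h1]
  simp only [h0]
  exact pd_const isSlab_univ 0 (by simp)

/-- A function on `[0, T] × 𝕋²`, viewed as a function on `[0, T] × Ω₀^±`. -/
lemma IsSmooth.comp_init (hT : 0 < T) {g : (Fin 3 → ℝ) → ℝ} (hg : IsSmooth (BCyl T) {1, 2} g) :
    IsSmooth (Cyl T s) {1, 2} fun x => g (Fin.init x) := by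
  refine hg.comp (contDiff_pi.2 fun i => contDiff_apply ℝ ℝ i.castSucc)
    (fun x hx => (mem_closure_BCyl hT).2 ((mem_closure_Cyl hT).1 hx).1) fun i hi => ?_
  rcases hi with rfl | rfl
  · exact ⟨1, by simp, fun x => by ext k; fin_cases k <;> simp [Fin.init]⟩
  · exact ⟨2, by simp, fun x => by ext k; fin_cases k <;> simp [Fin.init]⟩

lemma pd_comp_init_last (hT : 0 < T) {g : (Fin 3 → ℝ) → ℝ} (hg : IsSmooth (BCyl T) {1, 2} g)
    {x : Fin 4 → ℝ} (hx : x ∈ closure (Cyl T s)) :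
    pd (Cyl T s) 3 (fun x => g (Fin.init x)) x = 0 := by
  refine hg.pd_comp_zero (isSlab_Cyl hT s) (contDiff_pi.2 fun i => contDiff_apply ℝ ℝ i.castSucc)
    (fun x hx => (mem_closure_BCyl hT).2 ((mem_closure_Cyl hT).1 hx).1) hx fun r => ?_
  ext k; fin_cases k <;> simp

/-- The value at the point `y' = 0` of the sheet, viewed as a function of time on
`[0, T] × Ω₀^±`. -/
lemma IsSmooth.comp_time (hT : 0 < T) {g : (Fin 3 → ℝ) → ℝ} (hg : IsSmooth (BCyl T) {1, 2} g) :
    IsSmooth (Cyl T s) {1, 2} fun x => g (VortexSheet.atTime (x 0) 0) := by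
  have hA : ContDiff ℝ ∞ fun x : Fin 4 → ℝ => (VortexSheet.atTime (x 0) 0 : Fin 3 → ℝ) := by
    refine contDiff_pi.2 fun i => ?_
    refine Fin.cases ?_ (fun k => ?_) i
    · exact contDiff_apply ℝ ℝ 0
    · simpa [VortexSheet.atTime] using contDiff_const
  refine ⟨hg.contDiffOn.comp hA.contDiffOn
    (fun x hx => (mem_closure_BCyl hT).2 ((mem_closure_Cyl hT).1 hx).1), fun i hi x hx => ?_⟩
  rcases hi with rfl | rfl <;> simp

lemma isSmooth_apply_three : IsSmooth (Cyl T s) {1, 2} fun x => x 3 := by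
  refine ⟨(contDiff_apply ℝ ℝ 3).contDiffOn, fun i hi x hx => ?_⟩
  rcases hi with rfl | rfl <;> simp

lemma pd_apply_three (hT : 0 < T) {x : Fin 4 → ℝ} (hx : x ∈ closure (Cyl T s)) :
    pd (Cyl T s) 3 (fun x => x 3) x = 1 := by
  have h1 : HasFDerivWithinAt (fun x : Fin 4 → ℝ => x 3)
    (ContinuousLinearMap.proj 3 : (Fin 4 → ℝ) →L[ℝ] ℝ) (closure (Cyl T s)) x :=
    (ContinuousLinearMap.proj 3 : (Fin 4 → ℝ) →L[ℝ] ℝ).hasFDerivWithinAt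
  have := (isSlab_Cyl hT s).pd_eq (i := 3) hx h1
  simpa using this

end Domains

/-! ### A priori estimates for the Neumann problem -/

section Neumann

open scoped NNReal
open Filter Topology

variable {s : Side} {p g : (Fin 3 → ℝ) → ℝ}

/-- The divergence theorem lives on closed boxes; the period cell differs from one by faces of
measure zero. -/
lemma cell_ae_eq (s : Side) :
    (Om s ∩ cell {0, 1} : Set (Fin 3 → ℝ)) =ᵐ[volume]
      Icc ![0, 0, lo s] ![2 * Real.pi, 2 * Real.pi, hi s] := by
  have h1 : (univ.pi fun i : Fin 3 => Ioo ((![0, 0, lo s] : Fin 3 → ℝ) i)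
      ((![2 * Real.pi, 2 * Real.pi, hi s] : Fin 3 → ℝ) i)) ⊆ Om s ∩ cell {0, 1} := by
    intro y hy
    have h0 := hy 0 (mem_univ _)
    have h1 := hy 1 (mem_univ _)
    have h2 := hy 2 (mem_univ _)
    refine ⟨by show _ ∈ I s; rw [I_eq]; exact h2, ?_⟩
    rintro i (rfl | rfl)
    · exact Ioo_subset_Ioc_self h0
    · exact Ioo_subset_Ioc_self h1
  have h2 : (Om s ∩ cell {0, 1} : Set (Fin 3 → ℝ)) ⊆
      Icc ![0, 0, lo s] ![2 * Real.pi, 2 * Real.pi, hi s] := by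
    rintro y ⟨hy, hc⟩
    have hy : y 2 ∈ I s := hy
    rw [I_eq] at hy
    have h0 := hc 0 (by simp)
    have h1 := hc 1 (by simp)
    constructor <;> intro i <;> fin_cases i
    · exact h0.1.le
    · exact h1.1.le
    · exact hy.1.le
    · exact h0.2
    · exact h1.2
    · exact hy.2.le
  exact (LE.le.eventuallyLE h2).antisymm
    ((Measure.univ_pi_Ioo_ae_eq_Icc (μ := fun _ : Fin 3 => (volume : Measure ℝ))).symm.le.trans
      (LE.le.eventuallyLE h1))

lemma box_subset (s : Side) : Icc ![0, 0, lo s] ![2 * Real.pi, 2 * Real.pi, hi s]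
    ⊆ closure (Om s) := fun _ hy => mem_closure_Om.2 ⟨hy.1 2, hy.2 2⟩

lemma measurableSet_cellOm (s : Side) : MeasurableSet (Om s ∩ cell {0, 1}) :=
  (isSlab_Om s).measurableSet.inter (measurableSet_cell _)

/-- The integral of a derivative over the period cell, provided the boundary terms cancel. -/
lemma integral_pd_eq_zero (hg : IsSmooth (Om s) {0, 1} g) (i : Fin 3)
    (h : ∀ z ∈ Icc ((![0, 0, lo s] : Fin 3 → ℝ) ∘ i.succAbove)
        ((![2 * Real.pi, 2 * Real.pi, hi s] : Fin 3 → ℝ) ∘ i.succAbove),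
      g (i.insertNth ((![2 * Real.pi, 2 * Real.pi, hi s] : Fin 3 → ℝ) i) z)
        = g (i.insertNth ((![0, 0, lo s] : Fin 3 → ℝ) i) z)) :
    ∫ y in Om s ∩ cell {0, 1}, pd (Om s) i g y = 0 := by
  classical
  set a : Fin 3 → ℝ := ![0, 0, lo s]
  set b : Fin 3 → ℝ := ![2 * Real.pi, 2 * Real.pi, hi s]
  have hab : a ≤ b := by
    intro k
    fin_cases k
    · show (0 : ℝ) ≤ 2 * Real.pi; positivity
    · show (0 : ℝ) ≤ 2 * Real.pi; positivity
    · exact (lo_lt_hi s).le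
  rw [setIntegral_congr_set (cell_ae_eq s)]
  -- The divergence theorem for the vector field whose only nonzero component is `g`, in direction
  -- `i`.
  have key := integral_divergence_of_hasFDerivAt_off_countable' a b hab
    (fun k => if k = i then g else fun _ => 0)
    (fun k x => if k = i then gradCLM fun j => pd (Om s) j g x else 0) ∅ countable_empty ?_ ?_ ?_
  · have e : ∀ x : Fin 3 → ℝ, ∑ k, ((if k = i then gradCLM fun j => pd (Om s) j g x else 0 :
        (Fin 3 → ℝ) →L[ℝ] ℝ)) (Pi.single k 1) = pd (Om s) i g x := by
      intro x
      rw [Finset.sum_eq_single i (fun k _ hk => by simp [hk]) (by simp)]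
      simp
    simp only [e] at key
    rw [key]
    refine Finset.sum_eq_zero fun k _ => ?_
    by_cases hk : k = i
    · subst hk
      simp only [if_true]
      rw [sub_eq_zero]
      exact setIntegral_congr_fun measurableSet_Icc h
    · simp [hk]
  · intro k
    by_cases hk : k = i
    · simp only [hk, if_true]; exact hg.continuousOn.mono (box_subset s)
    · simp only [hk, if_false]; exact continuousOn_const
  · intro x hx k
    by_cases hk : k = i
    · simp only [hk, if_true]
      have hxO : x ∈ Om s := by show _ ∈ I s; rw [I_eq]; exact hx.1 2 (mem_univ _)
      exact (hg.hasFDerivWithinAt (subset_closure hxO)).hasFDerivAt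
        (Filter.mem_of_superset ((isSlab_Om s).isOpen.mem_nhds hxO) subset_closure)
    · simp only [hk, if_false]; exact hasFDerivAt_const _ _
  · have e : ∀ x : Fin 3 → ℝ, ∑ k, ((if k = i then gradCLM fun j => pd (Om s) j g x else 0 :
        (Fin 3 → ℝ) →L[ℝ] ℝ)) (Pi.single k 1) = pd (Om s) i g x := by
      intro x
      rw [Finset.sum_eq_single i (fun k _ hk => by simp [hk]) (by simp)]
      simp
    simp only [e]
    exact ((hg.pd (isSlab_Om s) i).continuousOn.mono (box_subset s)).integrableOn_compact
      isCompact_Icc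

lemma integral_pd_tangential (hg : IsSmooth (Om s) {0, 1} g) (j : Fin 2) :
    ∫ y in Om s ∩ cell {0, 1}, pd (Om s) j.castSucc g y = 0 := by
  refine integral_pd_eq_zero hg _ fun z hz => ?_
  have hmem : (j.castSucc.insertNth 0 z : Fin 3 → ℝ) ∈ closure (Om s) := by
    rw [mem_closure_Om]
    fin_cases j
    · exact ⟨hz.1 1, hz.2 1⟩
    · exact ⟨hz.1 1, hz.2 1⟩
  fin_cases j
  · have e : (Fin.insertNth 0 (2 * Real.pi) z : Fin 3 → ℝ)
        = Fin.insertNth 0 0 z + Pi.single 0 (2 * Real.pi) := by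
      ext k; fin_cases k <;> (simp; try rfl)
    exact (congrArg g e).trans (hg.periodic 0 (by simp) _ hmem)
  · have e : (Fin.insertNth 1 (2 * Real.pi) z : Fin 3 → ℝ)
        = Fin.insertNth 1 0 z + Pi.single 1 (2 * Real.pi) := by
      ext k; fin_cases k <;> simp [Fin.insertNth, Fin.succAboveCases]
    exact (congrArg g e).trans (hg.periodic 1 (by simp) _ hmem)

lemma integral_pd_normal (hg : IsSmooth (Om s) {0, 1} g)
    (h1 : ∀ z, g (atHeight (lo s) z) = 0) (h2 : ∀ z, g (atHeight (hi s) z) = 0) :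
    ∫ y in Om s ∩ cell {0, 1}, pd (Om s) 2 g y = 0 := by
  refine integral_pd_eq_zero hg 2 fun z _ => ?_
  have e : ∀ r, (Fin.insertNth 2 r z : Fin 3 → ℝ) = atHeight r z := fun r =>
    Fin.insertNth_last' r z
  rw [e, e]
  exact (h2 z).trans (h1 z).symm

/-- Smooth functions with vanishing normal derivative on the boundary. -/
structure IsNeumann (s : Side) (p : (Fin 3 → ℝ) → ℝ) : Prop where
  smooth : IsSmooth (Om s) {0, 1} p
  lower : ∀ z, pd (Om s) 2 p (atHeight (lo s) z) = 0
  upper : ∀ z, pd (Om s) 2 p (atHeight (hi s) z) = 0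

lemma lo_mem_Icc (s : Side) : lo s ∈ Icc (lo s) (hi s) := ⟨le_rfl, (lo_lt_hi s).le⟩

lemma hi_mem_Icc (s : Side) : hi s ∈ Icc (lo s) (hi s) := ⟨(lo_lt_hi s).le, le_rfl⟩

/-- The normal derivative of ∂ⱼp is ∂ⱼ of the normal derivative of `p`, and the latter vanishes
identically on each flat face. All higher regularity rests on this. -/
lemma IsNeumann.tangential (hp : IsNeumann s p) (j : Fin 2) : IsNeumann s (pd (Om s) j.castSucc p) where
  smooth := hp.smooth.pd (isSlab_Om s) _
  lower z := by
    rw [pd_comm (isSlab_Om s) hp.smooth _ _ (atHeight_mem_Om (lo_mem_Icc s) z)]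
    exact pd_Om_atHeight (hp.smooth.pd (isSlab_Om s) 2) (lo_mem_Icc s) hp.lower j z
  upper z := by
    rw [pd_comm (isSlab_Om s) hp.smooth _ _ (atHeight_mem_Om (hi_mem_Icc s) z)]
    exact pd_Om_atHeight (hp.smooth.pd (isSlab_Om s) 2) (hi_mem_Icc s) hp.upper j z

lemma IsSmooth.laplacian (hp : IsSmooth (Om s) {0, 1} p) :
    IsSmooth (Om s) {0, 1} (laplacian s p) :=
  IsSmooth.sum _ fun i _ => (hp.pd (isSlab_Om s) i).pd (isSlab_Om s) i

lemma laplacian_pd (hp : IsSmooth (Om s) {0, 1} p) (i : Fin 3) :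
    EqOn (laplacian s (pd (Om s) i p)) (pd (Om s) i (laplacian s p)) (closure (Om s)) := by
  intro y hy
  have h := isSlab_Om s
  unfold laplacian
  rw [pd_sum h _ (fun k _ => (hp.pd h k).pd h k) hy]
  refine Finset.sum_congr rfl fun k _ => ?_
  rw [pd_congr (fun x hx => pd_comm h hp k i hx) hy, pd_comm h (hp.pd h k) k i hy]

lemma IsSmooth.integrableOn (hp : IsSmooth (Om s) {0, 1} p) :
    IntegrableOn p (Om s ∩ cell {0, 1}) := by
  have := (isSlab_Om s).isFiniteMeasure
  exact ((isSlab_Om s).memLp hp.continuousOn hp.periodic 2).integrable (by norm_num)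

/-- Green's identity. -/
lemma IsNeumann.integral_grad_sq (hp : IsNeumann s p) :
    ∑ i, ∫ y in Om s ∩ cell {0, 1}, pd (Om s) i p y ^ 2
      = -∫ y in Om s ∩ cell {0, 1}, p y * laplacian s p y := by
  have h := isSlab_Om s
  have hs := hp.smooth
  have h0 : ∀ i : Fin 3, ∫ y in Om s ∩ cell {0, 1},
      pd (Om s) i (fun y => p y * pd (Om s) i p y) y = 0 := by
    intro i
    have hsm := hs.mul (hs.pd h i)
    refine Fin.lastCases ?_ (fun j => ?_) i (motive := fun i => IsSmooth (Om s) {0, 1}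
      (fun y => p y * pd (Om s) i p y) → ∫ y in Om s ∩ cell {0, 1},
      pd (Om s) i (fun y => p y * pd (Om s) i p y) y = 0) hsm
    · intro hsm
      exact integral_pd_normal hsm (fun z => by rw [show Fin.last 2 = 2 from rfl, hp.lower, mul_zero])
        fun z => by rw [show Fin.last 2 = 2 from rfl, hp.upper, mul_zero]
    · exact fun hsm => integral_pd_tangential hsm j
  have e : ∀ i : Fin 3, ∫ y in Om s ∩ cell {0, 1},
      pd (Om s) i (fun y => p y * pd (Om s) i p y) y
      = (∫ y in Om s ∩ cell {0, 1}, p y * pd (Om s) i (pd (Om s) i p) y)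
        + ∫ y in Om s ∩ cell {0, 1}, pd (Om s) i p y ^ 2 := by
    intro i
    have hsq : IntegrableOn (fun y => pd (Om s) i p y ^ 2) (Om s ∩ cell {0, 1}) := by
      simpa only [sq] using ((hs.pd h i).mul (hs.pd h i)).integrableOn
    rw [← integral_add (hs.mul ((hs.pd h i).pd h i)).integrableOn
      hsq]
    refine setIntegral_congr_fun (measurableSet_cellOm s) fun y hy => ?_
    rw [pd_mul h hs (hs.pd h i) (subset_closure hy.1), sq]
  have e2 : ∫ y in Om s ∩ cell {0, 1}, p y * laplacian s p y
      = ∑ i, ∫ y in Om s ∩ cell {0, 1}, p y * pd (Om s) i (pd (Om s) i p) y := by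
    rw [← integral_finsetSum _ fun i _ => (hs.mul ((hs.pd h i).pd h i)).integrableOn]
    simp only [laplacian, Finset.mul_sum]
  rw [e2, eq_neg_iff_add_eq_zero, ← Finset.sum_add_distrib]
  refine Finset.sum_eq_zero fun i _ => ?_
  rw [add_comm, ← e, h0]

/-- The energy estimate for tangential derivatives. -/
lemma IsNeumann.integral_sq_le (hp : IsNeumann s p) (i : Fin 3) (j : Fin 2) :
    ∫ y in Om s ∩ cell {0, 1}, pd (Om s) i (VortexSheet.pd (Om s) j.castSucc p) y ^ 2
      ≤ ∫ y in Om s ∩ cell {0, 1}, laplacian s p y ^ 2 := by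
  have h := isSlab_Om s
  have hs := hp.smooth
  set r := VortexSheet.pd (Om s) j.castSucc p with hr
  have hrN : IsNeumann s r := hp.tangential j
  have hrs := hrN.smooth
  have hL := hs.laplacian
  have h1 := hrN.integral_grad_sq
  have h2 : ∫ y in Om s ∩ cell {0, 1}, r y * laplacian s r y
      = ∫ y in Om s ∩ cell {0, 1}, r y * VortexSheet.pd (Om s) j.castSucc (laplacian s p) y :=
    setIntegral_congr_fun (measurableSet_cellOm s) fun y hy => by
      rw [laplacian_pd hs _ (subset_closure hy.1)]
  -- A second integration by parts, tangential and hence without boundary terms, takes ∂ⱼ off the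
  -- Laplacian: the Dirichlet energy of r = ∂ⱼp becomes ∫ Δp ∂ⱼr, with no derivative of Δp left.
  have h3 : (∫ y in Om s ∩ cell {0, 1}, r y * VortexSheet.pd (Om s) j.castSucc (laplacian s p) y)
      + ∫ y in Om s ∩ cell {0, 1}, laplacian s p y * VortexSheet.pd (Om s) j.castSucc r y = 0 := by
    rw [← integral_pd_tangential (hrs.mul hL) j, ← integral_add
      (hrs.mul (hL.pd h _)).integrableOn (hL.mul (hrs.pd h _)).integrableOn]
    refine setIntegral_congr_fun (measurableSet_cellOm s) fun y hy => ?_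
    rw [pd_mul h hrs hL (subset_closure hy.1)]
  have hsq : ∀ {g : (Fin 3 → ℝ) → ℝ}, IsSmooth (Om s) {0, 1} g →
      IntegrableOn (fun y => g y ^ 2) (Om s ∩ cell {0, 1}) := fun hg => by
    simpa only [sq] using (hg.mul hg).integrableOn
  have h4 : 2 * ∫ y in Om s ∩ cell {0, 1}, laplacian s p y * VortexSheet.pd (Om s) j.castSucc r y
      ≤ (∫ y in Om s ∩ cell {0, 1}, laplacian s p y ^ 2)
        + ∫ y in Om s ∩ cell {0, 1}, VortexSheet.pd (Om s) j.castSucc r y ^ 2 := by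
    rw [← integral_const_mul, ← integral_add (hsq hL) (hsq (hrs.pd h _))]
    refine setIntegral_mono ((hL.mul (hrs.pd h _)).const_mul 2).integrableOn
      ((hsq hL).add (hsq (hrs.pd h _))) fun y => ?_
    simp only
    nlinarith [sq_nonneg (laplacian s p y - VortexSheet.pd (Om s) j.castSucc r y)]
  have hnn : ∀ k : Fin 3, 0 ≤ ∫ y in Om s ∩ cell {0, 1}, VortexSheet.pd (Om s) k r y ^ 2 :=
    fun k => integral_nonneg fun y => sq_nonneg _
  have h5 : ∀ k : Fin 3, ∫ y in Om s ∩ cell {0, 1}, VortexSheet.pd (Om s) k r y ^ 2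
      ≤ ∑ k, ∫ y in Om s ∩ cell {0, 1}, VortexSheet.pd (Om s) k r y ^ 2 := fun k =>
    Finset.single_le_sum (fun k _ => hnn k) (Finset.mem_univ k)
  -- The term ½∫(∂ⱼr)² is absorbed into the energy, of which it is at most one half; this explains
  -- the constant 1.
  linarith [h5 i, h5 j.castSucc]

/-- The `L²` norm over the period cell. -/
def N2 (s : Side) (g : (Fin 3 → ℝ) → ℝ) : ENNReal :=
  eLpNorm g 2 (volume.restrict (Om s ∩ cell {0, 1}))

lemma IsSmooth.memLp_two (hg : IsSmooth (Om s) {0, 1} g) :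
    MemLp g 2 (volume.restrict (Om s ∩ cell {0, 1})) :=
  (isSlab_Om s).memLp hg.continuousOn hg.periodic 2

lemma N2_congr {g' : (Fin 3 → ℝ) → ℝ} (h : EqOn g g' (closure (Om s))) : N2 s g = N2 s g' := by
  refine eLpNorm_congr_ae ?_
  filter_upwards [ae_restrict_mem (measurableSet_cellOm s)] with y hy
  exact h (subset_closure hy.1)

lemma N2_add_le {g' : (Fin 3 → ℝ) → ℝ} (hg : IsSmooth (Om s) {0, 1} g)
    (hg' : IsSmooth (Om s) {0, 1} g') : N2 s (fun y => g y + g' y) ≤ N2 s g + N2 s g' :=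
  eLpNorm_add_le hg.memLp_two.1 hg'.memLp_two.1 (by norm_num)

lemma N2_sub_le {g' : (Fin 3 → ℝ) → ℝ} (hg : IsSmooth (Om s) {0, 1} g)
    (hg' : IsSmooth (Om s) {0, 1} g') : N2 s (fun y => g y - g' y) ≤ N2 s g + N2 s g' :=
  eLpNorm_sub_le hg.memLp_two.1 hg'.memLp_two.1 (by norm_num)

lemma N2_le_of_integral_sq_le {g' : (Fin 3 → ℝ) → ℝ} (hg : IsSmooth (Om s) {0, 1} g)
    (hg' : IsSmooth (Om s) {0, 1} g')
    (h : ∫ y in Om s ∩ cell {0, 1}, g y ^ 2 ≤ ∫ y in Om s ∩ cell {0, 1}, g' y ^ 2) :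
    N2 s g ≤ N2 s g' := by
  unfold N2
  rw [hg.memLp_two.eLpNorm_eq_integral_rpow_norm (by norm_num) (by norm_num),
    hg'.memLp_two.eLpNorm_eq_integral_rpow_norm (by norm_num) (by norm_num)]
  refine ENNReal.ofReal_le_ofReal (Real.rpow_le_rpow (integral_nonneg fun y => by positivity) ?_
    (by norm_num))
  simpa using h

/-- `A p` is controlled by `L²` norms of derivatives of the Laplacian of `p`, for `p` with
vanishing normal derivative on the boundary. -/
def Ctrl (s : Side) (A : ((Fin 3 → ℝ) → ℝ) → ENNReal) : Prop :=
  ∃ (V : Finset (List (Fin 3))) (C : ℝ≥0), ∀ p, IsNeumann s p →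
    A p ≤ C * ∑ v ∈ V, N2 s (dw (Om s) v (laplacian s p))

variable {A B : ((Fin 3 → ℝ) → ℝ) → ENNReal}

lemma Ctrl.mono (hB : Ctrl s B) (h : ∀ p, IsNeumann s p → A p ≤ B p) : Ctrl s A := by
  obtain ⟨V, C, hC⟩ := hB
  exact ⟨V, C, fun p hp => (h p hp).trans (hC p hp)⟩

lemma Ctrl.add (hA : Ctrl s A) (hB : Ctrl s B) : Ctrl s fun p => A p + B p := by
  obtain ⟨V, C, hC⟩ := hA
  obtain ⟨V', C', hC'⟩ := hB
  refine ⟨V ∪ V', C + C', fun p hp => ?_⟩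
  push_cast
  rw [add_mul]
  refine add_le_add ((hC p hp).trans ?_) ((hC' p hp).trans ?_)
  · gcongr; exact Finset.subset_union_left
  · gcongr; exact Finset.subset_union_right

lemma Ctrl.const_mul (hA : Ctrl s A) (c : ℝ≥0) : Ctrl s fun p => c * A p := by
  obtain ⟨V, C, hC⟩ := hA
  refine ⟨V, c * C, fun p hp => ?_⟩
  push_cast
  rw [mul_assoc]
  gcongr
  exact hC p hp

lemma Ctrl.sum {ι : Type*} (S : Finset ι) {A : ι → ((Fin 3 → ℝ) → ℝ) → ENNReal}
    (hA : ∀ k ∈ S, Ctrl s (A k)) : Ctrl s fun p => ∑ k ∈ S, A k p := by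
  classical
  induction S using Finset.induction_on with
  | empty => exact ⟨∅, 0, fun p _ => by simp⟩
  | insert k S hk ih =>
    simp only [Finset.sum_insert hk]
    exact (hA k (Finset.mem_insert_self _ _)).add
      (ih fun k hk => hA k (Finset.mem_insert_of_mem hk))

lemma ctrl_dw_laplacian (v : List (Fin 3)) : Ctrl s fun p => N2 s (dw (Om s) v (laplacian s p)) :=
  ⟨{v}, 1, fun p _ => by simp⟩

/-- A tangential derivative of a Neumann function is again one, and its Laplacian is the derivative
of the Laplacian. The estimate is reused with one more letter in each word; this drives the
induction on the order. -/
lemma Ctrl.comp_pd (hA : Ctrl s A) (j : Fin 2) :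
    Ctrl s fun p => A (pd (Om s) j.castSucc p) := by
  classical
  obtain ⟨V, C, hC⟩ := hA
  refine ⟨V.image fun v => v ++ [j.castSucc], C, fun p hp => (hC _ (hp.tangential j)).trans ?_⟩
  rw [Finset.sum_image fun u _ v _ huv => List.append_cancel_right huv]
  refine mul_le_mul' le_rfl (Finset.sum_le_sum fun v _ => le_of_eq (N2_congr ?_))
  intro y hy
  rw [dw_append]
  exact dw_congr v (laplacian_pd hp.smooth j.castSucc) hy

/-- The case split of the regularity argument: a tangential letter lowers the order, while two
normal letters are traded for the Laplacian. -/
lemma exists_castSucc_mem_or {w : List (Fin 3)} (h : 2 ≤ w.length) :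
    (∃ j : Fin 2, j.castSucc ∈ w) ∨ ∃ u, w = 2 :: 2 :: u := by
  match w, h with
  | a :: b :: u, _ =>
    by_cases ha : a = 2
    · by_cases hb : b = 2
      · exact Or.inr ⟨u, by rw [ha, hb]⟩
      · exact Or.inl ⟨b.castPred hb, by simp⟩
    · exact Or.inl ⟨a.castPred ha, by simp⟩

/-- Elliptic regularity: all derivatives of order at least two are controlled in `L²`. -/
lemma ctrl_N2_dw (k : ℕ) :
    ∀ w : List (Fin 3), w.length = k + 2 → Ctrl s fun p => N2 s (dw (Om s) w p) := by
  have h := isSlab_Om s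
  have base : ∀ (i : Fin 3) (j : Fin 2), Ctrl s fun p => N2 s (dw (Om s) [i] (pd (Om s) j.castSucc p)) :=
    fun i j => (ctrl_dw_laplacian []).mono fun p hp =>
      N2_le_of_integral_sq_le ((hp.smooth.pd h _).pd h _) hp.smooth.laplacian
        (hp.integral_sq_le i j)
  induction k with
  | zero =>
    have tang : ∀ w : List (Fin 3), w.length = 2 → (∃ j : Fin 2, j.castSucc ∈ w) →
        Ctrl s fun p => N2 s (dw (Om s) w p) := by
      rintro w hw ⟨j, hj⟩
      have hperm : w.Perm (w.erase j.castSucc ++ [j.castSucc]) :=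
        (List.perm_cons_erase hj).trans (List.perm_append_singleton _ _).symm
      obtain ⟨i, hi⟩ := List.length_eq_one_iff.1
        (show (w.erase j.castSucc).length = 1 by rw [List.length_erase_of_mem hj, hw])
      rw [hi] at hperm
      refine (base i j).mono fun p hp => le_of_eq (N2_congr ?_)
      exact dw_perm h hp.smooth hperm
    intro w hw
    rcases exists_castSucc_mem_or hw.ge with hj | ⟨u, rfl⟩
    · exact tang w hw hj
    · have hu : u = [] := by simpa using hw
      subst hu
      -- The purely normal derivative is recovered from the equation, ∂₃² = Δ − ∂₁² − ∂₂².
      have hc := (ctrl_dw_laplacian (s := s) []).add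
        ((tang [0, 0] rfl ⟨0, by simp⟩).add (tang [1, 1] rfl ⟨1, by simp⟩))
      refine hc.mono fun p hp => ?_
      have hp' := hp.smooth
      have e : EqOn (dw (Om s) [2, 2] p) (fun y => laplacian s p y -
          (dw (Om s) [0, 0] p y + dw (Om s) [1, 1] p y)) (closure (Om s)) := by
        intro y hy
        simp only [laplacian, Fin.sum_univ_three, dw]
        ring
      rw [N2_congr e]
      refine (N2_sub_le hp'.laplacian ((hp'.dw h _).add (hp'.dw h _))).trans ?_
      exact add_le_add le_rfl (N2_add_le (hp'.dw h _) (hp'.dw h _))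
  | succ k ih =>
    have tang : ∀ w : List (Fin 3), w.length = k + 1 + 2 → (∃ j : Fin 2, j.castSucc ∈ w) →
        Ctrl s fun p => N2 s (dw (Om s) w p) := by
      rintro w hw ⟨j, hj⟩
      have hperm : w.Perm (w.erase j.castSucc ++ [j.castSucc]) :=
        (List.perm_cons_erase hj).trans (List.perm_append_singleton _ _).symm
      refine ((ih (w.erase j.castSucc) ?_).comp_pd j).mono fun p hp => le_of_eq (N2_congr ?_)
      · rw [List.length_erase_of_mem hj, hw]; rfl
      · intro y hy
        rw [dw_perm h hp.smooth hperm hy, dw_append]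
        rfl
    intro w hw
    rcases exists_castSucc_mem_or (by omega : 2 ≤ w.length) with hj | ⟨u, rfl⟩
    · exact tang w hw hj
    · have hu : u.length = k + 1 := by simpa using hw
      have hc := (ctrl_dw_laplacian (s := s) u).add
        ((tang (u ++ [0, 0]) (by simp [hu]) ⟨0, by simp⟩).add
          (tang (u ++ [1, 1]) (by simp [hu]) ⟨1, by simp⟩))
      refine hc.mono fun p hp => ?_
      have hp' := hp.smooth
      -- The normal pair is moved to the innermost position, where the same identity applies to `p`
      -- itself. The two tangential words so created fall under `tang`, even if `u` is purely
      -- normal.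
      have hperm : (2 :: 2 :: u).Perm (u ++ [2, 2]) := List.perm_append_comm (l₁ := [2, 2])
      have e : EqOn (dw (Om s) (2 :: 2 :: u) p) (fun y => dw (Om s) u (laplacian s p) y -
          (dw (Om s) (u ++ [0, 0]) p y + dw (Om s) (u ++ [1, 1]) p y)) (closure (Om s)) := by
        intro y hy
        rw [dw_perm h hp' hperm hy, dw_append, dw_append, dw_append]
        have e1 : EqOn (dw (Om s) [2, 2] p) (fun y => laplacian s p y -
            (dw (Om s) [0, 0] p y + dw (Om s) [1, 1] p y)) (closure (Om s)) := by
          intro y hy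
          simp only [laplacian, Fin.sum_univ_three, dw]
          ring
        rw [dw_congr u e1 hy, dw_sub h hp'.laplacian ((hp'.dw h _).add (hp'.dw h _)) u hy]
        simp only
        rw [dw_add h (hp'.dw h _) (hp'.dw h _) u hy]
      rw [N2_congr e]
      refine (N2_sub_le (hp'.laplacian.dw h _) ((hp'.dw h _).add (hp'.dw h _))).trans ?_
      exact add_le_add le_rfl (N2_add_le (hp'.dw h _) (hp'.dw h _))

end Neumann

/-! ### Sup estimates for the Neumann problem, and the solution operator -/

section SupNeumann

open scoped NNReal
open Filter Topology

variable {s : Side} {p g : (Fin 3 → ℝ) → ℝ}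

/-- The sup norm on the closed domain. -/
def supE (s : Side) (f : (Fin 3 → ℝ) → ℝ) : ENNReal := ⨆ y ∈ closure (Om s), ‖f y‖ₑ

lemma enorm_le_supE {y : Fin 3 → ℝ} (hy : y ∈ closure (Om s)) : ‖g y‖ₑ ≤ supE s g :=
  le_iSup₂ (f := fun y (_ : y ∈ closure (Om s)) => ‖g y‖ₑ) y hy

lemma supE_le_of_Om (hg : ContinuousOn g (closure (Om s))) {M : ENNReal}
    (h : ∀ y ∈ Om s, ‖g y‖ₑ ≤ M) : supE s g ≤ M := by
  refine iSup₂_le fun y hy => ?_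
  have : (𝓝[Om s] y).NeBot := mem_closure_iff_nhdsWithin_neBot.1 hy
  have h1 : Tendsto (fun z => ‖g z‖ₑ) (𝓝[Om s] y) (𝓝 ‖g y‖ₑ) :=
    ((hg y hy).mono subset_closure).tendsto.enorm
  exact le_of_tendsto h1 (eventually_of_mem self_mem_nhdsWithin h)

lemma IsSmooth.supE_ne_top (hg : IsSmooth (Om s) {0, 1} g) : supE s g ≠ ⊤ := by
  obtain ⟨C, hC⟩ := (isSlab_Om s).exists_bound hg.continuousOn hg.periodic
  refine ne_top_of_le_ne_top (ENNReal.ofReal_ne_top (r := C)) (iSup₂_le fun y hy => ?_)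
  rw [Real.enorm_eq_ofReal_abs]
  exact ENNReal.ofReal_le_ofReal (hC y hy)

lemma IsSmooth.abs_le_supE (hg : IsSmooth (Om s) {0, 1} g) {y : Fin 3 → ℝ}
    (hy : y ∈ closure (Om s)) : |g y| ≤ (supE s g).toReal := by
  have := ENNReal.toReal_mono hg.supE_ne_top (enorm_le_supE (g := g) hy)
  simpa using this

/-- The recursion only lengthens words, so every term has length at least two and is covered by the
L² regularity. -/
lemma ctrl_towerBound (K c : ℝ≥0) (k : ℕ) : ∀ w : List (Fin 3), 2 ≤ w.length →
    Ctrl s fun p => towerBound (K : ENNReal) k (fun v => c * N2 s (dw (Om s) v p)) w := by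
  induction k with
  | zero =>
    intro w hw
    obtain ⟨m, hm⟩ := Nat.exists_eq_add_of_le hw
    exact (ctrl_N2_dw m w (by omega)).const_mul c
  | succ k ih =>
    intro w hw
    simp only [towerBound]
    exact ((ih w hw).add (Ctrl.sum _ fun i _ => ih (i :: w) (by simp; omega))).const_mul K

/-- Eight translates of the cell cover a unit cube, and Cauchy–Schwarz on the cell passes from L¹ to
L². -/
lemma exists_lintegral_cube_le (s : Side) : ∃ c : ℝ≥0, ∀ g, IsSmooth (Om s) {0, 1} g → ∀ a,
    ∫⁻ x in Om s ∩ Icc a (fun i => a i + 1), ‖g x‖ₑ ≤ c * N2 s g := by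
  have hfin := (isSlab_Om s).isFiniteMeasure
  set μ := (volume : Measure (Fin 3 → ℝ)).restrict (Om s ∩ cell {0, 1})
  set v : ENNReal := μ univ ^ (1 / (1 : ENNReal).toReal - 1 / (2 : ENNReal).toReal) with hv
  have hvt : v ≠ ⊤ := ENNReal.rpow_ne_top_of_nonneg (by norm_num) (measure_ne_top _ _)
  refine ⟨2 ^ 3 * v.toNNReal, fun g hg a => ?_⟩
  refine (lintegral_cube_le (isSlab_Om s) (fun k => ?_) a).trans ?_
  · filter_upwards [ae_restrict_mem (isSlab_Om s).measurableSet] with x hx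
    exact hg.periodic.latticeVec (isSlab_Om s) k x (subset_closure hx)
  · push_cast
    rw [ENNReal.coe_toNNReal hvt, mul_assoc]
    gcongr
    have := eLpNorm_le_eLpNorm_mul_rpow_measure_univ (μ := μ) (p := 1) (q := 2) (by norm_num)
      hg.memLp_two.1
    rw [eLpNorm_one_eq_lintegral_enorm, mul_comm] at this
    exact this

/-- Every point of the slab lies in a cube of fixed side `l` inside it. Three more derivatives, one
per dimension, turn the L² control into a sup bound whose constants depend only on `l` and the cell.
-/
lemma ctrl_supE (w : List (Fin 3)) (hw : 2 ≤ w.length) :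
    Ctrl s fun p => supE s (dw (Om s) w p) := by
  obtain ⟨c, hc⟩ := exists_lintegral_cube_le s
  obtain ⟨l, hl0, hl1, hl⟩ := exists_side (a := fun _ : Fin 3 => lo s) (b := fun _ => hi s)
    fun _ => lo_lt_hi s
  refine (ctrl_towerBound (l⁻¹.toNNReal + 1) c 3 w hw).mono fun p hp => ?_
  have h := isSlab_Om s
  refine supE_le_of_Om (hp.smooth.dw h w).continuousOn fun y hy => ?_
  rw [Om_eq] at hy
  obtain ⟨a, hya, ha⟩ := exists_cube_subset_slab hl hl0 hy
  rw [← Om_eq] at ha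
  have ht : IsTower (Icc a fun i => a i + l) fun w => dw (Om s) w p := (hp.smooth.isTower h).mono ha
  refine (ht.enorm_le_towerBound hl0 w hya).trans ?_
  push_cast
  refine towerBound_mono (fun v => ?_) 3 w
  have hsub : Icc a (fun i => a i + l) ⊆ Om s ∩ Icc a (fun i => a i + 1) := fun x hx =>
    ⟨ha hx, hx.1, fun i => (hx.2 i).trans (by dsimp only; linarith)⟩
  exact (lintegral_mono_set hsub).trans (hc _ (hp.smooth.dw h v) a)

/-! ### Mean value and Taylor estimates along segments of the closed slab. -/

section Line

variable {n : ℕ} {D : Set (Fin n → ℝ)} {P : Set (Fin n)} {f : (Fin n → ℝ) → ℝ}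

lemma IsSmooth.hasDerivWithinAt_segment (h : IsSlab D P) (hf : IsSmooth D P f) {x z : Fin n → ℝ}
    (hx : x ∈ closure D) (hz : z ∈ closure D) {r : ℝ} (hr : r ∈ Icc (0 : ℝ) 1) :
    HasDerivWithinAt (fun r : ℝ => f (x + r • (z - x)))
      (∑ i, VortexSheet.pd D i f (x + r • (z - x)) * (z i - x i)) (Icc 0 1) r := by
  have hm : MapsTo (fun r : ℝ => x + r • (z - x)) (Icc 0 1) (closure D) := fun r hr =>
    h.convex.closure.add_smul_sub_mem hx hz hr
  have h1 : HasDerivWithinAt (fun r : ℝ => x + r • (z - x)) (z - x) (Icc 0 1) r := by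
    simpa using (((hasDerivAt_id r).smul_const (z - x)).const_add x).hasDerivWithinAt
  have h2 := (hf.hasFDerivWithinAt (hm hr)).comp_hasDerivWithinAt r h1 hm
  rw [gradCLM_apply] at h2
  exact h2

lemma IsSmooth.abs_sub_le (h : IsSlab D P) (hf : IsSmooth D P f) {M : Fin n → ℝ}
    (hM : ∀ i, ∀ y ∈ closure D, |VortexSheet.pd D i f y| ≤ M i) {x z : Fin n → ℝ}
    (hx : x ∈ closure D) (hz : z ∈ closure D) : |f z - f x| ≤ ∑ i, M i * |z i - x i| := by
  have := norm_image_sub_le_of_norm_deriv_le_segment_01' (C := ∑ i, M i * |z i - x i|)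
    (fun r hr => hf.hasDerivWithinAt_segment h hx hz hr) fun r hr => ?_
  · simpa using this
  · refine (norm_sum_le _ _).trans (Finset.sum_le_sum fun i _ => ?_)
    rw [norm_mul, Real.norm_eq_abs, Real.norm_eq_abs]
    gcongr
    exact hM i _ (h.convex.closure.add_smul_sub_mem hx hz (Ico_subset_Icc_self hr))

lemma IsSmooth.abs_sub_le_single (h : IsSlab D P) (hf : IsSmooth D P f) {i : Fin n} {M : ℝ}
    (hM : ∀ y ∈ closure D, |VortexSheet.pd D i f y| ≤ M) {x : Fin n → ℝ} {d : ℝ}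
    (hx : x ∈ closure D) (hz : x + d • (Pi.single i 1 : Fin _ → ℝ) ∈ closure D) :
    |f (x + d • (Pi.single i 1 : Fin _ → ℝ)) - f x| ≤ M * |d| := by
  classical
  have hB : ∀ j, ∃ C, ∀ y ∈ closure D, |VortexSheet.pd D j f y| ≤ C := fun j =>
    h.exists_bound (hf.pd h j).continuousOn (hf.pd h j).periodic
  choose B hB using hB
  -- The auxiliary bounds `B j` meet a zero displacement and drop out, so the final constant
  -- involves only direction `i`.
  have := hf.abs_sub_le h (M := fun j => if j = i then M else B j) (fun j y hy => by
    by_cases hj : j = i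
    · subst hj; simpa using hM y hy
    · simpa [hj] using hB j y hy) hx hz
  refine this.trans (le_of_eq ?_)
  rw [Finset.sum_eq_single i (fun j _ hj => by simp [hj]) (by simp)]
  simp

/-- Taylor's formula of first order in one coordinate. -/
lemma IsSmooth.abs_taylor_le (h : IsSlab D P) (hf : IsSmooth D P f) {i : Fin n} {M : ℝ}
    (hM : ∀ y ∈ closure D, |VortexSheet.pd D i (VortexSheet.pd D i f) y| ≤ M) {x : Fin n → ℝ} {d : ℝ}
    (hx : x ∈ closure D) (hz : x + d • (Pi.single i 1 : Fin _ → ℝ) ∈ closure D) :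
    |f (x + d • (Pi.single i 1 : Fin _ → ℝ)) - f x - d * VortexSheet.pd D i f x| ≤ M * |d| ^ 2 := by
  have hM0 : 0 ≤ M := (abs_nonneg _).trans (hM x hx)
  have e : ∀ r : ℝ, x + r • (x + d • (Pi.single i 1 : Fin _ → ℝ) - x) = x + (r * d) • (Pi.single i 1 : Fin _ → ℝ) := by
    intro r; rw [add_sub_cancel_left, smul_smul]
  have hsum : ∀ r : ℝ, ∑ j, VortexSheet.pd D j f (x + r • (x + d • (Pi.single i 1 : Fin _ → ℝ) - x))
      * ((x + d • (Pi.single i 1 : Fin _ → ℝ)) j - x j)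
      = VortexSheet.pd D i f (x + (r * d) • (Pi.single i 1 : Fin _ → ℝ)) * d := by
    intro r
    rw [Finset.sum_eq_single i (fun j _ hj => by simp [hj]) (by simp), e]
    simp
  have hmem : ∀ r ∈ Icc (0 : ℝ) 1, x + (r * d) • (Pi.single i 1 : Fin _ → ℝ) ∈ closure D := fun r hr => by
    rw [← e]; exact h.convex.closure.add_smul_sub_mem hx hz hr
  have key := norm_image_sub_le_of_norm_deriv_le_segment_01' (C := M * |d| ^ 2)
    (f := fun r : ℝ => f (x + r • (x + d • (Pi.single i 1 : Fin _ → ℝ) - x)) - r * (d * VortexSheet.pd D i f x))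
    (f' := fun r => VortexSheet.pd D i f (x + (r * d) • (Pi.single i 1 : Fin _ → ℝ)) * d
      - d * VortexSheet.pd D i f x)
    (fun r hr => by
      have h1 := hf.hasDerivWithinAt_segment h hx hz hr
      rw [hsum] at h1
      have h2 := h1.sub (((hasDerivAt_id r).mul_const
        (d * VortexSheet.pd D i f x)).hasDerivWithinAt (s := Icc 0 1))
      exact (h2.congr_deriv (by simp))) fun r hr => ?_
  · simp only [e] at key
    simpa [sub_right_comm] using key
  · have hr' := Ico_subset_Icc_self hr
    have h3 := (hf.pd h i).abs_sub_le_single h hM (d := r * d) hx (hmem r hr')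
    rw [show VortexSheet.pd D i f (x + (r * d) • (Pi.single i 1 : Fin _ → ℝ)) * d - d * VortexSheet.pd D i f x
      = (VortexSheet.pd D i f (x + (r * d) • (Pi.single i 1 : Fin _ → ℝ)) - VortexSheet.pd D i f x) * d by ring,
      norm_mul, Real.norm_eq_abs, Real.norm_eq_abs]
    calc _ ≤ M * |r * d| * |d| := by gcongr
      _ = r * (M * |d| ^ 2) := by rw [abs_mul, abs_of_nonneg hr.1]; ring
      _ ≤ 1 * (M * |d| ^ 2) := by gcongr; exact hr.2.le
      _ = _ := one_mul _

end Line

lemma enorm_le_of_abs_le {r C : ℝ} {S : ENNReal} (hS : S ≠ ⊤) (hC : 0 ≤ C)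
    (h : |r| ≤ C * S.toReal) : ‖r‖ₑ ≤ ENNReal.ofReal C * S := by
  rw [Real.enorm_eq_ofReal_abs]
  refine (ENNReal.ofReal_le_ofReal h).trans (le_of_eq ?_)
  rw [ENNReal.ofReal_mul hC, ENNReal.ofReal_toReal hS]

/-- First derivatives vanish somewhere along each coordinate line, so they are controlled by second
derivatives. -/
lemma IsNeumann.supE_pd_le (hp : IsNeumann s p) (i : Fin 3) :
    supE s (VortexSheet.pd (Om s) i p) ≤ ENNReal.ofReal (2 * Real.pi) * supE s (VortexSheet.pd (Om s) i (VortexSheet.pd (Om s) i p)) := by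
  have h := isSlab_Om s
  have h1 := hp.smooth.pd h i
  have h2 := h1.pd h i
  set S := supE s (VortexSheet.pd (Om s) i (VortexSheet.pd (Om s) i p))
  have hpi : 1 ≤ 2 * Real.pi := by linarith [Real.pi_gt_three]
  -- In the normal direction the zero is at the lower face, by the Neumann condition. In a
  -- tangential direction Rolle's theorem over one period provides it.
  have hz : ∀ y ∈ closure (Om s), ∃ d : ℝ, |d| ≤ 2 * Real.pi ∧
      y + d • (Pi.single i 1 : Fin _ → ℝ) ∈ closure (Om s) ∧
      VortexSheet.pd (Om s) i p (y + d • (Pi.single i 1 : Fin _ → ℝ)) = 0 := by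
    intro y hy
    induction i using Fin.lastCases with
    | last =>
      refine ⟨lo s - y 2, ?_, ?_, ?_⟩
      · have := mem_closure_Om.1 hy
        have e : hi s = lo s + 1 := by cases s <;> norm_num [lo, hi]
        rw [abs_le]
        constructor <;> linarith [this.1, this.2]
      · rw [mem_closure_Om]; simpa using (lo_mem_Icc s)
      · have e : y + (lo s - y 2) • (Pi.single (Fin.last 2) 1 : Fin _ → ℝ) = atHeight (lo s) (Fin.init y) := by
          ext k; fin_cases k <;> simp [atHeight, Fin.init, Fin.snoc, Fin.last]
        rw [e]
        exact hp.lower _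
    | cast j =>
      have hmem : ∀ r : ℝ, y + r • (Pi.single j.castSucc 1 : Fin _ → ℝ) ∈ closure (Om s) := fun r => by
        rw [mem_closure_Om] at *
        have : (j.castSucc : Fin 3) ≠ 2 := Fin.castSucc_ne_last j
        simpa [Pi.single_apply, this.symm] using hy
      have hd : ∀ r : ℝ, HasDerivAt (fun r : ℝ => p (y + r • (Pi.single j.castSucc 1 : Fin _ → ℝ)))
          (VortexSheet.pd (Om s) j.castSucc p (y + r • (Pi.single j.castSucc 1 : Fin _ → ℝ))) r := by
        intro r
        have e1 : HasDerivAt (fun r : ℝ => y + r • (Pi.single j.castSucc 1 : Fin 3 → ℝ))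
            (Pi.single j.castSucc 1) r := by
          simpa using ((hasDerivAt_id r).smul_const (Pi.single j.castSucc 1 : Fin 3 → ℝ)).const_add y
        have e2 := (hp.smooth.hasFDerivWithinAt (hmem r)).comp_hasDerivWithinAt r
          (e1.hasDerivWithinAt (s := univ)) (fun r _ => hmem r)
        rw [gradCLM_single, hasDerivWithinAt_univ] at e2
        exact e2
      obtain ⟨c, hc, hc0⟩ := exists_hasDerivAt_eq_zero (f := fun r : ℝ =>
        p (y + r • (Pi.single j.castSucc 1 : Fin _ → ℝ))) (a := 0) (b := 2 * Real.pi) (by positivity)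
        (fun r _ => (hd r).continuousAt.continuousWithinAt) (by
          have hj : (j.castSucc : Fin 3) ∈ ({0, 1} : Set (Fin 3)) := by fin_cases j <;> simp
          have := hp.smooth.periodic _ hj y hy
          rw [single_eq_smul] at this
          simpa using this.symm) fun r _ => hd r
      exact ⟨c, by rw [abs_of_pos hc.1]; exact hc.2.le, hmem c, hc0⟩
  refine iSup₂_le fun y hy => ?_
  obtain ⟨d, hd, hm, h0⟩ := hz y hy
  refine enorm_le_of_abs_le h2.supE_ne_top (by positivity) ?_
  have h3 := h1.abs_sub_le_single h (fun z hz => h2.abs_le_supE hz) hy hm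
  rw [h0, zero_sub, abs_neg] at h3
  refine h3.trans ?_
  rw [mul_comm]
  gcongr

/-- The origin lies on the sheet, hence in both closed domains. This makes it the point at which
pressures are normalised and the jump condition is read off. -/
lemma zero_mem_closure_Om (s : Side) : (0 : Fin 3 → ℝ) ∈ closure (Om s) :=
  mem_closure_Om.2 (zero_mem_Icc s)

/-- A lattice translation brings the point to within 2π of the origin in every coordinate; the mean
value inequality from the origin, where `p` vanishes, then suffices. -/
lemma IsSmooth.supE_le (hp : IsSmooth (Om s) {0, 1} p) (h0 : p 0 = 0) :
    supE s p ≤ ∑ i, ENNReal.ofReal (2 * Real.pi) * supE s (VortexSheet.pd (Om s) i p) := by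
  have h := isSlab_Om s
  have hpi : 1 ≤ 2 * Real.pi := by linarith [Real.pi_gt_three]
  have hS := fun i => (hp.pd h i).supE_ne_top
  refine iSup₂_le fun y hy => ?_
  obtain ⟨k, hk⟩ := exists_latticeVec_mem_cell {0, 1} y
  have hy' := (h.add_latticeVec_mem_closure k y).2 hy
  rw [← hp.periodic.latticeVec h k y hy]
  set z := y + latticeVec {0, 1} k
  have hz : ∀ i, |z i| ≤ 2 * Real.pi := by
    intro i
    induction i using Fin.lastCases with
    | last =>
      have := mem_closure_Om.1 hy'
      have e : -1 ≤ lo s ∧ hi s ≤ 1 := by cases s <;> norm_num [lo, hi]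
      rw [abs_le]
      exact ⟨by show _ ≤ z 2; linarith [this.1], by show z 2 ≤ _; linarith [this.2]⟩
    | cast j =>
      have hj : (j.castSucc : Fin 3) ∈ ({0, 1} : Set (Fin 3)) := by fin_cases j <;> simp
      rw [abs_of_pos (hk _ hj).1]
      exact (hk _ hj).2
  have h1 := hp.abs_sub_le h (fun i y hy => (hp.pd h i).abs_le_supE hy) (zero_mem_closure_Om s) hy'
  rw [h0, sub_zero] at h1
  rw [Real.enorm_eq_ofReal_abs]
  refine (ENNReal.ofReal_le_ofReal h1).trans ?_
  rw [ENNReal.ofReal_sum_of_nonneg fun i _ => by positivity]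
  refine Finset.sum_le_sum fun i _ => ?_
  rw [ENNReal.ofReal_mul ENNReal.toReal_nonneg, ENNReal.ofReal_toReal (hS i), mul_comm]
  gcongr
  simpa using hz i

/-- All derivatives of normalised Neumann functions are bounded by the derivatives of their
Laplacian. -/
theorem exists_supE_le (s : Side) (w : List (Fin 3)) :
    ∃ (V : Finset (List (Fin 3))) (C : ℝ≥0), ∀ p, IsNeumann s p → p 0 = 0 →
      supE s (dw (Om s) w p) ≤ C * ∑ v ∈ V, N2 s (dw (Om s) v (laplacian s p)) := by
  have one : ∀ i : Fin 3, Ctrl s fun p => supE s (dw (Om s) [i] p) := fun i =>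
    ((ctrl_supE (s := s) [i, i] le_rfl).const_mul (2 * Real.pi).toNNReal).mono fun p hp =>
      hp.supE_pd_le i
  match w with
  | [] =>
    obtain ⟨V, C, hC⟩ := Ctrl.sum Finset.univ fun i _ => (one i).const_mul (2 * Real.pi).toNNReal
    exact ⟨V, C, fun p hp h0 => (hp.smooth.supE_le h0).trans (hC p hp)⟩
  | [i] =>
    obtain ⟨V, C, hC⟩ := one i
    exact ⟨V, C, fun p hp _ => hC p hp⟩
  | i :: j :: w =>
    obtain ⟨V, C, hC⟩ := ctrl_supE (s := s) (i :: j :: w) (by simp)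
    exact ⟨V, C, fun p hp _ => hC p hp⟩

/-- Solutions of the homogeneous Neumann problem are constant. -/
lemma IsNeumann.eq_of_laplacian_eq_zero (hp : IsNeumann s p)
    (h0 : ∀ y ∈ Om s, laplacian s p y = 0) :
    ∀ y ∈ closure (Om s), p y = p 0 := by
  have h := isSlab_Om s
  have hL : EqOn (laplacian s p) (fun _ => 0) (closure (Om s)) :=
    hp.smooth.laplacian.eqOn_closure (IsSmooth.const 0) h0
  -- Uniqueness is read off from the a priori bound for `p` itself, with vanishing right-hand side,
  -- after subtracting the value at the origin.
  obtain ⟨V, C, hC⟩ := exists_supE_le s []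
  have hsm : IsSmooth (Om s) {0, 1} fun y => p y - p 0 := hp.smooth.sub (IsSmooth.const _)
  have hpd : ∀ i, ∀ y ∈ closure (Om s), VortexSheet.pd (Om s) i (fun y => p y - p 0) y
      = VortexSheet.pd (Om s) i p y := fun i y hy => by
    rw [pd_sub h hp.smooth (IsSmooth.const _) hy, pd_const h _ hy, sub_zero]
  have hN : IsNeumann s fun y => p y - p 0 := by
    refine ⟨hsm, fun z => ?_, fun z => ?_⟩
    · rw [hpd _ _ (atHeight_mem_Om (lo_mem_Icc s) z), hp.lower]
    · rw [hpd _ _ (atHeight_mem_Om (hi_mem_Icc s) z), hp.upper]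
  have hL' : EqOn (laplacian s fun y => p y - p 0) (fun _ => 0) (closure (Om s)) := by
    intro y hy
    rw [← hL hy]
    exact Finset.sum_congr rfl fun i _ => pd_congr (hpd i) hy
  have h1 := hC _ hN (sub_self _)
  have h2 : ∀ v, N2 s (dw (Om s) v (laplacian s fun y => p y - p 0)) = 0 := by
    intro v
    have e1 : EqOn (dw (Om s) v (laplacian s fun y => p y - p 0)) (fun _ => 0) (closure (Om s)) := by
      refine (dw_congr v hL').trans ?_
      have := dw_const_mul h 0 (IsSmooth.const (D := Om s) (P := {0, 1}) 0) v
      simpa using this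
    rw [N2_congr e1]
    simp [N2]
  simp only [h2, Finset.sum_const_zero, mul_zero] at h1
  intro y hy
  have h3 := (enorm_le_supE (g := fun y => p y - p 0) hy).trans h1
  simpa [sub_eq_zero] using h3

end SupNeumann

/-! ### Dependence of the solution of the Neumann problem on time -/

/-- A linear map bounded in terms of a Hilbert space valued linear map factors through it. -/
lemma exists_clm_of_norm_le {N E F : Type*} [AddCommGroup N] [Module ℝ N] [NormedAddCommGroup E]
    [InnerProductSpace ℝ E] [CompleteSpace E] [NormedAddCommGroup F] [NormedSpace ℝ F]
    [CompleteSpace F] (e : N →ₗ[ℝ] E) (τ : N →ₗ[ℝ] F) (C : ℝ) (h : ∀ x, ‖τ x‖ ≤ C * ‖e x‖) :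
    ∃ L : E →L[ℝ] F, ∀ x, L (e x) = τ x := by
  set R := (LinearMap.range e).topologicalClosure
  have : CompleteSpace R := (LinearMap.range e).isClosed_topologicalClosure.completeSpace_coe
  have hR : ∀ x, e x ∈ R := fun x => (LinearMap.range e).le_topologicalClosure ⟨x, rfl⟩
  set e' : N →ₗ[ℝ] R := e.codRestrict R hR
  have hd : DenseRange e' := by
    refine Topology.IsInducing.subtypeVal.dense_iff.2 fun x => ?_
    have hx : (x : E) ∈ closure (LinearMap.range e : Set E) := x.2
    refine closure_mono ?_ hx
    rintro _ ⟨y, rfl⟩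
    exact ⟨e' y, ⟨y, rfl⟩, rfl⟩
  -- Extension by continuity reaches only the closure of the range. The orthogonal projection makes
  -- the operator total, and this is why the target of `e` is a Hilbert space.
  refine ⟨(τ.extendOfNorm e').comp R.orthogonalProjectionOnto, fun x => ?_⟩
  have h1 : R.orthogonalProjectionOnto (e x) = e' x :=
    R.orthogonalProjectionOnto_mem_subspace_eq_self (e' x)
  rw [ContinuousLinearMap.comp_apply, h1]
  exact LinearMap.extendOfNorm_eq hd ⟨C, h⟩ x

section Slices

open scoped NNReal BoundedContinuousFunction
open Filter Topology

variable {s : Side} {g g' : (Fin 3 → ℝ) → ℝ}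

open Classical in
/-- The class of a function in the space `L²` of one period cell. -/
def toL2 (s : Side) (g : (Fin 3 → ℝ) → ℝ) :
    Lp ℝ 2 ((volume : Measure (Fin 3 → ℝ)).restrict (Om s ∩ cell {0, 1})) :=
  if h : MemLp g 2 (volume.restrict (Om s ∩ cell {0, 1})) then h.toLp g else 0

lemma toL2_eq (hg : IsSmooth (Om s) {0, 1} g) : toL2 s g = hg.memLp_two.toLp g :=
  dif_pos hg.memLp_two

lemma ae_of_closure {p : (Fin 3 → ℝ) → Prop} (h : ∀ y ∈ closure (Om s), p y) :
    ∀ᵐ y ∂(volume : Measure (Fin 3 → ℝ)).restrict (Om s ∩ cell {0, 1}), p y := by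
  filter_upwards [ae_restrict_mem (measurableSet_cellOm s)] with y hy using h y (subset_closure hy.1)

lemma toL2_congr (hg : IsSmooth (Om s) {0, 1} g) (h : EqOn g' g (closure (Om s))) :
    toL2 s g' = toL2 s g := by
  rw [toL2_eq hg, toL2_eq (hg.congr (isSlab_Om s) h)]
  exact MemLp.toLp_congr _ _ (ae_of_closure h)

lemma toL2_add (hg : IsSmooth (Om s) {0, 1} g) (hg' : IsSmooth (Om s) {0, 1} g') :
    toL2 s (fun y => g y + g' y) = toL2 s g + toL2 s g' := by
  rw [toL2_eq hg, toL2_eq hg', toL2_eq (hg.add hg')]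
  rfl

lemma toL2_const_mul (c : ℝ) (hg : IsSmooth (Om s) {0, 1} g) :
    toL2 s (fun y => c * g y) = c • toL2 s g := by
  rw [toL2_eq hg, toL2_eq (hg.const_mul c)]
  rfl

lemma enorm_toL2 (hg : IsSmooth (Om s) {0, 1} g) : ‖toL2 s g‖ₑ = N2 s g := by
  rw [toL2_eq hg, Lp.enorm_toLp]; rfl

lemma exists_norm_toL2_le (s : Side) : ∃ K : ℝ, ∀ g, IsSmooth (Om s) {0, 1} g → ∀ C, 0 ≤ C →
    (∀ y ∈ closure (Om s), |g y| ≤ C) → ‖toL2 s g‖ ≤ K * C := by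
  have hfin := (isSlab_Om s).isFiniteMeasure
  refine ⟨_, fun g hg C hC h => Lp.norm_le_of_ae_bound hC ?_⟩
  rw [toL2_eq hg]
  filter_upwards [hg.memLp_two.coeFn_toLp, ae_of_closure h] with y hy hy'
  rwa [hy]

/-- The value of a bounded continuous function on the closed domain, extended by zero. -/
def evalOm (s : Side) (y : Fin 3 → ℝ) : (closure (Om s) →ᵇ ℝ) →L[ℝ] ℝ := by
  classical
  exact if h : y ∈ closure (Om s) then BoundedContinuousFunction.evalCLM ℝ (⟨y, h⟩ : closure (Om s))
    else 0

lemma evalOm_apply {y : Fin 3 → ℝ} (hy : y ∈ closure (Om s)) (φ : closure (Om s) →ᵇ ℝ) :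
    evalOm s y φ = φ ⟨y, hy⟩ := by
  simp [evalOm, hy]

open Classical in
/-- A smooth function as a bounded continuous function. -/
def toBCF (s : Side) (g : (Fin 3 → ℝ) → ℝ) : closure (Om s) →ᵇ ℝ :=
  if h : IsSmooth (Om s) {0, 1} g then
    BoundedContinuousFunction.ofNormedAddCommGroup (fun y : closure (Om s) => g y)
      (continuousOn_iff_continuous_domRestrict.1 h.continuousOn) (supE s g).toReal
      fun y => by simpa using h.abs_le_supE y.2
  else 0

lemma toBCF_apply (hg : IsSmooth (Om s) {0, 1} g) (y : closure (Om s)) : toBCF s g y = g y := by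
  rw [toBCF, dif_pos hg]; rfl

lemma norm_toBCF_le (hg : IsSmooth (Om s) {0, 1} g) : ‖toBCF s g‖ ≤ (supE s g).toReal :=
  (BoundedContinuousFunction.norm_le ENNReal.toReal_nonneg).2 fun y => by
    rw [toBCF_apply hg]; exact hg.abs_le_supE y.2

lemma laplacian_add (hg : IsSmooth (Om s) {0, 1} g) (hg' : IsSmooth (Om s) {0, 1} g') :
    EqOn (laplacian s fun y => g y + g' y) (fun y => laplacian s g y + laplacian s g' y)
      (closure (Om s)) := by
  intro y hy
  have h := isSlab_Om s
  simp only [laplacian, ← Finset.sum_add_distrib]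
  refine Finset.sum_congr rfl fun i _ => ?_
  rw [pd_congr (fun z hz => pd_add h hg hg' hz) hy, pd_add h (hg.pd h i) (hg'.pd h i) hy]

lemma laplacian_const_mul (c : ℝ) (hg : IsSmooth (Om s) {0, 1} g) :
    EqOn (laplacian s fun y => c * g y) (fun y => c * laplacian s g y) (closure (Om s)) := by
  intro y hy
  have h := isSlab_Om s
  simp only [laplacian, Finset.mul_sum]
  refine Finset.sum_congr rfl fun i _ => ?_
  rw [pd_congr (fun z hz => pd_const_mul h c hg hz) hy, pd_const_mul h c (hg.pd h i) hy]

/-- Functions with vanishing normal derivative, normalised at the origin. -/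
def neumannSpace (s : Side) : Submodule ℝ ((Fin 3 → ℝ) → ℝ) where
  carrier := {p | IsNeumann s p ∧ p 0 = 0}
  zero_mem' := by
    refine ⟨⟨IsSmooth.const 0, fun z => ?_, fun z => ?_⟩, rfl⟩
    · exact pd_const (isSlab_Om s) 0 (atHeight_mem_Om (lo_mem_Icc s) z)
    · exact pd_const (isSlab_Om s) 0 (atHeight_mem_Om (hi_mem_Icc s) z)
  add_mem' := by
    rintro p q ⟨hp, hp0⟩ ⟨hq, hq0⟩
    refine ⟨⟨hp.smooth.add hq.smooth, fun z => ?_, fun z => ?_⟩, by simp [hp0, hq0]⟩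
    · have := pd_add (i := 2) (isSlab_Om s) hp.smooth hq.smooth (atHeight_mem_Om (lo_mem_Icc s) z)
      rw [hp.lower, hq.lower, add_zero] at this
      exact this
    · have := pd_add (i := 2) (isSlab_Om s) hp.smooth hq.smooth (atHeight_mem_Om (hi_mem_Icc s) z)
      rw [hp.upper, hq.upper, add_zero] at this
      exact this
  smul_mem' := by
    rintro c p ⟨hp, hp0⟩
    refine ⟨⟨hp.smooth.const_mul c, fun z => ?_, fun z => ?_⟩, by simp [hp0]⟩
    · have := pd_const_mul (i := 2) (isSlab_Om s) c hp.smooth (atHeight_mem_Om (lo_mem_Icc s) z)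
      rw [hp.lower, mul_zero] at this
      exact this
    · have := pd_const_mul (i := 2) (isSlab_Om s) c hp.smooth (atHeight_mem_Om (hi_mem_Icc s) z)
      rw [hp.upper, mul_zero] at this
      exact this

/-- The derivatives of the Laplacian along a finite set of words. -/
def laplacianL2 (s : Side) (V : Finset (List (Fin 3))) : neumannSpace s →ₗ[ℝ]
    PiLp 2 fun _ : V => Lp ℝ 2 ((volume : Measure (Fin 3 → ℝ)).restrict (Om s ∩ cell {0, 1})) where
  toFun p := WithLp.toLp 2 fun v => toL2 s (dw (Om s) v (laplacian s p))
  map_add' p q := by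
    have h := isSlab_Om s
    ext1 v
    have hp := p.2.1.smooth.laplacian
    have hq := q.2.1.smooth.laplacian
    have := toL2_congr (((hp.dw h v).add (hq.dw h v)))
      ((dw_congr v (laplacian_add p.2.1.smooth q.2.1.smooth)).trans (dw_add h hp hq v))
    exact this.trans (toL2_add (hp.dw h v) (hq.dw h v))
  map_smul' c p := by
    have h := isSlab_Om s
    ext1 v
    have hp := p.2.1.smooth.laplacian
    have := toL2_congr (((hp.dw h v).const_mul c))
      ((dw_congr v (laplacian_const_mul c p.2.1.smooth)).trans (dw_const_mul h c hp v))
    exact this.trans (toL2_const_mul c (hp.dw h v))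

/-- A derivative as a bounded continuous function. -/
def dwBCF (s : Side) (w : List (Fin 3)) : neumannSpace s →ₗ[ℝ] (closure (Om s) →ᵇ ℝ) where
  toFun p := toBCF s (dw (Om s) w p)
  map_add' p q := by
    have h := isSlab_Om s
    have hp := p.2.1.smooth
    have hq := q.2.1.smooth
    ext y
    have e := toBCF_apply ((hp.add hq).dw h w) y
    rw [BoundedContinuousFunction.add_apply, toBCF_apply (hp.dw h w), toBCF_apply (hq.dw h w)]
    refine e.trans ?_
    exact dw_add h hp hq w y.2
  map_smul' c p := by
    have h := isSlab_Om s
    have hp := p.2.1.smooth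
    ext y
    have e := toBCF_apply ((hp.const_mul c).dw h w) y
    rw [RingHom.id_apply, BoundedContinuousFunction.smul_apply, toBCF_apply (hp.dw h w)]
    refine e.trans ?_
    exact dw_const_mul h c hp w y.2

/-- The solution operator of the Neumann problem. -/
theorem exists_neumann_operator (s : Side) (w : List (Fin 3)) :
    ∃ (V : Finset (List (Fin 3))) (L : (PiLp 2 fun _ : V =>
      Lp ℝ 2 ((volume : Measure (Fin 3 → ℝ)).restrict (Om s ∩ cell {0, 1}))) →L[ℝ]
        (closure (Om s) →ᵇ ℝ)),
      ∀ p, IsNeumann s p → p 0 = 0 →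
        L (WithLp.toLp 2 fun v => toL2 s (dw (Om s) v (laplacian s p))) = toBCF s (dw (Om s) w p) := by
  obtain ⟨V, C, hC⟩ := exists_supE_le s w
  have h := isSlab_Om s
  -- Each of the |V| summands of the a priori bound is at most the norm of the whole tuple, which
  -- gives the constant `C * V.card`.
  obtain ⟨L, hL⟩ := exists_clm_of_norm_le (laplacianL2 s V) (dwBCF s w) (C * V.card) fun p => by
    refine (norm_toBCF_le (p.2.1.smooth.dw h w)).trans ?_
    have hsm := fun v => p.2.1.smooth.laplacian.dw h v
    have e1 : ∀ v ∈ V, N2 s (dw (Om s) v (laplacian s p)) ≤ ‖laplacianL2 s V p‖ₑ := fun v hv => by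
      rw [← enorm_toL2 (hsm v), enorm_le_iff_norm_le]
      exact PiLp.norm_apply_le (laplacianL2 s V p) ⟨v, hv⟩
    have e2 : supE s (dw (Om s) w p) ≤ C * V.card * ‖laplacianL2 s V p‖ₑ := by
      refine (hC _ p.2.1 p.2.2).trans ?_
      rw [mul_assoc]
      gcongr
      exact (Finset.sum_le_sum e1).trans (by simp)
    have := ENNReal.toReal_mono (by finiteness) e2
    simpa using this
  exact ⟨V, L, fun p hp h0 => hL ⟨p, hp, h0⟩⟩

variable {T : ℝ} {f : (Fin 4 → ℝ) → ℝ}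

/-- A quadratic remainder is the convenient criterion here: for L²-valued slices and for parameter
integrals it follows from a pointwise Taylor bound that is uniform in the remaining variables. -/
lemma hasDerivWithinAt_of_taylor {E : Type*} [NormedAddCommGroup E] [NormedSpace ℝ E] {γ : ℝ → E}
    {γ' : E} {S : Set ℝ} {t K : ℝ} (h : ∀ r ∈ S, ‖γ r - γ t - (r - t) • γ'‖ ≤ K * |r - t| ^ 2) :
    HasDerivWithinAt γ γ' S t := by
  rw [hasDerivWithinAt_iff_isLittleO]
  have h1 : (fun r => γ r - γ t - (r - t) • γ') =O[𝓝[S] t] fun r => ‖r - t‖ ^ 2 :=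
    Asymptotics.IsBigO.of_bound K (eventually_of_mem self_mem_nhdsWithin fun r hr => by
      simpa using h r hr)
  exact h1.trans_isLittleO ((Asymptotics.isLittleO_pow_sub_sub t one_lt_two).mono nhdsWithin_le_nhds)

lemma atTime_eq_add {n : ℕ} (t r : ℝ) (y : Fin n → ℝ) :
    atTime r y = atTime t y + (r - t) • (Pi.single 0 1 : Fin (n + 1) → ℝ) := by
  ext k
  refine Fin.cases ?_ (fun k => ?_) k <;> simp [atTime]

/-- The second time derivative is bounded on the closed cylinder, so the Taylor remainder is
uniformly quadratic in `y`; the cell has finite measure, so the same holds in L². -/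
lemma hasDerivWithinAt_toL2 (hT : 0 < T) (hf : IsSmooth (Cyl T s) {1, 2} f) {t : ℝ}
    (ht : t ∈ Icc 0 T) :
    HasDerivWithinAt (fun t => toL2 s fun y => f (atTime t y))
      (toL2 s fun y => pd (Cyl T s) 0 f (atTime t y)) (Icc 0 T) t := by
  have h := isSlab_Cyl hT s
  obtain ⟨K, hK⟩ := exists_norm_toL2_le s
  obtain ⟨M, hM⟩ := h.exists_bound ((hf.pd h 0).pd h 0).continuousOn ((hf.pd h 0).pd h 0).periodic
  have hM0 : 0 ≤ M := (abs_nonneg _).trans (hM _ (atTime_mem hT ht (zero_mem_closure_Om s)))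
  refine hasDerivWithinAt_of_taylor (K := K * M) fun r hr => ?_
  have s1 := hf.atTime hT hr
  have s2 := hf.atTime hT ht
  have s3 := (hf.pd h 0).atTime hT ht
  have e : (toL2 s fun y => f (atTime r y)) - (toL2 s fun y => f (atTime t y))
      - (r - t) • (toL2 s fun y => pd (Cyl T s) 0 f (atTime t y))
      = toL2 s fun y => f (atTime r y) - f (atTime t y) - (r - t) * pd (Cyl T s) 0 f (atTime t y) := by
    rw [toL2_eq s1, toL2_eq s2, toL2_eq s3, toL2_eq ((s1.sub s2).sub (s3.const_mul (r - t)))]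
    rfl
  rw [e, mul_assoc]
  refine hK _ ((s1.sub s2).sub (s3.const_mul (r - t))) _ (by positivity) fun y hy => ?_
  have := hf.abs_taylor_le h hM (d := r - t) (atTime_mem hT ht hy)
    (by rw [← atTime_eq_add]; exact atTime_mem hT hr hy)
  rwa [← atTime_eq_add] at this

/-- A solution of the Neumann problem with smooth source is smooth in space and time. -/
theorem IsNeumann.isSmooth_of_time (hT : 0 < T) (hf : IsSmooth (Cyl T s) {1, 2} f)
    {p : ℝ → (Fin 3 → ℝ) → ℝ} (hp : ∀ t ∈ Icc 0 T, IsNeumann s (p t))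
    (h0 : ∀ t ∈ Icc 0 T, p t 0 = 0)
    (hL : ∀ t ∈ Icc 0 T, EqOn (laplacian s (p t)) (fun y => f (atTime t y)) (closure (Om s))) :
    IsSmooth (Cyl T s) {1, 2} fun x => p (x 0) (Fin.tail x) := by
  have h := isSlab_Cyl hT s
  have h3 := isSlab_Om s
  choose V L hVL using exists_neumann_operator s
  set F : ℕ → (Fin 4 → ℝ) → ℝ := fun k => (pd (Cyl T s) 0)^[k] f with hF
  have hF1 : ∀ k, F (k + 1) = pd (Cyl T s) 0 (F k) := fun k => Function.iterate_succ_apply' _ _ _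
  have hFs : ∀ k, IsSmooth (Cyl T s) {1, 2} (F k) := fun k => by
    induction k with
    | zero => exact hf
    | succ k ih => rw [hF1]; exact ih.pd h 0
  -- The data curve of the solution operator for the word `w` and its time derivatives; `hed` shows
  -- that raising `k` differentiates in time.
  set e : ∀ (w : List (Fin 3)), ℕ → ℝ → PiLp 2 fun _ : V w =>
      Lp ℝ 2 ((volume : Measure (Fin 3 → ℝ)).restrict (Om s ∩ cell {0, 1})) := fun w k t =>
    WithLp.toLp 2 fun v => toL2 s fun y =>
      dw (Cyl T s) ((v : List (Fin 3)).map Fin.succ) (F k) (atTime t y) with he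
  have hed : ∀ w k, ∀ t ∈ Icc 0 T, HasDerivWithinAt (e w k) (e w (k + 1) t) (Icc 0 T) t := by
    intro w k t ht
    have hpi : HasDerivWithinAt (fun t => (e w k t).ofLp) (e w (k + 1) t).ofLp (Icc 0 T) t := by
      refine hasDerivWithinAt_pi.2 fun v => ?_
      have := hasDerivWithinAt_toL2 hT ((hFs k).dw h ((v : List (Fin 3)).map Fin.succ)) ht
      rw [toL2_congr (((hFs (k + 1)).dw h ((v : List (Fin 3)).map Fin.succ)).atTime hT ht)] at this
      · exact this
      · intro y hy
        have := dw_perm h (hFs k) (List.perm_append_singleton 0 ((v : List (Fin 3)).map Fin.succ)).symm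
          (atTime_mem hT ht hy)
        rw [dw_append] at this
        rw [hF1]
        exact this
    exact (PiLp.hasFDerivAt_toLp 2 _).comp_hasDerivWithinAt t hpi
  -- For k = 0 this is the derivative of `p` along `w`. For k ≥ 1 it is the k-th time derivative,
  -- which exists because `L` is bounded on the whole space; the differentiated source is not
  -- claimed to be the Laplacian of any Neumann function.
  set Φ : ℕ → List (Fin 3) → ℝ → closure (Om s) →ᵇ ℝ := fun k w t => L w (e w k t) with hΦ
  have hd : ∀ k w, ∀ t ∈ Icc 0 T, HasDerivWithinAt (Φ k w) (Φ (k + 1) w t) (Icc 0 T) t :=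
    fun k w t ht => (L w).hasFDerivAt.comp_hasDerivWithinAt t (hed w k t ht)
  have hΦ0 : ∀ w, ∀ t ∈ Icc 0 T, Φ 0 w t = toBCF s (dw (Om s) w (p t)) := by
    intro w t ht
    rw [← hVL w _ (hp t ht) (h0 t ht)]
    simp only [hΦ, he]
    congr 2
    funext v
    refine (toL2_congr ((hf.dw h _).atTime hT ht) ?_).symm
    exact (dw_congr v (hL t ht)).trans (dw_atTime hT hf ht v)
  set r : ℕ → List (Fin 3) → (Fin 4 → ℝ) → ℝ := fun k w x => evalOm s (Fin.tail x) (Φ k w (x 0))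
    with hr
  have hmem : ∀ x ∈ closure (Cyl T s), x 0 ∈ Icc 0 T ∧ Fin.tail x ∈ closure (Om s) := fun x hx =>
    ⟨((mem_closure_Cyl hT).1 hx).1, mem_closure_Om.2 ((mem_closure_Cyl hT).1 hx).2⟩
  have hc : ∀ k w, ContinuousOn (r k w) (closure (Cyl T s)) := by
    intro k w
    rw [continuousOn_iff_continuous_domRestrict]
    have hΦc : Continuous ((Icc 0 T).domRestrict (Φ k w)) :=
      continuousOn_iff_continuous_domRestrict.1 fun t ht => (hd k w t ht).continuousWithinAt
    have hA : Continuous fun x : closure (Cyl T s) => (⟨x.1 0, (hmem x x.2).1⟩ : Icc 0 T) :=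
      Continuous.subtype_mk ((continuous_apply 0).comp continuous_subtype_val) _
    have hB : Continuous fun x : closure (Cyl T s) =>
        (⟨Fin.tail x.1, (hmem x x.2).2⟩ : closure (Om s)) :=
      Continuous.subtype_mk (continuous_pi fun i => (continuous_apply i.succ).comp continuous_subtype_val) _
    have := (hΦc.comp hA).eval hB
    convert this using 1
    ext x
    exact evalOm_apply (hmem x x.2).2 _
  -- For k ≥ 1 periodicity has no direct source; it is the time derivative of an identity known at
  -- level k − 1.
  have hper : ∀ i ∈ ({0, 1} : Set (Fin 3)), ∀ y ∈ closure (Om s), ∀ w k, ∀ t ∈ Icc 0 T,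
      (evalOm s (y + Pi.single i (2 * Real.pi)) - evalOm s y) (Φ k w t) = 0 := by
    intro i hi y hy w k
    have hy' : y + Pi.single i (2 * Real.pi) ∈ closure (Om s) :=
      h3.mem_closure_of_eq hy fun j hj => by
        have : j ≠ i := by rintro rfl; exact hj hi
        simp [this]
    induction k with
    | zero =>
      intro t ht
      have hs := (hp t ht).smooth.dw h3 w
      rw [hΦ0 w t ht, sub_apply, evalOm_apply hy, evalOm_apply hy',
        toBCF_apply hs, toBCF_apply hs, hs.periodic i hi y hy, sub_self]
    | succ k ih =>
      intro t ht
      have h1 := (evalOm s (y + Pi.single i (2 * Real.pi)) - evalOm s y).hasFDerivAt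
        |>.comp_hasDerivWithinAt t (hd k w t ht)
      have h2 := (hasDerivWithinAt_const t (Icc 0 T) (0 : ℝ)).congr_of_mem ih ht
      exact (uniqueDiffOn_Icc hT t ht).eq_deriv _ h1 h2
  have hw0 : ∀ k w, IsWeakDeriv (Cyl T s) 0 (r k w) (r (k + 1) w) := by
    intro k w
    refine IsWeakDeriv.of_hasLineDerivAt ((hc k w).mono subset_closure)
      ((hc _ w).mono subset_closure) h.isOpen fun x hx => ?_
    have h1 := (evalOm s (Fin.tail x)).hasFDerivAt.comp_hasDerivWithinAt _
      (hd k w (x 0) (Ioo_subset_Icc_self hx.1))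
    have h2 := h1.hasDerivAt (Icc_mem_nhds hx.1.1 hx.1.2)
    have e1 : (fun a : ℝ => r k w (x + a • Pi.single 0 1))
        = fun a : ℝ => (evalOm s (Fin.tail x) ∘ Φ k w) (x 0 + a) := by
      funext a
      have : Fin.tail (x + a • (Pi.single 0 1 : Fin 4 → ℝ)) = Fin.tail x := by
        ext i; simp [Fin.tail]
      simp only [hr, this]
      simp
    have h3 : HasDerivAt (fun a : ℝ => (evalOm s (Fin.tail x) ∘ Φ k w) (x 0 + a))
        (r (k + 1) w x) 0 := by
      have := HasDerivAt.comp_const_add (x 0) 0 (by simpa using h2)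
      exact this
    rw [HasLineDerivAt, e1]
    exact h3
  have hwj : ∀ k w (j : Fin 3), IsWeakDeriv (Cyl T s) j.succ (r k w) (r k (j :: w)) := by
    intro k w j
    induction k with
    | zero =>
      refine IsWeakDeriv.of_hasLineDerivAt ((hc 0 w).mono subset_closure)
        ((hc _ _).mono subset_closure) h.isOpen fun x hx => ?_
      have ht := Ioo_subset_Icc_self hx.1
      have hy : Fin.tail x ∈ Om s := hx.2
      have hs := (hp (x 0) ht).smooth
      have h1 := (hs.dw h3 w).hasLineDerivAt h3 hy (i := j)
      have e0 : ∀ v, ∀ z ∈ closure (Om s), r 0 v (atTime (x 0) z) = dw (Om s) v (p (x 0)) z := by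
        intro v z hz
        show evalOm s z (Φ 0 v (x 0)) = _
        rw [hΦ0 v _ ht, evalOm_apply hz, toBCF_apply (hs.dw h3 v)]
      rw [HasLineDerivAt] at h1 ⊢
      have e2 : r 0 (j :: w) x = pd (Om s) j (dw (Om s) w (p (x 0))) (Fin.tail x) := by
        have := e0 (j :: w) _ (subset_closure hy)
        rwa [atTime_eta] at this
      rw [e2]
      refine h1.congr_of_eventuallyEq ?_
      have hcont : Continuous fun a : ℝ => Fin.tail x + a • (Pi.single j 1 : Fin 3 → ℝ) := by
        fun_prop
      have hev : ∀ᶠ a in 𝓝 (0 : ℝ), Fin.tail x + a • (Pi.single j 1 : Fin 3 → ℝ) ∈ Om s :=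
        hcont.continuousAt.eventually_mem (h3.isOpen.mem_nhds (by simpa using hy))
      filter_upwards [hev] with a ha
      have := e0 w _ (subset_closure ha)
      rwa [atTime_add_smul_single, atTime_eta] at this
    -- Beyond k = 0 the spatial derivative is not available classically, but weak derivatives in `t`
    -- and `y` may be interchanged. Thus the functions `r k w` form a family closed under weak
    -- derivatives, as `memHInf_of_closed` requires.
    | succ k ih => exact ih.swap (hw0 k w) (hw0 k (j :: w))
  have key : MemHInf (Cyl T s) {1, 2} (r 0 []) := by
    refine memHInf_of_closed h (C := {g | ∃ k w, g = r k w}) ?_ ?_ ?_ _ ⟨0, [], rfl⟩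
    · rintro _ ⟨k, w, rfl⟩; exact hc k w
    · rintro _ ⟨k, w, rfl⟩ i hi x hx
      obtain ⟨ht, hy⟩ := hmem x hx
      have : ∃ j ∈ ({0, 1} : Set (Fin 3)), i = j.succ := by
        rcases hi with rfl | rfl
        · exact ⟨0, by simp, rfl⟩
        · exact ⟨1, by simp, rfl⟩
      obtain ⟨j, hj, rfl⟩ := this
      have h1 := hper j hj _ hy w k _ ht
      have e1 : Fin.tail (x + Pi.single j.succ (2 * Real.pi))
          = Fin.tail x + Pi.single j (2 * Real.pi) := by
        ext m; simp [Fin.tail, Pi.single_apply, Fin.succ_inj]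
      have e2 : (x + Pi.single j.succ (2 * Real.pi) : Fin 4 → ℝ) 0 = x 0 := by
        simp [(Fin.succ_ne_zero j).symm]
      simp only [hr, e1, e2]
      simpa [sub_eq_zero] using h1
    · rintro _ ⟨k, w, rfl⟩ i
      refine Fin.cases ⟨_, ⟨k + 1, w, rfl⟩, hw0 k w⟩ (fun j => ?_) i
      exact ⟨_, ⟨k, j :: w, rfl⟩, hwj k w j⟩
  refine ((memHInf_iff_isSmooth h).1 key).congr h fun x hx => ?_
  obtain ⟨ht, hy⟩ := hmem x hx
  show _ = evalOm s (Fin.tail x) (Φ 0 [] (x 0))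
  rw [hΦ0 _ _ ht, evalOm_apply hy]
  exact (toBCF_apply (hp _ ht).smooth ⟨_, hy⟩).symm

/-- The integral of a smooth function over one period cell is smooth in time. -/
lemma IsSmooth.integral_slice (hT : 0 < T) (hf : IsSmooth (Cyl T s) {1, 2} f) (s' : Side) :
    IsSmooth (Cyl T s') {1, 2} fun x => ∫ y in Om s ∩ cell {0, 1}, f (VortexSheet.atTime (x 0) y) := by
  have h := isSlab_Cyl hT s
  have h' := isSlab_Cyl hT s'
  have hd : ∀ g, IsSmooth (Cyl T s) {1, 2} g → ∀ t ∈ Icc 0 T,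
      HasDerivWithinAt (fun t => ∫ y in Om s ∩ cell {0, 1}, g (VortexSheet.atTime t y))
        (∫ y in Om s ∩ cell {0, 1}, VortexSheet.pd (Cyl T s) 0 g (VortexSheet.atTime t y))
        (Icc 0 T) t := by
    intro g hg t ht
    -- Integration over the cell is the inner product with the class of 1, a bounded functional, so
    -- the L² derivative passes through it.
    have h1 := (innerSL ℝ (toL2 s fun _ => 1)).hasFDerivAt.comp_hasDerivWithinAt t
      (hasDerivWithinAt_toL2 hT hg ht)
    have e : ∀ q, IsSmooth (Om s) {0, 1} q →
        innerSL ℝ (toL2 s fun _ => 1) (toL2 s q) = ∫ y in Om s ∩ cell {0, 1}, q y := by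
      intro q hq
      have h1 := IsSmooth.const (D := Om s) (P := {0, 1}) 1
      rw [innerSL_apply_apply, toL2_eq hq, toL2_eq h1, L2.inner_def]
      refine integral_congr_ae ?_
      filter_upwards [hq.memLp_two.coeFn_toLp, h1.memLp_two.coeFn_toLp] with y e1 e2
      rw [e1, e2]
      simp
    rw [e _ ((hg.pd h 0).atTime hT ht)] at h1
    exact h1.congr_of_mem (fun r hr => (e _ (hg.atTime hT hr)).symm) ht
  have hc : ∀ g, IsSmooth (Cyl T s) {1, 2} g →
      ContinuousOn (fun x : Fin 4 → ℝ => ∫ y in Om s ∩ cell {0, 1}, g (VortexSheet.atTime (x 0) y))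
        (closure (Cyl T s')) := fun g hg =>
    ContinuousOn.comp (f := fun x : Fin 4 → ℝ => x 0)
      (g := fun t => ∫ y in Om s ∩ cell {0, 1}, g (VortexSheet.atTime t y)) (t := Icc 0 T)
      (fun t ht => (hd g hg t ht).continuousWithinAt) (continuous_apply 0).continuousOn fun x hx => ((mem_closure_Cyl hT).1 hx).1
  refine (memHInf_iff_isSmooth h').1 (memHInf_of_closed h' (C := {k | ∃ g, IsSmooth (Cyl T s) {1, 2} g ∧
    k = fun x => ∫ y in Om s ∩ cell {0, 1}, g (VortexSheet.atTime (x 0) y)}) ?_ ?_ ?_ _ ⟨f, hf, rfl⟩)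
  · rintro _ ⟨g, hg, rfl⟩; exact hc g hg
  · rintro _ ⟨g, hg, rfl⟩ i hi x hx
    have : (x + Pi.single i (2 * Real.pi) : Fin 4 → ℝ) 0 = x 0 := by
      rcases hi with rfl | rfl <;> simp
    simp only [this]
  · rintro _ ⟨g, hg, rfl⟩ i
    refine Fin.cases ⟨_, ⟨_, hg.pd h 0, rfl⟩, ?_⟩ (fun j => ⟨_, ⟨_, IsSmooth.const 0, rfl⟩, ?_⟩) i
    · refine IsWeakDeriv.of_hasLineDerivAt ((hc g hg).mono subset_closure)
        ((hc _ (hg.pd h 0)).mono subset_closure) h'.isOpen fun x hx => ?_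
      have h2 := (hd g hg (x 0) (Ioo_subset_Icc_self hx.1)).hasDerivAt (Icc_mem_nhds hx.1.1 hx.1.2)
      have := HasDerivAt.comp_const_add (x 0) 0 (by simpa using h2)
      rw [HasLineDerivAt]
      simpa using this
    · refine IsWeakDeriv.of_hasLineDerivAt ((hc g hg).mono subset_closure)
        ((hc _ (IsSmooth.const 0)).mono subset_closure) h'.isOpen fun x hx => ?_
      rw [HasLineDerivAt]
      simpa [(Fin.succ_ne_zero j).symm] using hasDerivAt_const (0 : ℝ) _

end Slices

/-! ### Transport equations -/

section Transport

open Filter Topology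

variable {n : ℕ} {D : Set (Fin n → ℝ)} {P : Set (Fin n)} {f w : (Fin n → ℝ) → ℝ}

/-- The product of the unit interval, as an additional first coordinate, with `D`. -/
def consUnit (D : Set (Fin n → ℝ)) : Set (Fin (n + 1) → ℝ) := {z | z 0 ∈ Ioo 0 1 ∧ Fin.tail z ∈ D}

lemma IsSlab.consUnit_eq {a b : Fin n → ℝ} :
    consUnit (slab a b P) = slab (Fin.cons 0 a) (Fin.cons 1 b) (Fin.succ '' P) := by
  ext z
  have : ∀ i : Fin n, i.succ ∈ Fin.succ '' P ↔ i ∈ P := fun i =>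
    (Fin.succ_injective n).mem_set_image
  have h0 : 0 ∉ Fin.succ '' P := by rintro ⟨i, -, hi⟩; exact Fin.succ_ne_zero i hi
  simp [h0, consUnit, slab, Set.mem_pi, Fin.forall_fin_succ, Fin.tail, -mem_image, this]

lemma IsSlab.consUnit (h : IsSlab D P) : IsSlab (consUnit D) (Fin.succ '' P) := by
  obtain ⟨a, b, hab, rfl⟩ := h
  exact ⟨_, _, Fin.forall_fin_succ.2 ⟨by simp, fun i => by simpa using hab i⟩, consUnit_eq⟩

lemma IsSlab.mem_closure_consUnit (h : IsSlab D P) {z : Fin (n + 1) → ℝ} :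
    z ∈ closure (VortexSheet.consUnit D) ↔ z 0 ∈ Icc (0 : ℝ) 1 ∧ Fin.tail z ∈ closure D := by
  obtain ⟨a, b, hab, rfl⟩ := h
  rw [consUnit_eq, closure_slab (Fin.forall_fin_succ.2 ⟨by simp, fun i => by simpa using hab i⟩),
    closure_slab hab]
  have : ∀ i : Fin n, i.succ ∈ Fin.succ '' P ↔ i ∈ P := fun i =>
    (Fin.succ_injective n).mem_set_image
  have h0 : 0 ∉ Fin.succ '' P := by rintro ⟨i, -, hi⟩; exact Fin.succ_ne_zero i hi
  simp [h0, Set.mem_pi, Fin.forall_fin_succ, Fin.tail, -mem_image, this]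

/-- Integrals of smooth functions depending smoothly on a parameter are smooth. -/
lemma IsSmooth.integral_consUnit (h : IsSlab D P) {g : (Fin (n + 1) → ℝ) → ℝ}
    (hg : IsSmooth (consUnit D) (Fin.succ '' P) g) :
    IsSmooth D P fun x => ∫ θ in (0 : ℝ)..1, g (VortexSheet.atTime θ x) := by
  have h' := h.consUnit
  have hm : ∀ θ ∈ Icc (0 : ℝ) 1, ∀ x ∈ closure D,
      VortexSheet.atTime θ x ∈ closure (consUnit D) := fun θ hθ x hx =>
    h.mem_closure_consUnit.2 ⟨hθ, by simpa [VortexSheet.atTime] using hx⟩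
  have hI : ∀ g, IsSmooth (consUnit D) (Fin.succ '' P) g → ∀ x ∈ closure D,
      IntervalIntegrable (fun θ => g (VortexSheet.atTime θ x)) volume 0 1 := fun g hg x hx => by
    refine ContinuousOn.intervalIntegrable ?_
    rw [uIcc_of_le zero_le_one]
    refine hg.continuousOn.comp (Continuous.continuousOn ?_) fun θ hθ => hm θ hθ x hx
    exact continuous_pi fun i => by
      refine Fin.cases ?_ (fun k => ?_) i
      · exact continuous_id
      · exact continuous_const
  have hB : ∀ g, IsSmooth (consUnit D) (Fin.succ '' P) g → ∃ C, ∀ x ∈ closure (consUnit D), |g x| ≤ C :=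
    fun g hg => h'.exists_bound hg.continuousOn hg.periodic
  have hle : ∀ (k : ℝ → ℝ) (C : ℝ), (∀ θ ∈ Icc (0 : ℝ) 1, |k θ| ≤ C) →
      |∫ θ in (0 : ℝ)..1, k θ| ≤ C := fun k C hk => by
    have := intervalIntegral.norm_integral_le_of_norm_le_const (a := 0) (b := 1) (f := k) (C := C)
      fun θ hθ => by
        rw [uIoc_of_le zero_le_one] at hθ
        exact hk θ (Ioc_subset_Icc_self hθ)
    simpa using this
  have hc : ∀ g, IsSmooth (consUnit D) (Fin.succ '' P) g → ContinuousOn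
      (fun x => ∫ θ in (0 : ℝ)..1, g (VortexSheet.atTime θ x)) (closure D) := by
    intro g hg x hx
    choose C hC using fun i => hB _ (hg.pd h' i)
    have hb : ∀ z ∈ closure D, |(∫ θ in (0 : ℝ)..1, g (VortexSheet.atTime θ z))
        - ∫ θ in (0 : ℝ)..1, g (VortexSheet.atTime θ x)| ≤ ∑ i : Fin n, C i.succ * |z i - x i| := by
      intro z hz
      rw [← intervalIntegral.integral_sub (hI g hg z hz) (hI g hg x hx)]
      refine hle _ _ fun θ hθ => ?_
      have := hg.abs_sub_le h' hC (hm θ hθ x hx) (hm θ hθ z hz)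
      rw [Fin.sum_univ_succ] at this
      simpa [VortexSheet.atTime] using this
    refine tendsto_iff_norm_sub_tendsto_zero.2 ?_
    have h0 : Tendsto (fun z : Fin n → ℝ => ∑ i : Fin n, C i.succ * |z i - x i|) (𝓝[closure D] x)
        (𝓝 0) := by
      have : Continuous fun z : Fin n → ℝ => ∑ i : Fin n, C i.succ * |z i - x i| := by fun_prop
      simpa using (this.tendsto x).mono_left nhdsWithin_le_nhds
    exact squeeze_zero' (Eventually.of_forall fun _ => norm_nonneg _)
      (eventually_of_mem self_mem_nhdsWithin hb) h0
  refine (memHInf_iff_isSmooth h).1 (memHInf_of_closed h (C := {k | ∃ g,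
    IsSmooth (consUnit D) (Fin.succ '' P) g ∧
      k = fun x => ∫ θ in (0 : ℝ)..1, g (VortexSheet.atTime θ x)}) ?_ ?_ ?_ _ ⟨g, hg, rfl⟩)
  · rintro _ ⟨g, hg, rfl⟩; exact hc g hg
  · rintro _ ⟨g, hg, rfl⟩ i hi x hx
    refine intervalIntegral.integral_congr fun θ hθ => ?_
    rw [uIcc_of_le zero_le_one] at hθ
    have e : VortexSheet.atTime θ (x + Pi.single i (2 * Real.pi))
        = VortexSheet.atTime θ x + Pi.single i.succ (2 * Real.pi) := by
      rw [single_eq_smul, atTime_add_smul_single, ← single_eq_smul]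
    simp only [e]
    exact hg.periodic _ ⟨i, hi, rfl⟩ _ (hm θ hθ x hx)
  · rintro _ ⟨g, hg, rfl⟩ i
    refine ⟨_, ⟨_, hg.pd h' i.succ, rfl⟩, IsWeakDeriv.of_hasLineDerivAt ((hc g hg).mono subset_closure)
      ((hc _ (hg.pd h' i.succ)).mono subset_closure) h.isOpen fun x hx => ?_⟩
    obtain ⟨M, hM⟩ := hB _ ((hg.pd h' i.succ).pd h' i.succ)
    have hx' := subset_closure hx
    have hcont : Continuous fun a : ℝ => x + a • (Pi.single i 1 : Fin n → ℝ) := by fun_prop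
    have hev : ∀ᶠ a in 𝓝 (0 : ℝ), x + a • (Pi.single i 1 : Fin n → ℝ) ∈ D :=
      hcont.continuousAt.eventually_mem (h.isOpen.mem_nhds (by simpa using hx))
    have key : HasDerivWithinAt (fun a : ℝ => ∫ θ in (0 : ℝ)..1,
        g (VortexSheet.atTime θ (x + a • (Pi.single i 1 : Fin n → ℝ))))
        (∫ θ in (0 : ℝ)..1, VortexSheet.pd (consUnit D) i.succ g (VortexSheet.atTime θ x))
        {a | x + a • (Pi.single i 1 : Fin n → ℝ) ∈ D} 0 := by
      refine hasDerivWithinAt_of_taylor (K := M) fun a ha => ?_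
      have ha' := subset_closure (show x + a • (Pi.single i 1 : Fin n → ℝ) ∈ D from ha)
      simp only [zero_smul, add_zero, sub_zero, smul_eq_mul]
      rw [← intervalIntegral.integral_sub (hI g hg _ ha') (hI g hg x hx'),
        ← intervalIntegral.integral_const_mul,
        ← intervalIntegral.integral_sub ((hI g hg _ ha').sub (hI g hg x hx'))
          ((hI _ (hg.pd h' i.succ) x hx').const_mul a)]
      refine hle _ _ fun θ hθ => ?_
      have := hg.abs_taylor_le h' hM (d := a) (hm θ hθ x hx')
        (by rw [← atTime_add_smul_single]; exact hm θ hθ _ ha')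
      rwa [← atTime_add_smul_single] at this
    exact key.hasDerivAt hev

/-- A smooth function that is constant along the lines in direction `v` from the initial time. -/
lemma IsSmooth.eq_of_directional_eq_zero [NeZero n] (h : IsSlab D P) (hw : IsSmooth D P w)
    {v : Fin n → ℝ} (h0 : ∀ x ∈ closure D, ∑ i, v i * VortexSheet.pd D i w x = 0) {x : Fin n → ℝ}
    (hx : x ∈ closure D) (hx0 : x - x 0 • v ∈ closure D) : w x = w (x - x 0 • v) := by
  have := norm_image_sub_le_of_norm_deriv_le_segment_01' (C := 0)
    (fun r hr => hw.hasDerivWithinAt_segment h hx0 hx hr) fun r hr => ?_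
  · simpa [sub_eq_zero] using this
  · have e := h0 _ (h.convex.closure.add_smul_sub_mem hx0 hx (Ico_subset_Icc_self hr))
    simp only [Pi.sub_apply, Pi.smul_apply, smul_eq_mul, sub_sub_cancel] at e ⊢
    have : ∀ y : Fin n → ℝ, ∑ i, VortexSheet.pd D i w y * (x 0 * v i)
        = x 0 * ∑ i, v i * VortexSheet.pd D i w y := fun y => by
      rw [Finset.mul_sum]; exact Finset.sum_congr rfl fun i _ => by ring
    rw [this, e]
    simp

variable {T : ℝ} {s : Side}

/-- The space-time direction with tangential velocity `c`. -/
def vel (c : Fin 2 → ℝ) : Fin 4 → ℝ := ![1, c 0, c 1, 0]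

/-- The space-time direction with velocity `c` on the sheet. -/
def velB (c : Fin 2 → ℝ) : Fin 3 → ℝ := ![1, c 0, c 1]

/-- The derivative `∂_t + c_j ∂_{y_j}`. -/
def mat (T : ℝ) (s : Side) (c : Fin 2 → ℝ) (f : (Fin 4 → ℝ) → ℝ) (x : Fin 4 → ℝ) : ℝ :=
  dt T s f x + tang T s c f x

/-- The derivative `∂_t + c_j ∂_{y_j}` on the sheet. -/
def matB (T : ℝ) (c : Fin 2 → ℝ) (g : (Fin 3 → ℝ) → ℝ) (z : Fin 3 → ℝ) : ℝ :=
  dtB T g z + tangB T c g z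

lemma mat_eq (c : Fin 2 → ℝ) (f : (Fin 4 → ℝ) → ℝ) (x : Fin 4 → ℝ) :
    mat T s c f x = ∑ i, vel c i * pd (Cyl T s) i f x := by
  simp [mat, dt, tang, dy, vel, Fin.sum_univ_succ]

lemma matB_eq (c : Fin 2 → ℝ) (g : (Fin 3 → ℝ) → ℝ) (z : Fin 3 → ℝ) :
    matB T c g z = ∑ i, velB c i * pd (BCyl T) i g z := by
  simp [matB, dtB, tangB, velB, Fin.sum_univ_succ]

lemma add_smul_vel_mem (hT : 0 < T) {x : Fin 4 → ℝ} (hx : x ∈ closure (Cyl T s)) {r : ℝ}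
    (hr : x 0 + r ∈ Icc 0 T) (c : Fin 2 → ℝ) : x + r • vel c ∈ closure (Cyl T s) := by
  rw [mem_closure_Cyl hT] at *
  exact ⟨by simpa [vel] using hr, by simpa [vel] using hx.2⟩

lemma sub_smul_vel_mem (hT : 0 < T) {x : Fin 4 → ℝ} (hx : x ∈ closure (Cyl T s)) (c : Fin 2 → ℝ) :
    x - x 0 • vel c ∈ closure (Cyl T s) := by
  have := add_smul_vel_mem hT hx (r := -x 0) (by simpa using hT.le) c
  simpa [sub_eq_add_neg] using this

/-- Uniqueness for the transport equation. -/
lemma IsSmooth.eq_zero_of_mat (hT : 0 < T) {w : (Fin 4 → ℝ) → ℝ}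
    (hw : IsSmooth (Cyl T s) {1, 2} w) {c : Fin 2 → ℝ}
    (h0 : ∀ x ∈ closure (Cyl T s), mat T s c w x = 0)
    (hi : ∀ y ∈ closure (Om s), w (VortexSheet.atTime 0 y) = 0) :
    ∀ x ∈ closure (Cyl T s), w x = 0 := by
  intro x hx
  have hx0 := sub_smul_vel_mem hT hx c
  rw [hw.eq_of_directional_eq_zero (isSlab_Cyl hT s) (fun y hy => by rw [← mat_eq]; exact h0 y hy)
    hx hx0, ← atTime_eta (x - x 0 • vel c)]
  have : (x - x 0 • vel c) 0 = 0 := by simp [vel]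
  rw [this]
  exact hi _ (mem_closure_Om.2 ((mem_closure_Cyl hT).1 hx0).2)

/-- Uniqueness for the transport equation on the sheet. -/
lemma IsSmooth.eq_zero_of_matB (hT : 0 < T) {w : (Fin 3 → ℝ) → ℝ}
    (hw : IsSmooth (BCyl T) {1, 2} w) {c : Fin 2 → ℝ}
    (h0 : ∀ z ∈ closure (BCyl T), matB T c w z = 0)
    (hi : ∀ y', w (VortexSheet.atTime 0 y') = 0) :
    ∀ z ∈ closure (BCyl T), w z = 0 := by
  intro z hz
  have e : (z - z 0 • velB c) 0 = 0 := by simp [velB]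
  have hz0 : z - z 0 • velB c ∈ closure (BCyl T) :=
    (mem_closure_BCyl hT).2 (by rw [e]; exact ⟨le_rfl, hT.le⟩)
  rw [hw.eq_of_directional_eq_zero (isSlab_BCyl hT) (fun y hy => by rw [← matB_eq]; exact h0 y hy)
    hz hz0, ← atTime_eta (z - z 0 • velB c), e]
  exact hi _

/-- Existence for the transport equation. -/
theorem exists_transport (hT : 0 < T) {f : (Fin 4 → ℝ) → ℝ} {w0 : (Fin 3 → ℝ) → ℝ}
    (hf : IsSmooth (Cyl T s) {1, 2} f) (hw0 : IsSmooth (Om s) {0, 1} w0) (c : Fin 2 → ℝ) :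
    ∃ w, IsSmooth (Cyl T s) {1, 2} w ∧ (∀ x ∈ closure (Cyl T s), mat T s c w x = f x) ∧
      ∀ y ∈ closure (Om s), w (atTime 0 y) = w0 y := by
  have h := isSlab_Cyl hT s
  -- The Duhamel integral along the characteristic through `x`, with time rescaled as σ = θt, so
  -- that the interval of integration does not depend on `x`. Coordinate 0 of `z` is θ and
  -- coordinate 1 is t.
  set g : (Fin 5 → ℝ) → ℝ := fun z => z 1 * f (Fin.tail z + ((z 0 - 1) * z 1) • vel c) with hg
  have hgs : IsSmooth (consUnit (Cyl T s)) (Fin.succ '' {1, 2}) g := by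
    refine IsSmooth.mul ⟨(contDiff_apply ℝ ℝ 1).contDiffOn, ?_⟩ (hf.comp ?_ ?_ ?_)
    · rintro _ ⟨i, rfl | rfl, rfl⟩ x hx <;> simp
    · refine contDiff_pi.2 fun i => ?_
      have h1 : ContDiff ℝ ∞ fun z : Fin 5 → ℝ => z i.succ := contDiff_apply ℝ ℝ i.succ
      have h2 : ContDiff ℝ ∞ fun z : Fin 5 → ℝ => ((z 0 - 1) * z 1) * vel c i :=
        (((contDiff_apply ℝ ℝ 0).sub contDiff_const).mul (contDiff_apply ℝ ℝ 1)).mul contDiff_const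
      exact h1.add h2
    · intro z hz
      obtain ⟨h1, h2⟩ := h.mem_closure_consUnit.1 hz
      refine add_smul_vel_mem hT h2 ?_ c
      have h3 : z 1 ∈ Icc 0 T := ((mem_closure_Cyl hT).1 h2).1
      have e : Fin.tail z 0 + (z 0 - 1) * z 1 = z 0 * z 1 := by
        show z 1 + _ = _; ring
      rw [e]
      exact ⟨mul_nonneg h1.1 h3.1, (mul_le_of_le_one_left h3.1 h1.2).trans h3.2⟩
    · rintro _ ⟨i, hi, rfl⟩
      refine ⟨i, hi, fun x => ?_⟩
      have e0 : (x + Pi.single i.succ (2 * Real.pi) : Fin 5 → ℝ) 0 = x 0 := by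
        simp [(Fin.succ_ne_zero i).symm]
      have e1 : (x + Pi.single i.succ (2 * Real.pi) : Fin 5 → ℝ) 1 = x 1 := by
        rcases hi with rfl | rfl <;> simp
      have e2 : Fin.tail (x + Pi.single i.succ (2 * Real.pi))
          = Fin.tail x + Pi.single i (2 * Real.pi) := by
        ext m; simp [Fin.tail, Pi.single_apply, Fin.succ_inj]
      rw [e0, e1, e2]
      abel
  have hK := IsSmooth.integral_consUnit h hgs
  have hW : IsSmooth (Cyl T s) {1, 2} fun x => w0 (Fin.tail (x - x 0 • vel c)) := by
    refine hw0.comp ?_ ?_ ?_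
    · refine contDiff_pi.2 fun i => ?_
      exact (contDiff_apply ℝ ℝ i.succ).sub ((contDiff_apply ℝ ℝ 0).mul contDiff_const)
    · intro x hx
      exact mem_closure_Om.2 ((mem_closure_Cyl hT).1 (sub_smul_vel_mem hT hx c)).2
    · intro i hi
      have : ∃ j ∈ ({0, 1} : Set (Fin 3)), i = j.succ := by
        rcases hi with rfl | rfl
        · exact ⟨0, by simp, rfl⟩
        · exact ⟨1, by simp, rfl⟩
      obtain ⟨j, hj, rfl⟩ := this
      refine ⟨j, hj, fun x => ?_⟩
      ext m
      simp [Fin.tail, Pi.single_apply, Fin.succ_inj, (Fin.succ_ne_zero j).symm]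
      ring
  refine ⟨_, hW.add hK, ?_, ?_⟩
  · have hms : IsSmooth (Cyl T s) {1, 2} (mat T s c fun x => w0 (Fin.tail (x - x 0 • vel c))
        + ∫ θ in (0 : ℝ)..1, g (atTime θ x)) := by
      have := IsSmooth.sum Finset.univ fun i (_ : i ∈ Finset.univ) =>
        ((hW.add hK).pd h i).const_mul (vel c i)
      exact this.congr h fun x _ => mat_eq c _ x
    -- By continuity the equation needs checking only at interior points, where two-sided
    -- derivatives in time are available.
    refine hms.eqOn_closure hf fun x hx => ?_
    have hx' := subset_closure hx
    set z := x - x 0 • vel c with hz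
    have hzm : z ∈ closure (Cyl T s) := sub_smul_vel_mem hT hx' c
    have hz0 : z 0 = 0 := by
      show x 0 - x 0 * 1 = 0
      ring
    have hmz : ∀ r ∈ Icc 0 T, z + r • vel c ∈ closure (Cyl T s) := fun r hr =>
      add_smul_vel_mem hT hzm (by rwa [hz0, zero_add]) c
    have hxz : z + x 0 • vel c = x := by simp [hz]
    have hfc : ContinuousOn (fun r : ℝ => f (z + r • vel c)) (Icc 0 T) :=
      hf.continuousOn.comp (by fun_prop) hmz
    -- Along the characteristic issuing from `z` at time zero the candidate is its initial value
    -- plus the integral of `f`. Comparing the derivative in `r` given by the fundamental theorem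
    -- with the one given by the chain rule yields the equation at `x`.
    have e1 : ∀ r : ℝ, w0 (Fin.tail ((z + r • vel c) - (z + r • vel c) 0 • vel c))
        + ∫ θ in (0 : ℝ)..1, g (atTime θ (z + r • vel c))
        = w0 (Fin.tail z) + ∫ σ in (0 : ℝ)..r, f (z + σ • vel c) := by
      intro r
      have ev : (z + r • vel c) 0 = r := by simp [hz0, vel]
      have eg : ∀ θ, g (atTime θ (z + r • vel c)) = r * f (z + (θ * r) • vel c) := by
        intro θ
        have a1 : atTime θ (z + r • vel c) 1 = r := ev
        have a2 : Fin.tail (atTime θ (z + r • vel c)) = z + r • vel c := by simp [atTime]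
        have a3 : atTime θ (z + r • vel c) 0 = θ := rfl
        simp only [hg, a1, a2, a3]
        rw [add_assoc, ← add_smul]
        ring_nf
      simp only [eg, ev, add_sub_cancel_right]
      rw [intervalIntegral.integral_const_mul,
        intervalIntegral.mul_integral_comp_mul_right (f := fun σ : ℝ => f (z + σ • vel c))]
      simp
    have hx0 : x 0 ∈ Ioo 0 T := hx.1
    have hnh : Icc 0 T ∈ 𝓝 (x 0) := Icc_mem_nhds hx0.1 hx0.2
    have d1 : HasDerivAt (fun r : ℝ => w0 (Fin.tail z) + ∫ σ in (0 : ℝ)..r, f (z + σ • vel c))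
        (f (z + x 0 • vel c)) (x 0) := by
      refine (intervalIntegral.integral_hasDerivAt_right ?_ ?_ ?_).const_add _
      · refine (hfc.mono ?_).intervalIntegrable
        rw [uIcc_of_le hx0.1.le]
        exact Icc_subset_Icc_right hx0.2.le
      · exact hfc.stronglyMeasurableAtFilter_nhdsWithin measurableSet_Icc (x 0) |>.filter_mono
          (by rw [nhdsWithin_eq_nhds.2 hnh])
      · exact hfc.continuousAt hnh
    have d2 := ((hW.add hK).hasFDerivWithinAt (x := z + x 0 • vel c)
      (by rw [hxz]; exact hx')).comp_hasDerivWithinAt (x 0)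
      ((((hasDerivAt_id (x 0)).smul_const (vel c)).const_add z).hasDerivWithinAt (s := Icc 0 T)) hmz
    have d3 := d2.hasDerivAt hnh
    have d4 := d3.congr_of_eventuallyEq (f₁ := fun r : ℝ => w0 (Fin.tail z)
      + ∫ σ in (0 : ℝ)..r, f (z + σ • vel c)) (Eventually.of_forall fun r => (e1 r).symm)
    have := d4.unique d1
    rw [hxz, gradCLM_apply] at this
    rw [← this, mat_eq]
    exact Finset.sum_congr rfl fun i _ => by simp [mul_comm]
  · intro y hy
    have e0 : atTime 0 y 0 = 0 := rfl
    have e1 : ∀ θ, g (atTime θ (atTime 0 y)) = 0 := fun θ => by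
      have : atTime θ (atTime 0 y) 1 = 0 := rfl
      simp [hg, this]
    simp only [e1, e0]
    simp [atTime]

end Transport

/-! ### The system in Elsässer variables -/

section Elsasser

variable {T : ℝ} {s : Side} {f g : (Fin 4 → ℝ) → ℝ} {x : Fin 4 → ℝ}

lemma IsSmooth.tang (hT : 0 < T) (hf : IsSmooth (Cyl T s) {1, 2} f) (v : Fin 2 → ℝ) :
    IsSmooth (Cyl T s) {1, 2} (tang T s v f) :=
  IsSmooth.sum _ fun j _ => (hf.pd (isSlab_Cyl hT s) _).const_mul (v j)

lemma IsSmooth.mat (hT : 0 < T) (hf : IsSmooth (Cyl T s) {1, 2} f) (v : Fin 2 → ℝ) :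
    IsSmooth (Cyl T s) {1, 2} (mat T s v f) :=
  (hf.pd (isSlab_Cyl hT s) 0).add (hf.tang hT v)

lemma IsSmooth.div (hT : 0 < T) {w : Fin 3 → (Fin 4 → ℝ) → ℝ}
    (hw : ∀ α, IsSmooth (Cyl T s) {1, 2} (w α)) : IsSmooth (Cyl T s) {1, 2} (div T s w) :=
  IsSmooth.sum _ fun α _ => (hw α).pd (isSlab_Cyl hT s) α.succ

lemma pd_add_mul {n : ℕ} {D : Set (Fin n → ℝ)} {P : Set (Fin n)} (h : IsSlab D P)
    {f g : (Fin n → ℝ) → ℝ} (ε : ℝ) (hf : IsSmooth D P f) (hg : IsSmooth D P g) {x : Fin n → ℝ}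
    (hx : x ∈ closure D) (i : Fin n) :
    pd D i (fun x => f x + ε * g x) x = pd D i f x + ε * pd D i g x := by
  rw [pd_add h hf (hg.const_mul ε) hx, pd_const_mul h ε hg hx]

lemma tang_add_mul (hT : 0 < T) (ε : ℝ) (hf : IsSmooth (Cyl T s) {1, 2} f)
    (hg : IsSmooth (Cyl T s) {1, 2} g) (hx : x ∈ closure (Cyl T s)) (v : Fin 2 → ℝ) :
    tang T s v (fun x => f x + ε * g x) x = tang T s v f x + ε * tang T s v g x := by
  simp only [tang, dy, pd_add_mul (isSlab_Cyl hT s) ε hf hg hx, Fin.sum_univ_two]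
  ring

lemma mat_add_mul (hT : 0 < T) (ε : ℝ) (hf : IsSmooth (Cyl T s) {1, 2} f)
    (hg : IsSmooth (Cyl T s) {1, 2} g) (hx : x ∈ closure (Cyl T s)) (v : Fin 2 → ℝ) :
    mat T s v (fun x => f x + ε * g x) x = mat T s v f x + ε * mat T s v g x := by
  simp only [mat, dt, pd_add_mul (isSlab_Cyl hT s) ε hf hg hx, tang_add_mul hT ε hf hg hx]
  ring

lemma div_add_mul (hT : 0 < T) (ε : ℝ) {u w : Fin 3 → (Fin 4 → ℝ) → ℝ}
    (hu : ∀ α, IsSmooth (Cyl T s) {1, 2} (u α)) (hw : ∀ α, IsSmooth (Cyl T s) {1, 2} (w α))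
    (hx : x ∈ closure (Cyl T s)) :
    div T s (fun α x => u α x + ε * w α x) x = div T s u x + ε * div T s w x := by
  simp only [div, dy, pd_add_mul (isSlab_Cyl hT s) ε (hu _) (hw _) hx, Finset.sum_add_distrib,
    Finset.mul_sum]

lemma mat_sub_smul (u v : Fin 2 → ℝ) (ε : ℝ) (f : (Fin 4 → ℝ) → ℝ) (x : Fin 4 → ℝ) :
    mat T s (u - ε • v) f x = mat T s u f x - ε * tang T s v f x := by
  simp only [mat, tang, Fin.sum_univ_two, Pi.sub_apply, Pi.smul_apply, smul_eq_mul]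
  ring

lemma tang_eq (v : Fin 2 → ℝ) (f : (Fin 4 → ℝ) → ℝ) (x : Fin 4 → ℝ) :
    tang T s v f x = ∑ α : Fin 3, atHeight 0 v α * dy T s α f x := by
  have h2 : atHeight 0 v 2 = 0 := rfl
  have h0 : atHeight 0 v 0 = v 0 := rfl
  have h1 : atHeight 0 v 1 = v 1 := rfl
  simp [tang, Fin.sum_univ_three, h0, h1, h2]

lemma matB_add_mul (hT : 0 < T) (ε : ℝ) {f g : (Fin 3 → ℝ) → ℝ} (hf : IsSmooth (BCyl T) {1, 2} f)
    (hg : IsSmooth (BCyl T) {1, 2} g) {z : Fin 3 → ℝ} (hz : z ∈ closure (BCyl T))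
    (v : Fin 2 → ℝ) :
    matB T v (fun x => f x + ε * g x) z = matB T v f z + ε * matB T v g z := by
  simp only [matB, dtB, tangB, pd_add_mul (isSlab_BCyl hT) ε hf hg hz, Fin.sum_univ_two]
  ring

lemma matB_sub_smul (u v : Fin 2 → ℝ) (ε : ℝ) (f : (Fin 3 → ℝ) → ℝ) (z : Fin 3 → ℝ) :
    matB T (u - ε • v) f z = matB T u f z - ε * tangB T v f z := by
  simp only [matB, tangB, Fin.sum_univ_two, Pi.sub_apply, Pi.smul_apply, smul_eq_mul]
  ring

/-- The transport velocity has no normal component, so the operator restricts to horizontal planes.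
For this reason boundary values evolve on their own. -/
lemma matB_atHeight (hT : 0 < T) (hf : IsSmooth (Cyl T s) {1, 2} f) {a : ℝ}
    (ha : a ∈ Icc (lo s) (hi s)) {z : Fin 3 → ℝ} (hz : z ∈ closure (BCyl T)) (v : Fin 2 → ℝ) :
    matB T v (fun z => f (atHeight a z)) z = mat T s v f (atHeight a z) := by
  simp only [matB, dtB, tangB, pd_atHeight hT hf ha hz]
  rfl

/-- The coefficients are constant, so the transport operator commutes with each ∂_α. The divergence
of a transported field is transported, with the divergence of the source as its own source. -/
lemma mat_div (hT : 0 < T) {w : Fin 3 → (Fin 4 → ℝ) → ℝ}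
    (hw : ∀ α, IsSmooth (Cyl T s) {1, 2} (w α)) (c : Fin 2 → ℝ) (hx : x ∈ closure (Cyl T s)) :
    mat T s c (div T s w) x = ∑ α, dy T s α (mat T s c (w α)) x := by
  have h := isSlab_Cyl hT s
  have e : ∀ α, dy T s α (mat T s c (w α)) x
      = ∑ i, vel c i * pd (Cyl T s) i (dy T s α (w α)) x := by
    intro α
    have : EqOn (mat T s c (w α)) (fun x => ∑ i, vel c i * pd (Cyl T s) i (w α) x)
        (closure (Cyl T s)) := fun y _ => mat_eq c _ y
    rw [dy, pd_congr this hx, pd_sum h _ (fun i _ => ((hw α).pd h i).const_mul _) hx]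
    refine Finset.sum_congr rfl fun i _ => ?_
    rw [pd_const_mul h _ ((hw α).pd h i) hx, pd_comm h (hw α) _ _ hx]
    rfl
  rw [mat_eq, Finset.sum_congr rfl fun α _ => e α, Finset.sum_comm]
  refine Finset.sum_congr rfl fun i _ => ?_
  rw [← Finset.mul_sum]
  congr 1
  exact pd_sum h _ (fun α _ => (hw α).pd h α.succ) hx

/-- Equality of smooth functions can be tested on the interior of the time slices. -/
lemma IsSmooth.eqOn_of_slices (hf : IsSmooth (Cyl T s) {1, 2} f)
    (hg : IsSmooth (Cyl T s) {1, 2} g)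
    (h : ∀ t ∈ Icc 0 T, ∀ y ∈ Om s, f (VortexSheet.atTime t y) = g (VortexSheet.atTime t y)) :
    EqOn f g (closure (Cyl T s)) :=
  hf.eqOn_closure hg fun x hx => by
    have := h (x 0) (Ioo_subset_Icc_self hx.1) (Fin.tail x) hx.2
    rwa [atTime_eta] at this

variable (T : ℝ) (B : Background) (S : Sources) (s : Side) (ε : ℝ)
  (q : (Fin 4 → ℝ) → ℝ)

/-- The right-hand side of the transport equation for `u + ε H`. -/
def elsSource (α : Fin 3) (x : Fin 4 → ℝ) : ℝ :=
  S.Fu s α x - atHeight 0 (B.u s) α * S.F7 s x + atHeight 0 (B.H s) α * S.F8 s x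
    + ε * (S.FH s α x + atHeight 0 (B.u s) α * S.F8 s x - atHeight 0 (B.H s) α * S.F7 s x)
    - dy T s α q x

/-- The right-hand side of the Laplace equation for the total pressure, up to sign. -/
def pressureSource (x : Fin 4 → ℝ) : ℝ :=
  (∑ α : Fin 3, dy T s α (S.Fu s α) x) - (dt T s (S.F7 s) x + 2 * tang T s (B.u s) (S.F7 s) x)
    + 2 * tang T s (B.H s) (S.F8 s) x

/-- The normal derivative of the total pressure on the sheet. -/
def sheetSource (z : Fin 3 → ℝ) : ℝ :=
  S.Fu s 2 (atHeight 0 z) - matB T (B.u s) (S.G1 s) z + tangB T (B.H s) (S.G2 s) z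

/-- The equations satisfied by `w = u + ε H`, for `ε = ±1`. -/
structure IsElsasser (w : Fin 3 → (Fin 4 → ℝ) → ℝ) : Prop where
  smooth : ∀ α, IsSmooth (Cyl T s) {1, 2} (w α)
  eq : ∀ α, ∀ x ∈ closure (Cyl T s),
    mat T s (B.u s - ε • B.H s) (w α) x = elsSource T B S s ε q α x
  div : ∀ x ∈ closure (Cyl T s), div T s w x = S.F7 s x + ε * S.F8 s x
  wall : ∀ z ∈ closure (BCyl T), w 2 (atHeight (wall s) z) = 0
  sheet : ∀ z ∈ closure (BCyl T), w 2 (atHeight 0 z) = S.G1 s z + ε * S.G2 s z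

variable {T B S s ε q} {w : Fin 3 → (Fin 4 → ℝ) → ℝ}

lemma Sources.Smooth.isSmooth_Fu (hS : S.Smooth T) (hT : 0 < T) (s : Side) (α : Fin 3) :
    IsSmooth (Cyl T s) {1, 2} (S.Fu s α) := (hS.Fu s α).isSmooth (isSlab_Cyl hT s)

lemma Sources.Smooth.isSmooth_FH (hS : S.Smooth T) (hT : 0 < T) (s : Side) (α : Fin 3) :
    IsSmooth (Cyl T s) {1, 2} (S.FH s α) := (hS.FH s α).isSmooth (isSlab_Cyl hT s)

lemma Sources.Smooth.isSmooth_F7 (hS : S.Smooth T) (hT : 0 < T) (s : Side) :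
    IsSmooth (Cyl T s) {1, 2} (S.F7 s) := (hS.F7 s).isSmooth (isSlab_Cyl hT s)

lemma Sources.Smooth.isSmooth_F8 (hS : S.Smooth T) (hT : 0 < T) (s : Side) :
    IsSmooth (Cyl T s) {1, 2} (S.F8 s) := (hS.F8 s).isSmooth (isSlab_Cyl hT s)

lemma Sources.Smooth.isSmooth_G1 (hS : S.Smooth T) (hT : 0 < T) (s : Side) :
    IsSmooth (BCyl T) {1, 2} (S.G1 s) := (hS.G1 s).isSmooth (isSlab_BCyl hT)

lemma Sources.Smooth.isSmooth_G2 (hS : S.Smooth T) (hT : 0 < T) (s : Side) :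
    IsSmooth (BCyl T) {1, 2} (S.G2 s) := (hS.G2 s).isSmooth (isSlab_BCyl hT)

lemma Sources.Smooth.isSmooth_G5 (hS : S.Smooth T) (hT : 0 < T) :
    IsSmooth (BCyl T) {1, 2} S.G5 := hS.G5.isSmooth (isSlab_BCyl hT)

lemma isSmooth_elsSource (hT : 0 < T) (hS : S.Smooth T) (hq : IsSmooth (Cyl T s) {1, 2} q)
    (α : Fin 3) : IsSmooth (Cyl T s) {1, 2} (elsSource T B S s ε q α) := by
  have h7 := hS.isSmooth_F7 hT s
  have h8 := hS.isSmooth_F8 hT s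
  exact ((((hS.isSmooth_Fu hT s α).sub (h7.const_mul _)).add (h8.const_mul _)).add
    ((((hS.isSmooth_FH hT s α).add (h8.const_mul _)).sub (h7.const_mul _)).const_mul ε)).sub
    (hq.pd (isSlab_Cyl hT s) _)

lemma isSmooth_pressureSource (hT : 0 < T) (hS : S.Smooth T) :
    IsSmooth (Cyl T s) {1, 2} (pressureSource T B S s) := by
  have h := isSlab_Cyl hT s
  have h7 := hS.isSmooth_F7 hT s
  have h8 := hS.isSmooth_F8 hT s
  exact ((IsSmooth.sum _ fun α _ => (hS.isSmooth_Fu hT s α).pd h α.succ).sub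
    ((h7.pd h 0).add ((h7.tang hT _).const_mul 2))).add ((h8.tang hT _).const_mul 2)

lemma isSmooth_sheetSource (hT : 0 < T) (hS : S.Smooth T) :
    IsSmooth (BCyl T) {1, 2} (sheetSource T B S s) := by
  have h := isSlab_BCyl hT
  have h1 := hS.isSmooth_G1 hT s
  have h2 := hS.isSmooth_G2 hT s
  exact (((hS.isSmooth_Fu hT s 2).atHeight hT (zero_mem_Icc s)).sub ((h1.pd h 0).add
    (IsSmooth.sum _ fun j _ => (h1.pd h _).const_mul _))).add
    (IsSmooth.sum _ fun j _ => (h2.pd h _).const_mul _)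

lemma dy_elsSource (hT : 0 < T) (hS : S.Smooth T) (hq : IsSmooth (Cyl T s) {1, 2} q) (α : Fin 3)
    (hx : x ∈ closure (Cyl T s)) :
    dy T s α (elsSource T B S s ε q α) x = dy T s α (S.Fu s α) x
      - atHeight 0 (B.u s) α * dy T s α (S.F7 s) x + atHeight 0 (B.H s) α * dy T s α (S.F8 s) x
      + ε * (dy T s α (S.FH s α) x + atHeight 0 (B.u s) α * dy T s α (S.F8 s) x
        - atHeight 0 (B.H s) α * dy T s α (S.F7 s) x) - dy T s α (dy T s α q) x := by
  have h := isSlab_Cyl hT s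
  have hu := hS.isSmooth_Fu hT s α
  have hH := hS.isSmooth_FH hT s α
  have h7 := hS.isSmooth_F7 hT s
  have h8 := hS.isSmooth_F8 hT s
  have a1 := h7.const_mul (atHeight 0 (B.u s) α)
  have a2 := h8.const_mul (atHeight 0 (B.H s) α)
  have a3 := h8.const_mul (atHeight 0 (B.u s) α)
  have a4 := h7.const_mul (atHeight 0 (B.H s) α)
  have e1 := (hu.sub a1).add a2
  have e2 := (hH.add a3).sub a4
  unfold elsSource dy
  rw [pd_sub h (e1.add (e2.const_mul ε)) (hq.pd h _) hx, pd_add h e1 (e2.const_mul ε) hx,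
    pd_const_mul h ε e2 hx, pd_add h (hu.sub a1) a2 hx, pd_sub h hu a1 hx,
    pd_sub h (hH.add a3) a4 hx, pd_add h hH a3 hx, pd_const_mul h _ h7 hx, pd_const_mul h _ h8 hx,
    pd_const_mul h _ h8 hx, pd_const_mul h _ h7 hx]

/-- The defect from the transport of `F7` + ε`F8` splits into the residual of the Laplace equation,
even in ε, and ε times the residual of the compatibility of the induction sources. The hypothesis ε²
= 1 is what lets the `F8` terms combine. -/
lemma div_elsSource (hT : 0 < T) (hS : S.Smooth T) (hq : IsSmooth (Cyl T s) {1, 2} q)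
    (hε : ε * ε = 1) (hx : x ∈ closure (Cyl T s)) :
    ∑ α, dy T s α (elsSource T B S s ε q α) x
      = mat T s (B.u s - ε • B.H s) (fun x => S.F7 s x + ε * S.F8 s x) x
        + (pressureSource T B S s x - ∑ α, dy T s α (dy T s α q) x)
        + ε * (∑ α, dy T s α (S.FH s α) x - dt T s (S.F8 s) x) := by
  rw [mat_sub_smul, mat_add_mul hT ε (hS.isSmooth_F7 hT s) (hS.isSmooth_F8 hT s) hx,
    tang_add_mul hT ε (hS.isSmooth_F7 hT s) (hS.isSmooth_F8 hT s) hx]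
  simp only [dy_elsSource hT hS hq _ hx, pressureSource, mat, tang_eq, Fin.sum_univ_three]
  linear_combination (atHeight 0 (B.H s) 0 * dy T s 0 (S.F8 s) x
    + atHeight 0 (B.H s) 1 * dy T s 1 (S.F8 s) x + atHeight 0 (B.H s) 2 * dy T s 2 (S.F8 s) x) * hε

end Elsasser

/-! ### Equivalence of the full system with two constrained transport problems and a pressure
problem. -/

section Reduction

variable {T : ℝ} {B : Background} {S : Sources} {s : Side} {ε : ℝ} {q : (Fin 4 → ℝ) → ℝ}
  {w w' : Fin 3 → (Fin 4 → ℝ) → ℝ} {x : Fin 4 → ℝ} {z : Fin 3 → ℝ}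

variable (T B S s ε q) in
/-- The conditions under which the divergence constraint and the boundary conditions are preserved
by the transport equation for `u + ε H`. -/
structure IsElsCompat : Prop where
  div : ∀ x ∈ closure (Cyl T s), ∑ α, dy T s α (elsSource T B S s ε q α) x
    = mat T s (B.u s - ε • B.H s) (fun x => S.F7 s x + ε * S.F8 s x) x
  wall : ∀ z ∈ closure (BCyl T), elsSource T B S s ε q 2 (atHeight (wall s) z) = 0
  sheet : ∀ z ∈ closure (BCyl T), elsSource T B S s ε q 2 (atHeight 0 z)
    = matB T (B.u s - ε • B.H s) (fun z => S.G1 s z + ε * S.G2 s z) z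

variable (T B S s q) in
/-- The Neumann problem for the total pressure on one side. -/
structure IsPressure : Prop where
  laplace : ∀ x ∈ closure (Cyl T s), ∑ α, dy T s α (dy T s α q) x = pressureSource T B S s x
  wall : ∀ z ∈ closure (BCyl T),
    dy T s 2 q (atHeight (wall s) z) = S.Fu s 2 (atHeight (wall s) z)
  sheet : ∀ z ∈ closure (BCyl T), dy T s 2 q (atHeight 0 z) = sheetSource T B S s z

variable (T B S s) in
/-- The compatibility conditions between the sources of the induction equation. -/
structure IsSourceCompat : Prop where
  div : ∀ x ∈ closure (Cyl T s), dt T s (S.F8 s) x = ∑ α, dy T s α (S.FH s α) x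
  wall : ∀ z ∈ closure (BCyl T), S.FH s 2 (atHeight (wall s) z) = 0
  sheet : ∀ z ∈ closure (BCyl T), S.FH s 2 (atHeight 0 z)
    = matB T (B.u s) (S.G2 s) z - tangB T (B.H s) (S.G1 s) z

lemma matB_congr {f g : (Fin 3 → ℝ) → ℝ} (h : EqOn f g (closure (BCyl T))) (c : Fin 2 → ℝ)
    (hz : z ∈ closure (BCyl T)) : matB T c f z = matB T c g z := by
  simp only [matB_eq, pd_congr h hz]

lemma mat_congr {f g : (Fin 4 → ℝ) → ℝ} (h : EqOn f g (closure (Cyl T s))) (c : Fin 2 → ℝ)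
    (hx : x ∈ closure (Cyl T s)) : mat T s c f x = mat T s c g x := by
  simp only [mat_eq, pd_congr h hx]

lemma matB_zero (hT : 0 < T) (c : Fin 2 → ℝ) (hz : z ∈ closure (BCyl T)) :
    matB T c (fun _ => 0) z = 0 := by
  simp only [matB_eq, pd_const (isSlab_BCyl hT) 0 hz, mul_zero, Finset.sum_const_zero]

/-- The background states are tangential, so the terms coming from the divergences vanish in the
normal component. -/
lemma elsSource_two (x : Fin 4 → ℝ) :
    elsSource T B S s ε q 2 x = S.Fu s 2 x + ε * S.FH s 2 x - dy T s 2 q x := by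
  have h : ∀ v : Fin 2 → ℝ, atHeight 0 v 2 = 0 := fun _ => rfl
  simp only [elsSource, h]
  ring

/-- Sorted by parity in ε, the even part belongs to the Neumann condition for the pressure on the
sheet and the odd part to the condition on 𝔽₆. -/
lemma sheet_identity (hT : 0 < T) (hS : S.Smooth T) (hε : ε * ε = 1)
    (hz : z ∈ closure (BCyl T)) :
    matB T (B.u s - ε • B.H s) (fun z => S.G1 s z + ε * S.G2 s z) z
      = matB T (B.u s) (S.G1 s) z - tangB T (B.H s) (S.G2 s) z
        + ε * (matB T (B.u s) (S.G2 s) z - tangB T (B.H s) (S.G1 s) z) := by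
  rw [matB_add_mul hT ε (hS.isSmooth_G1 hT s) (hS.isSmooth_G2 hT s) hz, matB_sub_smul,
    matB_sub_smul]
  linear_combination (-tangB T (B.H s) (S.G2 s) z) * hε

lemma IsPressure.isElsCompat (hT : 0 < T) (hS : S.Smooth T) (hq : IsSmooth (Cyl T s) {1, 2} q)
    (hp : IsPressure T B S s q) (hc : IsSourceCompat T B S s) (hε : ε * ε = 1) :
    IsElsCompat T B S s ε q where
  div x hx := by
    rw [div_elsSource hT hS hq hε hx, hp.laplace x hx, hc.div x hx]
    ring
  wall z hz := by
    rw [elsSource_two, hp.wall z hz, hc.wall z hz]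
    ring
  sheet z hz := by
    rw [elsSource_two, hp.sheet z hz, hc.sheet z hz, sheet_identity hT hS hε hz, sheetSource]
    ring

/-- Half the sum and half the difference of the conditions for ε = 1 and ε = −1 separate the
pressure from the induction sources. -/
lemma isPressure_and_isSourceCompat (hT : 0 < T) (hS : S.Smooth T)
    (hq : IsSmooth (Cyl T s) {1, 2} q) (h1 : IsElsCompat T B S s 1 q)
    (h2 : IsElsCompat T B S s (-1) q) : IsPressure T B S s q ∧ IsSourceCompat T B S s := by
  have e1 := fun x hx => (div_elsSource (ε := 1) hT hS hq (by norm_num) hx).symm.trans (h1.div x hx)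
  have e2 := fun x hx =>
    (div_elsSource (ε := -1) hT hS hq (by norm_num) hx).symm.trans (h2.div x hx)
  have w1 := fun z hz => (elsSource_two _).symm.trans (h1.wall z hz)
  have w2 := fun z hz => (elsSource_two _).symm.trans (h2.wall z hz)
  have s1 := fun z hz => ((elsSource_two _).symm.trans (h1.sheet z hz)).trans
    (sheet_identity hT hS (by norm_num) hz)
  have s2 := fun z hz => ((elsSource_two _).symm.trans (h2.sheet z hz)).trans
    (sheet_identity hT hS (by norm_num) hz)
  refine ⟨⟨fun x hx => ?_, fun z hz => ?_, fun z hz => ?_⟩,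
    fun x hx => ?_, fun z hz => ?_, fun z hz => ?_⟩
  · linarith [e1 x hx, e2 x hx]
  · linarith [w1 z hz, w2 z hz]
  · rw [sheetSource]; linarith [s1 z hz, s2 z hz]
  · linarith [e1 x hx, e2 x hx]
  · linarith [w1 z hz, w2 z hz]
  · linarith [s1 z hz, s2 z hz]

/-- Apply the transport operator to the divergence constraint and to both traces; the equation for
`w` turns the left-hand sides into data. This is the necessity half. -/
lemma IsElsasser.isElsCompat (hT : 0 < T) (hw : IsElsasser T B S s ε q w) :
    IsElsCompat T B S s ε q where
  div x hx := by
    rw [← mat_congr hw.div _ hx, mat_div hT hw.smooth _ hx]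
    exact Finset.sum_congr rfl fun α _ => (pd_congr (hw.eq α) hx).symm
  wall z hz := by
    rw [← hw.eq 2 _ (atHeight_mem hT (wall_mem_Icc s) hz),
      ← matB_atHeight hT (hw.smooth 2) (wall_mem_Icc s) hz, matB_congr hw.wall _ hz,
      matB_zero hT _ hz]
  sheet z hz := by
    rw [← hw.eq 2 _ (atHeight_mem hT (zero_mem_Icc s) hz),
      ← matB_atHeight hT (hw.smooth 2) (zero_mem_Icc s) hz, matB_congr hw.sheet _ hz]

/-- The transport equations are solved without regard to the constraints. The errors in the
divergence and in the traces then satisfy homogeneous transport equations with zero initial values,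
so they vanish. -/
lemma IsElsCompat.exists_isElsasser (hT : 0 < T) (hS : S.Smooth T)
    (hq : IsSmooth (Cyl T s) {1, 2} q) (hc : IsElsCompat T B S s ε q)
    {w0 : Fin 3 → (Fin 3 → ℝ) → ℝ} (hw0 : ∀ α, IsSmooth (Om s) {0, 1} (w0 α))
    (hdiv : ∀ y ∈ closure (Om s),
      divSpace s w0 y = S.F7 s (atTime 0 y) + ε * S.F8 s (atTime 0 y))
    (hwall : ∀ y', w0 2 (atHeight (VortexSheet.wall s) y') = 0)
    (hsheet : ∀ y', w0 2 (atHeight 0 y') = S.G1 s (atTime 0 y') + ε * S.G2 s (atTime 0 y')) :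
    ∃ w, IsElsasser T B S s ε q w ∧ ∀ α, ∀ y ∈ closure (Om s), w α (atTime 0 y) = w0 α y := by
  have h := isSlab_Cyl hT s
  have hb := isSlab_BCyl hT
  have h00 : (0 : ℝ) ∈ Icc 0 T := ⟨le_rfl, hT.le⟩
  choose w hw heq hi using fun α =>
    exists_transport hT (isSmooth_elsSource hT hS hq α (B := B) (ε := ε)) (hw0 α)
      (B.u s - ε • B.H s)
  have h7 := hS.isSmooth_F7 hT s
  have h8 := hS.isSmooth_F8 hT s
  have h78 := h7.add (h8.const_mul ε)
  have h12 := (hS.isSmooth_G1 hT s).add ((hS.isSmooth_G2 hT s).const_mul ε)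
  have hbz : ∀ {f g : (Fin 3 → ℝ) → ℝ}, IsSmooth (BCyl T) {1, 2} f → IsSmooth (BCyl T) {1, 2} g →
      (∀ z ∈ closure (BCyl T), matB T (B.u s - ε • B.H s) f z = matB T (B.u s - ε • B.H s) g z) →
      (∀ y', f (atTime 0 y') = g (atTime 0 y')) → ∀ z ∈ closure (BCyl T), f z = g z := by
    intro f g hf hg hfg h0 z hz
    have := (hf.add (hg.const_mul (-1))).eq_zero_of_matB hT (c := B.u s - ε • B.H s)
      (fun z hz => by rw [matB_add_mul hT _ hf hg hz, hfg z hz]; ring)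
      (fun y' => by rw [h0]; ring) z hz
    linarith
  refine ⟨w, ⟨hw, heq, fun x hx => ?_, fun z hz => ?_, fun z hz => ?_⟩, hi⟩
  · have hd := IsSmooth.div hT hw
    have := (hd.add (h78.const_mul (-1))).eq_zero_of_mat hT (c := B.u s - ε • B.H s)
      (fun x hx => by
        have e : ∀ α, dy T s α (mat T s (B.u s - ε • B.H s) (w α)) x
            = dy T s α (elsSource T B S s ε q α) x := fun α => pd_congr (heq α) hx
        rw [mat_add_mul hT _ hd h78 hx, mat_div hT hw _ hx, ← hc.div x hx]
        simp only [e]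
        ring)
      (fun y hy => by
        have e : VortexSheet.div T s w (atTime 0 y) = divSpace s w0 y :=
          Finset.sum_congr rfl fun α _ =>
            (pd_atTime hT (hw α) h00 hy α).symm.trans (pd_congr (hi α) hy)
        rw [e, hdiv y hy]; ring) x hx
    linarith
  · refine hbz ((hw 2).atHeight hT (wall_mem_Icc s)) (IsSmooth.const 0) (fun z hz => ?_)
      (fun y' => ?_) z hz
    · rw [matB_atHeight hT (hw 2) (wall_mem_Icc s) hz, heq 2 _ (atHeight_mem hT (wall_mem_Icc s) hz),
        hc.wall z hz, matB_zero hT _ hz]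
    · rw [← atTime_atHeight, hi 2 _ (atHeight_mem_Om (wall_mem_Icc s) y'), hwall]
  · refine hbz ((hw 2).atHeight hT (zero_mem_Icc s)) h12 (fun z hz => ?_)
      (fun y' => ?_) z hz
    · rw [matB_atHeight hT (hw 2) (zero_mem_Icc s) hz, heq 2 _ (atHeight_mem hT (zero_mem_Icc s) hz),
        hc.sheet z hz]
    · rw [← atTime_atHeight, hi 2 _ (atHeight_mem_Om (zero_mem_Icc s) y'), hsheet]

/-- The pressure enters only through its gradient, so two pressures differing by a function of time
produce the same fields. -/
lemma IsElsasser.unique (hT : 0 < T) {q' : (Fin 4 → ℝ) → ℝ} (hw : IsElsasser T B S s ε q w)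
    (hw' : IsElsasser T B S s ε q' w')
    (hq : ∀ α, ∀ x ∈ closure (Cyl T s), dy T s α q' x = dy T s α q x)
    (hi : ∀ α, ∀ y ∈ closure (Om s), w' α (atTime 0 y) = w α (atTime 0 y)) (α : Fin 3) :
    ∀ x ∈ closure (Cyl T s), w' α x = w α x := by
  intro x hx
  have := ((hw'.smooth α).add ((hw.smooth α).const_mul (-1))).eq_zero_of_mat hT
    (c := B.u s - ε • B.H s) (fun x hx => by
      rw [mat_add_mul hT _ (hw'.smooth α) (hw.smooth α) hx, hw.eq α x hx, hw'.eq α x hx, elsSource,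
        elsSource, hq α x hx]
      ring) (fun y hy => by rw [hi α y hy]; ring) x hx
  linarith

variable {d : InitialData} {U V : State}

lemma IsSolution.isElsasser (hT : 0 < T) (hS : S.Smooth T) (hU : IsSolution T B S d U) (s : Side)
    (hε : ε * ε = 1) :
    IsElsasser T B S s ε (U.q s) fun α x => U.u s α x + ε * U.H s α x := by
  have h := isSlab_Cyl hT s
  have hu := fun α => (hU.mem_u s α).isSmooth h
  have hH := fun α => (hU.mem_H s α).isSmooth h
  have hq := (hU.mem_q s).isSmooth h
  have hz : ∀ {z : Fin 3 → ℝ}, z ∈ closure (BCyl T) → z 0 ∈ Icc 0 T := fun hz =>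
    (mem_closure_BCyl hT).1 hz
  have hs := fun α => (hu α).add ((hH α).const_mul ε)
  have hae : ∀ a z, atTime (z 0) (atHeight a (Fin.tail z)) = atHeight a z := fun a z => by
    rw [atTime_atHeight, atTime_eta]
  refine ⟨hs, fun α => ((hs α).mat hT _).eqOn_of_slices (isSmooth_elsSource hT hS hq α) ?_,
    (IsSmooth.div hT hs).eqOn_of_slices
      ((hS.isSmooth_F7 hT s).add ((hS.isSmooth_F8 hT s).const_mul ε)) ?_,
    fun z h => ?_, fun z h => ?_⟩
  · intro t ht y hy
    have hx : atTime t y ∈ closure (Cyl T s) := atTime_mem hT ht (subset_closure hy)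
    rw [mat_sub_smul, mat_add_mul hT _ (hu α) (hH α) hx, tang_add_mul hT _ (hu α) (hH α) hx, mat,
      mat, elsSource]
    -- Momentum plus ε times induction; the multiples of the two divergence equations trade every
    -- divergence for `F7` or `F8`, and ε² = 1 turns the tangential derivative of H into that of
    -- `w`.
    linear_combination hU.momentum s t ht y hy α + ε * hU.induction s t ht y hy α
      + (ε * atHeight 0 (B.u s) α + atHeight 0 (B.H s) α) * hU.div_H s t ht y hy
      - (ε * atHeight 0 (B.H s) α + atHeight 0 (B.u s) α) * hU.div_u s t ht y hy
      - tang T s (B.H s) (U.H s α) (atTime t y) * hε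
  · intro t ht y hy
    rw [div_add_mul hT ε hu hH (atTime_mem hT ht (subset_closure hy)), hU.div_u s t ht y hy,
      hU.div_H s t ht y hy]
  · rw [← hae, hU.wall_u s _ (hz h), hU.wall_H s _ (hz h)]; ring
  · rw [← hae, hU.sheet_u s _ (hz h), hU.sheet_H s _ (hz h), atTime_eta]

/-- Inverts the change of variables: u is half the sum of the two Elsässer fields and H half their
difference. -/
lemma isSolution_of_isElsasser (hT : 0 < T) {q : Side → (Fin 4 → ℝ) → ℝ}
    {w₁ w₂ : Side → Fin 3 → (Fin 4 → ℝ) → ℝ} (hq : ∀ s, IsSmooth (Cyl T s) {1, 2} (q s))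
    (h1 : ∀ s, IsElsasser T B S s 1 (q s) (w₁ s)) (h2 : ∀ s, IsElsasser T B S s (-1) (q s) (w₂ s))
    (hj : ∀ z ∈ closure (BCyl T), q .plus (atHeight 0 z) - q .minus (atHeight 0 z) = S.G5 z)
    (hi1 : ∀ s α, ∀ y ∈ closure (Om s), w₁ s α (atTime 0 y) = d.u s α y + d.H s α y)
    (hi2 : ∀ s α, ∀ y ∈ closure (Om s), w₂ s α (atTime 0 y) = d.u s α y - d.H s α y) :
    IsSolution T B S d
      ⟨fun s α x => 2⁻¹ * w₁ s α x + 2⁻¹ * w₂ s α x,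
        fun s α x => 2⁻¹ * w₁ s α x + (-2⁻¹) * w₂ s α x, q⟩ := by
  have hC := fun s => isSlab_Cyl hT s
  have a1 := fun s α => ((h1 s).smooth α).const_mul 2⁻¹
  have a2 := fun s α => (h2 s).smooth α
  have L1 : ∀ s α x, x ∈ closure (Cyl T s) → ∀ (v : Fin 2 → ℝ) (r : ℝ), mat T s v
      (fun x => 2⁻¹ * w₁ s α x + r * w₂ s α x) x = 2⁻¹ * mat T s v (w₁ s α) x
        + r * mat T s v (w₂ s α) x := fun s α x hx v r => by
    rw [mat_add_mul hT r (a1 s α) (a2 s α) hx]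
    have := mat_add_mul hT 2⁻¹ (IsSmooth.const 0) ((h1 s).smooth α) hx v
    have e0 : mat T s v (fun _ => 0) x = 0 := by
      simp only [mat_eq, pd_const (hC s) 0 hx, mul_zero, Finset.sum_const_zero]
    simp only [zero_add, e0] at this
    rw [this]
  have L2 : ∀ s α x, x ∈ closure (Cyl T s) → ∀ (v : Fin 2 → ℝ) (r : ℝ), tang T s v
      (fun x => 2⁻¹ * w₁ s α x + r * w₂ s α x) x = 2⁻¹ * tang T s v (w₁ s α) x
        + r * tang T s v (w₂ s α) x := fun s α x hx v r => by
    -- The tangential derivative is a difference of two transport operators, with velocities `v` and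
    -- 0, so its linearity follows from `L1`.
    have e := fun f => mat_sub_smul (T := T) (s := s) 0 v (-1) f x
    have e0 := L1 s α x hx 0 r
    have e1 := L1 s α x hx (0 - (-1 : ℝ) • v) r
    rw [e, e, e] at e1
    linarith
  have L3 : ∀ s x, x ∈ closure (Cyl T s) → ∀ r : ℝ, div T s
      (fun α x => 2⁻¹ * w₁ s α x + r * w₂ s α x) x = 2⁻¹ * div T s (w₁ s) x
        + r * div T s (w₂ s) x := fun s x hx r => by
    rw [div_add_mul hT r (a1 s) (a2 s) hx]
    simp only [div, dy, pd_const_mul (hC s) _ ((h1 s).smooth _) hx, Finset.mul_sum]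
  have E1 : ∀ s α x, x ∈ closure (Cyl T s) → mat T s (B.u s) (w₁ s α) x
      - tang T s (B.H s) (w₁ s α) x = elsSource T B S s 1 (q s) α x := fun s α x hx => by
    have := (h1 s).eq α x hx
    rw [mat_sub_smul] at this
    linarith
  have E2 : ∀ s α x, x ∈ closure (Cyl T s) → mat T s (B.u s) (w₂ s α) x
      + tang T s (B.H s) (w₂ s α) x = elsSource T B S s (-1) (q s) α x := fun s α x hx => by
    have := (h2 s).eq α x hx
    rw [mat_sub_smul] at this
    linarith
  have hz : ∀ {t : ℝ}, t ∈ Icc 0 T → ∀ y' : Fin 2 → ℝ, atTime t y' ∈ closure (BCyl T) :=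
    fun ht y' => atTime_mem_BCyl hT ht y'
  have du : ∀ s, ∀ t ∈ Icc 0 T, ∀ y ∈ Om s, div T s
      (fun α x => 2⁻¹ * w₁ s α x + 2⁻¹ * w₂ s α x) (atTime t y) = S.F7 s (atTime t y) := by
    intro s t ht y hy
    have hx := atTime_mem hT ht (subset_closure hy)
    rw [L3 s _ hx, (h1 s).div _ hx, (h2 s).div _ hx]; ring
  have dH : ∀ s, ∀ t ∈ Icc 0 T, ∀ y ∈ Om s, div T s
      (fun α x => 2⁻¹ * w₁ s α x + (-2⁻¹) * w₂ s α x) (atTime t y) = S.F8 s (atTime t y) := by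
    intro s t ht y hy
    have hx := atTime_mem hT ht (subset_closure hy)
    rw [L3 s _ hx, (h1 s).div _ hx, (h2 s).div _ hx]; ring
  constructor
  · exact fun s α => (memHInf_iff_isSmooth (hC s)).2 ((a1 s α).add ((a2 s α).const_mul _))
  · exact fun s α => (memHInf_iff_isSmooth (hC s)).2 ((a1 s α).add ((a2 s α).const_mul _))
  · exact fun s => (memHInf_iff_isSmooth (hC s)).2 (hq s)
  · intro s t ht y hy α
    have hx := atTime_mem hT ht (subset_closure hy)
    have m := L1 s α _ hx (B.u s) 2⁻¹
    rw [mat] at m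
    have e1 := E1 s α _ hx
    have e2 := E2 s α _ hx
    rw [elsSource] at e1 e2
    dsimp only
    rw [du s t ht y hy, dH s t ht y hy, m, L2 s α _ hx]
    linear_combination 2⁻¹ * e1 + 2⁻¹ * e2
  · intro s t ht y hy α
    have hx := atTime_mem hT ht (subset_closure hy)
    have m := L1 s α _ hx (B.u s) (-2⁻¹)
    rw [mat] at m
    have e1 := E1 s α _ hx
    have e2 := E2 s α _ hx
    rw [elsSource] at e1 e2
    dsimp only
    rw [du s t ht y hy, dH s t ht y hy, m, L2 s α _ hx]
    linear_combination 2⁻¹ * e1 - 2⁻¹ * e2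
  · exact du
  · exact dH
  · intro s t ht y'
    dsimp only
    rw [atTime_atHeight, (h1 s).wall _ (hz ht y'), (h2 s).wall _ (hz ht y')]; ring
  · intro s t ht y'
    dsimp only
    rw [atTime_atHeight, (h1 s).wall _ (hz ht y'), (h2 s).wall _ (hz ht y')]; ring
  · intro s t ht y'
    dsimp only
    rw [atTime_atHeight, (h1 s).sheet _ (hz ht y'), (h2 s).sheet _ (hz ht y')]; ring
  · intro s t ht y'
    dsimp only
    rw [atTime_atHeight, (h1 s).sheet _ (hz ht y'), (h2 s).sheet _ (hz ht y')]; ring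
  · intro t ht y'
    dsimp only
    rw [atTime_atHeight]
    exact hj _ (hz ht y')
  · intro s α y hy
    dsimp only
    rw [hi1 s α y (subset_closure hy), hi2 s α y (subset_closure hy)]; ring
  · intro s α y hy
    dsimp only
    rw [hi1 s α y (subset_closure hy), hi2 s α y (subset_closure hy)]; ring

end Reduction

/-! ### The coupled Laplace problem -/

section Pressure

variable {T : ℝ} {B : Background} {S : Sources} {s : Side} {t : ℝ}

lemma laplacian_atTime (hT : 0 < T) {q : (Fin 4 → ℝ) → ℝ} (hq : IsSmooth (Cyl T s) {1, 2} q)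
    (ht : t ∈ Icc 0 T) {y : Fin 3 → ℝ} (hy : y ∈ closure (Om s)) :
    laplacian s (fun y => q (atTime t y)) y = ∑ α, dy T s α (dy T s α q) (atTime t y) := by
  refine Finset.sum_congr rfl fun α _ => ?_
  rw [pd_congr (fun z hz => pd_atTime hT hq ht hz α) hy,
    pd_atTime hT (hq.pd (isSlab_Cyl hT s) _) ht hy]
  rfl

lemma atHeight_zero_zero : atHeight 0 (0 : Fin 2 → ℝ) = 0 := by
  ext i; fin_cases i <;> rfl

section Laplace

variable {p p' : Side → (Fin 3 → ℝ) → ℝ}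

lemma IsLaplaceSolution.isSmooth (hp : IsLaplaceSolution T B S t p) (s : Side) :
    IsSmooth (Om s) {0, 1} (p s) := (hp.mem s).isSmooth (isSlab_Om s)

lemma IsLaplaceSolution.laplacian_eq (hT : 0 < T) (hS : S.Smooth T) (ht : t ∈ Icc 0 T)
    (hp : IsLaplaceSolution T B S t p) (s : Side) :
    EqOn (laplacian s (p s)) (fun y => pressureSource T B S s (atTime t y)) (closure (Om s)) := by
  refine (hp.isSmooth s).laplacian.eqOn_closure ((isSmooth_pressureSource hT hS).atTime hT ht)
    fun y hy => ?_
  have := hp.interior s y hy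
  rw [pressureSource]
  linarith

lemma isNeumann_of_wall_of_sheet {p : (Fin 3 → ℝ) → ℝ} (hp : IsSmooth (Om s) {0, 1} p)
    (hw : ∀ z, pd (Om s) 2 p (atHeight (wall s) z) = 0)
    (h0 : ∀ z, pd (Om s) 2 p (atHeight 0 z) = 0) : IsNeumann s p := by
  cases s
  · exact ⟨hp, h0, hw⟩
  · exact ⟨hp, hw, h0⟩

/-- Solutions of the coupled Laplace problem are unique up to one common constant. -/
lemma IsLaplaceSolution.exists_eq_add (hT : 0 < T) (hS : S.Smooth T) (ht : t ∈ Icc 0 T)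
    (hp : IsLaplaceSolution T B S t p) (hp' : IsLaplaceSolution T B S t p') :
    ∃ k, ∀ s, ∀ y ∈ closure (Om s), p' s y = p s y + k := by
  have hs := fun s => hp.isSmooth s
  have hs' := fun s => hp'.isSmooth s
  have hd : ∀ s, ∀ y ∈ closure (Om s), p' s y - p s y = p' s 0 - p s 0 := by
    intro s
    have h := isSlab_Om s
    have hpd : ∀ i, ∀ y ∈ closure (Om s), pd (Om s) i (fun y => p' s y - p s y) y
        = pd (Om s) i (p' s) y - pd (Om s) i (p s) y := fun i y hy => pd_sub h (hs' s) (hs s) hy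
    refine (isNeumann_of_wall_of_sheet ((hs' s).sub (hs s)) (fun z => ?_)
      fun z => ?_).eq_of_laplacian_eq_zero fun y hy => ?_
    · rw [hpd _ _ (atHeight_mem_Om (wall_mem_Icc s) z), hp.outer, hp'.outer, sub_self]
    · rw [hpd _ _ (atHeight_mem_Om (zero_mem_Icc s) z), hp.sheet, hp'.sheet, sub_self]
    · have hy' := subset_closure hy
      have e : laplacian s (fun y => p' s y - p s y) y = laplacian s (p' s) y - laplacian s (p s) y := by
        rw [laplacian, laplacian, laplacian, ← Finset.sum_sub_distrib]
        refine Finset.sum_congr rfl fun i _ => ?_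
        rw [pd_congr (hpd i) hy', pd_sub h ((hs' s).pd h i) ((hs s).pd h i) hy']
      rw [e, hp.laplacian_eq hT hS ht s hy', hp'.laplacian_eq hT hS ht s hy', sub_self]
  -- The difference is constant on each side; the jump condition at the origin, which is on the
  -- sheet, forces the two constants to coincide.
  have hj := hp.jump 0
  have hj' := hp'.jump 0
  rw [atHeight_zero_zero] at hj hj'
  refine ⟨p' .plus 0 - p .plus 0, fun s y hy => ?_⟩
  have := hd s y hy
  cases s <;> linarith

lemma IsLaplaceSolution.add_const (hp : IsLaplaceSolution T B S t p) (k : ℝ) :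
    IsLaplaceSolution T B S t fun s y => p s y + k := by
  have hpd : ∀ s i, ∀ y ∈ closure (Om s), pd (Om s) i (fun y => p s y + k) y
      = pd (Om s) i (p s) y := fun s i y hy => by
    rw [pd_add (isSlab_Om s) (hp.isSmooth s) (IsSmooth.const k) hy, pd_const (isSlab_Om s) k hy,
      add_zero]
  refine ⟨fun s => (memHInf_iff_isSmooth (isSlab_Om s)).2 ((hp.isSmooth s).add (IsSmooth.const k)),
    fun s y hy => ?_, fun s y' => ?_, fun s y' => ?_, fun y' => ?_⟩
  · rw [← hp.interior s y hy]
    congr 1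
    exact Finset.sum_congr rfl fun i _ => pd_congr (hpd s i) (subset_closure hy)
  · rw [hpd _ _ _ (atHeight_mem_Om (wall_mem_Icc s) y'), hp.outer]
  · rw [hpd _ _ _ (atHeight_mem_Om (zero_mem_Icc s) y'), hp.sheet]
  · rw [← hp.jump y']; ring

end Laplace

variable {q : Side → (Fin 4 → ℝ) → ℝ}

lemma isLaplaceSolution_slice (hT : 0 < T) (hq : ∀ s, IsSmooth (Cyl T s) {1, 2} (q s))
    (hp : ∀ s, IsPressure T B S s (q s))
    (hj : ∀ z ∈ closure (BCyl T), q .plus (atHeight 0 z) - q .minus (atHeight 0 z) = S.G5 z)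
    (ht : t ∈ Icc 0 T) : IsLaplaceSolution T B S t fun s y => q s (atTime t y) := by
  refine ⟨fun s => (memHInf_iff_isSmooth (isSlab_Om s)).2 ((hq s).atTime hT ht),
    fun s y hy => ?_, fun s y' => ?_, fun s y' => ?_, fun y' => ?_⟩
  · rw [laplacian_atTime hT (hq s) ht (subset_closure hy),
      (hp s).laplace _ (atTime_mem hT ht (subset_closure hy)), pressureSource]
    ring
  · rw [pd_atTime hT (hq s) ht (atHeight_mem_Om (wall_mem_Icc s) y'), atTime_atHeight]
    exact (hp s).wall _ (atTime_mem_BCyl hT ht y')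
  · rw [pd_atTime hT (hq s) ht (atHeight_mem_Om (zero_mem_Icc s) y'), atTime_atHeight]
    exact (hp s).sheet _ (atTime_mem_BCyl hT ht y')
  · rw [atTime_atHeight]
    exact hj _ (atTime_mem_BCyl hT ht y')

lemma isPressure_of_slices (hT : 0 < T) (hS : S.Smooth T)
    (hq : ∀ s, IsSmooth (Cyl T s) {1, 2} (q s))
    (hp : ∀ t ∈ Icc 0 T, IsLaplaceSolution T B S t fun s y => q s (atTime t y)) (s : Side) :
    IsPressure T B S s (q s) := by
  have hz : ∀ {z : Fin 3 → ℝ}, z ∈ closure (BCyl T) → z 0 ∈ Icc 0 T := fun hz =>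
    (mem_closure_BCyl hT).1 hz
  have hae : ∀ a (z : Fin 3 → ℝ), atTime (z 0) (atHeight a (Fin.tail z)) = atHeight a z :=
    fun a z => by rw [atTime_atHeight, atTime_eta]
  refine ⟨fun x hx => ?_, fun z h => ?_, fun z h => ?_⟩
  · obtain ⟨ht, hy⟩ := (mem_closure_Cyl hT).1 hx
    have hy : Fin.tail x ∈ closure (Om s) := mem_closure_Om.2 hy
    have := (hp _ ht).laplacian_eq hT hS ht s hy
    rw [laplacian_atTime hT (hq s) ht hy] at this
    simpa only [atTime_eta] using this
  · have := (hp _ (hz h)).outer s (Fin.tail z)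
    rw [pd_atTime hT (hq s) (hz h) (atHeight_mem_Om (wall_mem_Icc s) _), hae] at this
    exact this
  · have := (hp _ (hz h)).sheet s (Fin.tail z)
    rw [pd_atTime hT (hq s) (hz h) (atHeight_mem_Om (zero_mem_Icc s) _), hae, atTime_eta] at this
    exact this

/-- A function with prescribed normal derivatives that vanishes on the sheet. -/
lemma exists_neumann_lift (hT : 0 < T) (s : Side) {g₀ g₁ : (Fin 3 → ℝ) → ℝ}
    (h₀ : IsSmooth (BCyl T) {1, 2} g₀) (h₁ : IsSmooth (BCyl T) {1, 2} g₁) :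
    ∃ Ψ, IsSmooth (Cyl T s) {1, 2} Ψ ∧ (∀ x, x 3 = 0 → Ψ x = 0) ∧
      (∀ z ∈ closure (BCyl T), dy T s 2 Ψ (atHeight (wall s) z) = g₁ z) ∧
      ∀ z ∈ closure (BCyl T), dy T s 2 Ψ (atHeight 0 z) = g₀ z := by
  have h := isSlab_Cyl hT s
  have hx3 := isSmooth_apply_three (T := T) (s := s)
  -- The lift is y₃g₀ + y₃²b. Its normal derivative g₀ + 2y₃b equals g₀ on the sheet, and this
  -- choice of `b` makes it g₁ on the wall.
  set b : (Fin 3 → ℝ) → ℝ := fun z => (2 * wall s)⁻¹ * (g₁ z - g₀ z) with hbdef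
  have hb : IsSmooth (BCyl T) {1, 2} b := (h₁.sub h₀).const_mul _
  have hB := hb.comp_init (s := s) hT
  have hG := h₀.comp_init (s := s) hT
  have hd : ∀ x ∈ closure (Cyl T s), dy T s 2
      (fun x => x 3 * (g₀ (Fin.init x) + x 3 * b (Fin.init x))) x
      = g₀ (Fin.init x) + 2 * (x 3 * b (Fin.init x)) := by
    intro x hx
    show pd (Cyl T s) 3 _ x = _
    rw [pd_mul h hx3 (hG.add (hx3.mul hB)) hx, pd_add h hG (hx3.mul hB) hx, pd_mul h hx3 hB hx,
      pd_comp_init_last hT hb hx, pd_comp_init_last hT h₀ hx, pd_apply_three hT hx]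
    ring
  refine ⟨_, hx3.mul (hG.add (hx3.mul hB)), fun x hx => by simp [hx], fun z hz => ?_, fun z hz => ?_⟩
  · rw [hd _ (atHeight_mem hT (wall_mem_Icc s) hz)]
    have e1 : Fin.init (atHeight (wall s) z) = z := by simp [atHeight]
    have e2 : atHeight (wall s) z 3 = wall s := rfl
    rw [e1, e2, hbdef]
    have := wall_ne_zero s
    field_simp
    ring
  · rw [hd _ (atHeight_mem hT (zero_mem_Icc s) hz)]
    have e1 : Fin.init (atHeight 0 z) = z := by simp [atHeight]
    have e2 : atHeight 0 z 3 = 0 := rfl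
    rw [e1, e2]
    ring

/-- If the coupled Laplace problem is solvable at each time, there is a total pressure that is smooth
in space and time. -/
theorem exists_smooth_pressure (hT : 0 < T) (hS : S.Smooth T)
    (hL : ∀ t ∈ Icc 0 T, ∃ p, IsLaplaceSolution T B S t p) :
    ∃ q : Side → (Fin 4 → ℝ) → ℝ, (∀ s, IsSmooth (Cyl T s) {1, 2} (q s)) ∧
      ∀ t ∈ Icc 0 T, IsLaplaceSolution T B S t fun s y => q s (atTime t y) := by
  -- An arbitrary choice at each time, with no regularity in `t`.
  choose! p hp using hL
  choose Ψ hΨ hΨ0 hΨw hΨs using fun s => exists_neumann_lift hT s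
    (isSmooth_sheetSource hT hS (B := B) (s := s))
    ((hS.isSmooth_Fu hT s 2).atHeight hT (wall_mem_Icc s))
  have hps := fun s t ht => (hp t ht).isSmooth s
  have hΨt := fun s t (ht : t ∈ Icc 0 T) => (hΨ s).atTime hT ht
  have hΨz : ∀ s t, Ψ s (atTime t 0) = 0 := fun s t => hΨ0 s _ rfl
  have hC := fun s => isSlab_Cyl hT s
  -- Subtracting the lift makes the Neumann condition homogeneous. Subtracting the value at the
  -- origin, where the lift vanishes, removes the arbitrary constant and with it the irregular
  -- dependence on `t`.
  set P : Side → ℝ → (Fin 3 → ℝ) → ℝ := fun s t y => p t s y - Ψ s (atTime t y) - p t s 0 with hP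
  have hpd : ∀ s, ∀ t ∈ Icc 0 T, ∀ i, ∀ y ∈ closure (Om s), pd (Om s) i (P s t) y
      = pd (Om s) i (p t s) y - pd (Om s) i (fun y => Ψ s (atTime t y)) y := fun s t ht i y hy => by
    have h := isSlab_Om s
    rw [hP, pd_sub h ((hps s t ht).sub (hΨt s t ht)) (IsSmooth.const _) hy, pd_const h _ hy, sub_zero,
      pd_sub h (hps s t ht) (hΨt s t ht) hy]
  have hN : ∀ s, ∀ t ∈ Icc 0 T, IsNeumann s (P s t) := by
    intro s t ht
    refine isNeumann_of_wall_of_sheet (((hps s t ht).sub (hΨt s t ht)).sub (IsSmooth.const _))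
      (fun z => ?_) fun z => ?_
    · have hm := atHeight_mem_Om (wall_mem_Icc s) z
      have := hΨw s _ (atTime_mem_BCyl hT ht z)
      rw [hpd s t ht _ _ hm, (hp t ht).outer, pd_atTime hT (hΨ s) ht hm, atTime_atHeight]
      exact sub_eq_zero.2 this.symm
    · have hm := atHeight_mem_Om (zero_mem_Icc s) z
      have := hΨs s _ (atTime_mem_BCyl hT ht z)
      rw [hpd s t ht _ _ hm, (hp t ht).sheet, pd_atTime hT (hΨ s) ht hm, atTime_atHeight]
      exact sub_eq_zero.2 this.symm
  have hLap : ∀ s, ∀ t ∈ Icc 0 T, EqOn (laplacian s (P s t)) (fun y =>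
      (fun x => pressureSource T B S s x - ∑ α, dy T s α (dy T s α (Ψ s)) x) (atTime t y))
      (closure (Om s)) := by
    intro s t ht y hy
    have h := isSlab_Om s
    have e : laplacian s (P s t) y = laplacian s (p t s) y
        - laplacian s (fun y => Ψ s (atTime t y)) y := by
      rw [laplacian, laplacian, laplacian, ← Finset.sum_sub_distrib]
      refine Finset.sum_congr rfl fun i _ => ?_
      rw [pd_congr (hpd s t ht i) hy, pd_sub h ((hps s t ht).pd h i) ((hΨt s t ht).pd h i) hy]
    rw [e, (hp t ht).laplacian_eq hT hS ht s hy, laplacian_atTime hT (hΨ s) ht hy]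
  have hR : ∀ s, IsSmooth (Cyl T s) {1, 2}
      fun x => pressureSource T B S s x - ∑ α, dy T s α (dy T s α (Ψ s)) x := fun s =>
    (isSmooth_pressureSource hT hS).sub
      (IsSmooth.sum _ fun α _ => ((hΨ s).pd (hC s) α.succ).pd (hC s) α.succ)
  have hPs := fun s => IsNeumann.isSmooth_of_time hT (hR s) (hN s)
    (fun t _ => by simp [hP, hΨz]) (hLap s)
  -- The lift is restored, and the upper pressure is raised by the jump at the origin, which is
  -- smooth in time. The result is the chosen solution shifted by minus the value at the origin of
  -- its lower pressure.
  have hJ : ∀ s, IsSmooth (Cyl T s) {1, 2} fun x => P s (x 0) (Fin.tail x) + Ψ s x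
      + Side.rec (S.G5 (atTime (x 0) 0)) 0 s := by
    intro s
    refine ((hPs s).add (hΨ s)).add ?_
    cases s
    · exact (hS.isSmooth_G5 hT).comp_time hT
    · exact IsSmooth.const 0
  refine ⟨_, hJ, fun t ht => ?_⟩
  have := (hp t ht).add_const (-p t .minus 0)
  convert this using 1
  funext s y
  have hj := (hp t ht).jump 0
  rw [atHeight_zero_zero] at hj
  have e0 : atTime t y 0 = t := rfl
  have e1 : Fin.tail (atTime t y) = y := by simp [atTime]
  simp only [e0, e1, hP]
  cases s <;> dsimp only <;> linarith

end Pressure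

/-! ### Solvability and uniqueness -/

section Main

variable {T : ℝ} {B : Background} {S : Sources} {d : InitialData} {U V : State}

lemma IsSolution.init_closure (hT : 0 < T) (hd : d.Smooth) (hU : IsSolution T B S d U) (s : Side)
    (α : Fin 3) : EqOn (fun y => U.u s α (atTime 0 y)) (d.u s α) (closure (Om s)) ∧
      EqOn (fun y => U.H s α (atTime 0 y)) (d.H s α) (closure (Om s)) := by
  have h00 : (0 : ℝ) ∈ Icc 0 T := ⟨le_rfl, hT.le⟩
  have h := isSlab_Cyl hT s
  exact ⟨(((hU.mem_u s α).isSmooth h).atTime hT h00).eqOn_closure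
      ((hd.u s α).isSmooth (isSlab_Om s)) fun y hy => hU.init_u s α y hy,
    (((hU.mem_H s α).isSmooth h).atTime hT h00).eqOn_closure
      ((hd.H s α).isSmooth (isSlab_Om s)) fun y hy => hU.init_H s α y hy⟩

lemma IsSolution.isPressure_and_isSourceCompat (hT : 0 < T) (hS : S.Smooth T)
    (hU : IsSolution T B S d U) (s : Side) :
    IsPressure T B S s (U.q s) ∧ IsSourceCompat T B S s :=
  VortexSheet.isPressure_and_isSourceCompat hT hS ((hU.mem_q s).isSmooth (isSlab_Cyl hT s))
    ((hU.isElsasser hT hS s (by norm_num)).isElsCompat hT)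
    ((hU.isElsasser hT hS s (by norm_num)).isElsCompat hT)

lemma IsSolution.isLaplaceSolution (hT : 0 < T) (hS : S.Smooth T) (hU : IsSolution T B S d U)
    {t : ℝ} (ht : t ∈ Icc 0 T) : IsLaplaceSolution T B S t fun s y => U.q s (atTime t y) := by
  refine isLaplaceSolution_slice hT (fun s => (hU.mem_q s).isSmooth (isSlab_Cyl hT s))
    (fun s => (hU.isPressure_and_isSourceCompat hT hS s).1) (fun z hz => ?_) ht
  have := hU.sheet_q (z 0) ((mem_closure_BCyl hT).1 hz) (Fin.tail z)
  rwa [atTime_atHeight, atTime_eta] at this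

/-- The compatibility conditions are necessary. -/
theorem IsSolution.compatible (hT : 0 < T) (hS : S.Smooth T) (hd : d.Smooth)
    (hU : IsSolution T B S d U) : Compatible T B S d := by
  have h00 : (0 : ℝ) ∈ Icc 0 T := ⟨le_rfl, hT.le⟩
  have hc := fun s => (hU.isPressure_and_isSourceCompat hT hS s).2
  have hi := hU.init_closure hT hd
  have hdiv : ∀ s (w : Fin 3 → (Fin 4 → ℝ) → ℝ) (w0 : Fin 3 → (Fin 3 → ℝ) → ℝ),
      (∀ α, HInfCyl T s (w α)) → (∀ α, EqOn (fun y => w α (atTime 0 y)) (w0 α) (closure (Om s))) →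
      ∀ y ∈ Om s, divSpace s w0 y = div T s w (atTime 0 y) := fun s w w0 hw hw0 y hy =>
    Finset.sum_congr rfl fun α _ => (pd_congr (hw0 α) (subset_closure hy)).symm.trans
      (pd_atTime hT ((hw α).isSmooth (isSlab_Cyl hT s)) h00 (subset_closure hy) α)
  refine ⟨fun s t ht y' => ?_, fun s t ht y' => ?_, fun s t ht y hy => ?_, fun s y hy => ?_,
    fun s y hy => ?_, fun s y' => ?_, fun s y' => ?_, fun s y' => ?_, fun s y' => ?_,
    fun t ht => ⟨_, hU.isLaplaceSolution hT hS ht⟩⟩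
  · rw [atTime_atHeight]; exact (hc s).wall _ (atTime_mem_BCyl hT ht y')
  · rw [atTime_atHeight]; exact (hc s).sheet _ (atTime_mem_BCyl hT ht y')
  · exact (hc s).div _ (atTime_mem hT ht (subset_closure hy))
  · rw [hdiv s _ _ (hU.mem_u s) (fun α => (hi s α).1) y hy, hU.div_u s 0 h00 y hy]
  · rw [hdiv s _ _ (hU.mem_H s) (fun α => (hi s α).2) y hy, hU.div_H s 0 h00 y hy]
  · rw [← (hi s 2).1 (atHeight_mem_Om (wall_mem_Icc s) y')]; exact hU.wall_u s 0 h00 y'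
  · rw [← (hi s 2).2 (atHeight_mem_Om (wall_mem_Icc s) y')]; exact hU.wall_H s 0 h00 y'
  · rw [← (hi s 2).1 (atHeight_mem_Om (zero_mem_Icc s) y')]; exact hU.sheet_u s 0 h00 y'
  · rw [← (hi s 2).2 (atHeight_mem_Om (zero_mem_Icc s) y')]; exact hU.sheet_H s 0 h00 y'

/-- Solutions are unique up to a shift of the total pressure. -/
theorem IsSolution.eqUpToPressureShift (hT : 0 < T) (hS : S.Smooth T) (hd : d.Smooth)
    (hU : IsSolution T B S d U) (hV : IsSolution T B S d V) : EqUpToPressureShift T U V := by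
  choose! c hc using fun t (ht : t ∈ Icc 0 T) =>
    (hU.isLaplaceSolution hT hS ht).exists_eq_add hT hS ht (hV.isLaplaceSolution hT hS ht)
  have hq : ∀ s, ∀ x ∈ closure (Cyl T s), V.q s x = U.q s x + c (x 0) := fun s x hx => by
    obtain ⟨ht, hy⟩ := (mem_closure_Cyl hT).1 hx
    have := hc _ ht s (Fin.tail x) (mem_closure_Om.2 hy)
    rwa [atTime_eta] at this
  -- Only spatial derivatives are compared, slice by slice, so no regularity of `c` in time is
  -- required.
  have hdq : ∀ s α, ∀ x ∈ closure (Cyl T s), dy T s α (V.q s) x = dy T s α (U.q s) x := by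
    intro s α x hx
    have h := isSlab_Om s
    obtain ⟨ht, hy⟩ := (mem_closure_Cyl hT).1 hx
    have hy : Fin.tail x ∈ closure (Om s) := mem_closure_Om.2 hy
    have hu := (hU.mem_q s).isSmooth (isSlab_Cyl hT s)
    have e1 := pd_atTime hT hu ht hy α
    have e2 := pd_atTime hT ((hV.mem_q s).isSmooth (isSlab_Cyl hT s)) ht hy α
    rw [pd_congr (fun y hy => hc _ ht s y hy) hy, pd_add h (hu.atTime hT ht) (IsSmooth.const _) hy,
      pd_const h _ hy, add_zero, e1, atTime_eta] at e2
    exact e2.symm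
  have hw : ∀ ε : ℝ, ε * ε = 1 → ∀ s α, ∀ x ∈ closure (Cyl T s),
      V.u s α x + ε * V.H s α x = U.u s α x + ε * U.H s α x := fun ε hε s =>
    (hU.isElsasser hT hS s hε).unique hT (hV.isElsasser hT hS s hε) (hdq s) fun α y hy => by
      have a1 := (hU.init_closure hT hd s α).1 hy
      have a2 := (hU.init_closure hT hd s α).2 hy
      have b1 := (hV.init_closure hT hd s α).1 hy
      have b2 := (hV.init_closure hT hd s α).2 hy
      dsimp only at a1 a2 b1 b2 ⊢
      rw [a1, a2, b1, b2]
  refine ⟨c, fun s x hx => ⟨fun α => ?_, fun α => ?_, hq s x hx⟩⟩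
  · linarith [hw 1 (by norm_num) s α x hx, hw (-1) (by norm_num) s α x hx]
  · linarith [hw 1 (by norm_num) s α x hx, hw (-1) (by norm_num) s α x hx]

/-- The compatibility conditions are sufficient. -/
theorem Compatible.exists_isSolution (hT : 0 < T) (hS : S.Smooth T) (hd : d.Smooth)
    (hC : Compatible T B S d) : ∃ U, IsSolution T B S d U := by
  have h00 : (0 : ℝ) ∈ Icc 0 T := ⟨le_rfl, hT.le⟩
  have hz : ∀ {z : Fin 3 → ℝ}, z ∈ closure (BCyl T) → z 0 ∈ Icc 0 T := fun hz =>
    (mem_closure_BCyl hT).1 hz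
  have hae : ∀ a (z : Fin 3 → ℝ), atTime (z 0) (atHeight a (Fin.tail z)) = atHeight a z :=
    fun a z => by rw [atTime_atHeight, atTime_eta]
  obtain ⟨q, hq, hqt⟩ := exists_smooth_pressure hT hS hC.laplace
  have hdu := fun s α => (hd.u s α).isSmooth (isSlab_Om s)
  have hdH := fun s α => (hd.H s α).isSmooth (isSlab_Om s)
  have hsc : ∀ s, IsSourceCompat T B S s := by
    intro s
    have h := isSlab_Cyl hT s
    refine ⟨((hS.isSmooth_F8 hT s).pd h 0).eqOn_of_slices
      (IsSmooth.sum _ fun α _ => (hS.isSmooth_FH hT s α).pd h α.succ) (hC.div_sources s),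
      fun z h => ?_, fun z h => ?_⟩
    · rw [← hae]; exact hC.wall_F6 s _ (hz h) _
    · have := hC.sheet_F6 s _ (hz h) (Fin.tail z)
      rw [hae, atTime_eta] at this
      exact this
  have hdiv : ∀ {s} {w0 : Fin 3 → (Fin 3 → ℝ) → ℝ} {f : (Fin 4 → ℝ) → ℝ},
      (∀ α, IsSmooth (Om s) {0, 1} (w0 α)) → IsSmooth (Cyl T s) {1, 2} f →
      (∀ y ∈ Om s, divSpace s w0 y = f (atTime 0 y)) →
      ∀ y ∈ closure (Om s), divSpace s w0 y = f (atTime 0 y) := fun {s} {w0} {f} hw0 hf h =>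
    IsSmooth.eqOn_closure (IsSmooth.sum _ fun α _ => (hw0 α).pd (isSlab_Om s) α)
      (hf.atTime hT h00) h
  have key : ∀ ε : ℝ, ε * ε = 1 → ∀ s, ∃ w, IsElsasser T B S s ε (q s) w ∧
      ∀ α, ∀ y ∈ closure (Om s), w α (atTime 0 y) = d.u s α y + ε * d.H s α y := by
    intro ε hε s
    refine ((isPressure_of_slices hT hS hq hqt s).isElsCompat hT hS (hq s) (hsc s)
      hε).exists_isElsasser hT hS (hq s) (w0 := fun α y => d.u s α y + ε * d.H s α y)
      (fun α => (hdu s α).add ((hdH s α).const_mul ε)) (fun y hy => ?_) (fun y' => ?_) fun y' => ?_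
    · have e : divSpace s (fun α y => d.u s α y + ε * d.H s α y) y
          = divSpace s (d.u s) y + ε * divSpace s (d.H s) y := by
        simp only [divSpace, pd_add_mul (isSlab_Om s) ε (hdu s _) (hdH s _) hy,
          Finset.sum_add_distrib, Finset.mul_sum]
      rw [e, hdiv (hdu s) (hS.isSmooth_F7 hT s) (hC.div_init_u s) y hy,
        hdiv (hdH s) (hS.isSmooth_F8 hT s) (hC.div_init_H s) y hy]
    · rw [hC.wall_init_u, hC.wall_init_H]; ring
    · rw [hC.sheet_init_u, hC.sheet_init_H]
  choose w₁ h1 hi1 using key 1 (by norm_num)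
  choose w₂ h2 hi2 using key (-1) (by norm_num)
  refine ⟨_, isSolution_of_isElsasser hT hq h1 h2 (fun z h => ?_) (fun s α y hy => ?_)
    fun s α y hy => ?_⟩
  · have := (hqt _ (hz h)).jump (Fin.tail z)
    simpa only [hae, atTime_eta] using this
  · rw [hi1 s α y hy]; ring
  · rw [hi2 s α y hy]; ring

/-- Adding a function of time to the total pressure. -/
lemma IsSolution.shift (hT : 0 < T) (hU : IsSolution T B S d U) {k : ℝ → ℝ}
    (hk : ∀ s, IsSmooth (Cyl T s) {1, 2} fun x => k (x 0)) :
    IsSolution T B S d ⟨U.u, U.H, fun s x => U.q s x + k (x 0)⟩ := by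
  have hC := fun s => isSlab_Cyl hT s
  have hq := fun s => (hU.mem_q s).isSmooth (hC s)
  have e : ∀ s, ∀ t ∈ Icc 0 T, ∀ y ∈ Om s, ∀ α,
      dy T s α (fun x => U.q s x + k (x 0)) (atTime t y) = dy T s α (U.q s) (atTime t y) := by
    intro s t ht y hy α
    have hy' := subset_closure hy
    have h0 : pd (Cyl T s) α.succ (fun x => k (x 0)) (atTime t y) = 0 := by
      rw [← pd_atTime hT (hk s) ht hy' α]
      exact pd_const (isSlab_Om s) (k t) hy'
    rw [dy, pd_add (hC s) (hq s) (hk s) (atTime_mem hT ht hy'), h0, add_zero]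
    rfl
  exact
    { mem_u := hU.mem_u
      mem_H := hU.mem_H
      mem_q := fun s => (memHInf_iff_isSmooth (hC s)).2 ((hq s).add (hk s))
      momentum := fun s t ht y hy α => by
        dsimp only
        rw [e s t ht y hy α]; exact hU.momentum s t ht y hy α
      induction := hU.induction
      div_u := hU.div_u
      div_H := hU.div_H
      wall_u := hU.wall_u
      wall_H := hU.wall_H
      sheet_u := hU.sheet_u
      sheet_H := hU.sheet_H
      sheet_q := fun t ht y' => by
        rw [← hU.sheet_q t ht y']
        have : ∀ y : Fin 3 → ℝ, atTime t y 0 = t := fun _ => rfl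
        simp only [this]
        ring
      init_u := hU.init_u
      init_H := hU.init_H }

lemma measureReal_cellOm_pos (s : Side) : 0 < volume.real (Om s ∩ cell {0, 1}) := by
  refine ENNReal.toReal_pos (ne_of_gt ?_) (isSlab_Om s).volume_cell_lt_top.ne
  have hpi := Real.pi_pos
  have ho : IsOpen (Om s ∩ slab (fun _ => 0) (fun _ => 2 * Real.pi) {2}) :=
    (isSlab_Om s).isOpen.inter isOpen_slab
  have hne : (Om s ∩ slab (fun _ => 0) (fun _ => 2 * Real.pi) {2}).Nonempty := by
    refine ⟨![Real.pi, Real.pi, (lo s + hi s) / 2], ?_, ?_⟩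
    · have := lo_lt_hi s
      show (_ : ℝ) ∈ I s
      rw [I_eq]
      constructor <;> simp <;> linarith
    · intro i hi
      fin_cases i
      · constructor <;> simp <;> linarith
      · constructor <;> simp <;> linarith
      · simp at hi
  refine (ho.measure_pos volume hne).trans_le (measure_mono fun y hy => ⟨hy.1, fun i hi => ?_⟩)
  have := hy.2 i (by rcases hi with rfl | rfl <;> simp)
  exact Ioo_subset_Ioc_self this

lemma integral_add_const_cellOm {s : Side} {f : (Fin 3 → ℝ) → ℝ} (hf : IsSmooth (Om s) {0, 1} f)
    (k : ℝ) : ∫ y in Om s ∩ cell {0, 1}, (f y + k)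
      = (∫ y in Om s ∩ cell {0, 1}, f y) + volume.real (Om s ∩ cell {0, 1}) * k := by
  rw [integral_add hf.integrableOn (IsSmooth.const k).integrableOn, setIntegral_const, smul_eq_mul]

/-- A solution can be normalised. -/
lemma IsSolution.exists_normalized (hT : 0 < T) (hU : IsSolution T B S d U) :
    ∃ V, IsSolution T B S d V ∧ Normalized T V := by
  have hq := fun s => (hU.mem_q s).isSmooth (isSlab_Cyl hT s)
  set v := fun s => volume.real (Om s ∩ cell {0, 1})
  have hv : v .plus + v .minus ≠ 0 :=
    (add_pos (measureReal_cellOm_pos .plus) (measureReal_cellOm_pos .minus)).ne'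
  set m : Side → ℝ → ℝ := fun s t => ∫ y in Om s ∩ cell {0, 1}, U.q s (atTime t y) with hm
  -- Minus the mean of the total pressure over both cells together; it is smooth in time because
  -- slice integrals are.
  set k : ℝ → ℝ := fun t => -(v .plus + v .minus)⁻¹ * (m .plus t + m .minus t) with hk
  refine ⟨_, hU.shift hT (k := k) fun s => (((hq .plus).integral_slice hT s).add
    ((hq .minus).integral_slice hT s)).const_mul _, fun t ht => ?_⟩
  have e : ∀ y : Fin 3 → ℝ, atTime t y 0 = t := fun _ => rfl
  simp only [e]
  rw [integral_add_const_cellOm ((hq .plus).atTime hT ht),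
    integral_add_const_cellOm ((hq .minus).atTime hT ht)]
  change m .plus t + v .plus * k t + (m .minus t + v .minus * k t) = 0
  simp only [hk]
  field_simp
  ring

/-- The two normalisation integrals differ by `c t` times the total volume of the two cells, which
is positive. -/
lemma IsSolution.eq_zero_of_normalized (hT : 0 < T) (hU : IsSolution T B S d U)
    (hn : Normalized T U) (hn' : Normalized T V) {c : ℝ → ℝ}
    (hc : ∀ s, ∀ x ∈ closure (Cyl T s), V.q s x = U.q s x + c (x 0)) :
    ∀ t ∈ Icc 0 T, c t = 0 := by
  intro t ht
  have hq := fun s => (hU.mem_q s).isSmooth (isSlab_Cyl hT s)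
  have e : ∀ s, ∫ y in Om s ∩ cell {0, 1}, V.q s (atTime t y)
      = (∫ y in Om s ∩ cell {0, 1}, U.q s (atTime t y))
        + volume.real (Om s ∩ cell {0, 1}) * c t := fun s => by
    rw [← integral_add_const_cellOm ((hq s).atTime hT ht)]
    exact setIntegral_congr_fun (measurableSet_cellOm s) fun y hy =>
      hc s _ (atTime_mem hT ht (subset_closure hy.1))
  have h1 := hn t ht
  have h2 := hn' t ht
  rw [e, e] at h2
  have hv := add_pos (measureReal_cellOm_pos .plus) (measureReal_cellOm_pos .minus)
  have : (volume.real (Om .plus ∩ cell {0, 1}) + volume.real (Om .minus ∩ cell {0, 1})) * c t = 0 := by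
    linarith
  exact (mul_eq_zero.1 this).resolve_left hv.ne'

end Main

end VortexSheet

end

theorem mainTheorem6 (T : ℝ) (hT : 0 < T) (B : VortexSheet.Background)
    (S : VortexSheet.Sources) (hS : S.Smooth T)
    (d : VortexSheet.InitialData) (hd : d.Smooth) :
    ((∃ U, VortexSheet.IsSolution T B S d U ∧
        ∀ V, VortexSheet.IsSolution T B S d V → VortexSheet.EqUpToPressureShift T U V) ↔
      VortexSheet.Compatible T B S d) ∧
    ((∃ U, VortexSheet.IsSolution T B S d U ∧ VortexSheet.Normalized T U ∧
        ∀ V, VortexSheet.IsSolution T B S d V → VortexSheet.Normalized T V →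
          VortexSheet.EqOnDomain T U V) ↔
      VortexSheet.Compatible T B S d) := by
  refine ⟨⟨fun ⟨U, hU, _⟩ => hU.compatible hT hS hd, fun hC => ?_⟩,
    fun ⟨U, hU, _⟩ => hU.compatible hT hS hd, fun hC => ?_⟩
  · obtain ⟨U, hU⟩ := hC.exists_isSolution hT hS hd
    exact ⟨U, hU, fun V hV => hU.eqUpToPressureShift hT hS hd hV⟩
  · obtain ⟨U, hU⟩ := hC.exists_isSolution hT hS hd
    obtain ⟨V, hV, hn⟩ := hU.exists_normalized hT
    refine ⟨V, hV, hn, fun W hW hnW s x hx => ?_⟩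
    obtain ⟨c, hc⟩ := hV.eqUpToPressureShift hT hS hd hW
    have h0 := hV.eq_zero_of_normalized hT hn hnW (fun s x hx => (hc s x hx).2.2) (x 0)
      ((VortexSheet.mem_closure_Cyl hT).1 hx).1
    obtain ⟨h1, h2, h3⟩ := hc s x hx
    exact ⟨h1, h2, by rw [h3, h0, add_zero]⟩
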